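/- Let $S^3\subset\mathbb R^4$ be the unit sphere with round metric, its volume form ($\operatorname{vol}S^3=2\pi^2$, outward-normal orientation), let $\mathfrak{sdiff}(S^3)$ be the smooth divergence-free vector fields, with bracket $[t,s]^i=t^j\partial_js^i-s^j\partial_jt^i$, and let $K=\mathfrak{so}(4)\subset\mathfrak{sdiff}(S^3)$ be the infinitesimal rotations $p\mapsto Bp$, $B^T=-B$. Let $\mathcal V_\alpha$, $\alpha=(j,m,\tilde m,\epsilon)$, $j\ge1$, $\epsilon=\pm1$, be the complex divergence-free vector harmonics: for each $(j,\epsilon)$ they span the $SO(4)$-representation with $SU(2)$ spins $(Q,\tilde Q)=(\frac{j+\epsilon}2,\frac{j-\epsilon}2)$, on which the curl is $-\epsilon(j+1)$; $m$, $\tilde m$ are the weights; they are $L^2$-orthonormal, and $(\mathcal V_{j,m,\tilde m,\epsilon})^*=(-1)^{m+\tilde m+1}\mathcal V_{j,-m,-\tilde m,\epsilon}$. Put $E^{\alpha\beta\gamma}=\oint_{S^3}\epsilon_{ijk}\mathcal V_\alpha^i\mathcal V_\beta^j\mathcal V_\gamma^k$. Let $M$ be the space of all elements of $\mathfrak{sdiff}(S^3)$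 whose harmonic coefficients with $j=1$ vanish. Let $U\subset\mathbb R^3$ be an open set (a coordinate patch of the spacetime). For an $\mathfrak{sdiff}(S^3)$-valued one-form $s^i$ on $U$ with potential $A_i$, $s^i=\epsilon^{ijk}\partial_jA_k$, let $L(s)=\oint_{S^3}\big(ds^i\wedge A_i-\frac13\epsilon_{ijk}s^i\wedge s^j\wedge s^k\big)$ be the Nambu--Chern--Simons (NCS) Lagrangian, and $S(s)=\int_UL(s)$. Its field equations are $F=0$, where $F_{\mu\nu}=\partial_\mu s_\nu-\partial_\nu s_\mu+[s_\mu,s_\nu]$; in modes $s=\sum_\alpha s_\alpha\mathcal V_\alpha$ they read $$2\epsilon_\alpha\,d(s_\alpha)^*+(j_\alpha+1)\sum_{\beta,\gamma}s_\beta\wedge s_\gamma\,E^{\alpha\beta\gamma}=0\quad\text{for all }\alpha .\qquad(*)$$ 1. $K$ is a Lie subalgebra, its complexification $K_{\mathbb C}$ is the span of the $\mathcal V_\alpha$ with $j_\alpha=1$, and $\mathfrak{sdiff}(S^3)=K\oplus M$. 2. $[M,K]\subseteq M$. The same holds for the complexifications $M_{\mathbb C}$, $K_{\mathbb C}$. Moreover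 the span of the $\mathcal V_\alpha$ with $j_\alpha>1$ lies in $M_{\mathbb C}$ and is itself preserved by bracketing with $K_{\mathbb C}$. 3. On $K$-valued fields the NCS theory is an $SO(4)$ Chern--Simons theory. Let $E^-_a(p)=i_ap$ and $E^+_a(p)=-p\,i_a$, where $p$ is regarded as a unit quaternion and $(i_1,i_2,i_3)=(i,j,k)$. Every element of $K$ is uniquely of the form $\sum_a(s_+^aE_a^++s_-^aE_a^-)$. Correspondingly, for a smooth $K$-valued $s$, with components $s_\pm=s_\pm^a\sigma^a$ in terms of the Pauli matrices, a potential exists, and for every potential that is smooth on $S^3$ $$\frac2{\pi^2}L(s)=\operatorname{tr}\big(s_-\wedge ds_-+\tfrac23i\,s_-^3\big)-\operatorname{tr}\big(s_+\wedge ds_++\tfrac23i\,s_+^3\big),$$ and likewise for the actions over $U$. The gauge transformations $\delta_\xi s=d\xi-[\xi,s]$ with smooth $K$-valued parameter $\xi$ preserve $K$-valued fields, on which they act by $\delta s_\pm^c=d\xi_\pm^c+2\epsilon_{abc}\xi_\pm^as_\pm^b$. If $\xi$ has compact support in $U$, then $\int_U\delta_\xi L(s)=0$ for every smooth $K$-valued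 $s$. 4. Call truncated equations the equations $(*)$ for $j_\alpha=1$ with the sum restricted to $j_\beta=j_\gamma=1$. If smooth modes $\bar s_\alpha$, $j_\alpha=1$, solve the truncated equations, then their extension by zero, $s_\alpha=\delta_{j_\alpha,1}\bar s_\alpha$, solves all equations $(*)$. If moreover the $\bar s_\alpha$ satisfy the reality condition $(\bar s_{j,m,\tilde m,\epsilon})^*=(-1)^{m+\tilde m+1}\bar s_{j,-m,-\tilde m,\epsilon}$, then $s=\sum_{j_\alpha=1}\bar s_\alpha\mathcal V_\alpha$ is a smooth $K$-valued field, and the truncated equations for $\bar s$ are equivalent to the first-order equations of Euclidean de Sitter gravity of unit radius $$de^a+\omega^{ab}\wedge e^b=0,\qquad d\omega^{ab}+\omega^{ac}\wedge\omega^{cb}=e^a\wedge e^b$$ for $e^a=s_+^a-s_-^a$ and $\omega^{ab}=\epsilon_{abc}(s_+^c+s_-^c)$. For every smooth $K$-valued $s$ these equations are equivalent to the full field equations $F=0$. -/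

import Mathlib

open MeasureTheory Set
open scoped Manifold ContDiff

namespace NCS

noncomputable section

/-! ### Calculus on the round unit three-sphere -/

/-- The ambient Euclidean space `ℝ⁴`. -/
abbrev E4 : Type := EuclideanSpace ℝ (Fin 4)

/-- The unit three-sphere. -/
abbrev S3 : Type := Metric.sphere (0 : E4) 1

instance factFinrankE4 : Fact (Module.finrank ℝ E4 = 3 + 1) := ⟨by simp⟩

/-- The volume measure of the round metric (total mass `2 π ^ 2`). -/
abbrev S3vol : Measure S3 := (volume : Measure E4).toSphere

/-- The point `(1, 0, 0, 0)`. -/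
def north : S3 := ⟨EuclideanSpace.single 0 1, by simp⟩

/-- Radial projection of `ℝ⁴ ∖ {0}` onto the sphere (the value at `0` is irrelevant). -/
def toS3 (y : E4) : S3 :=
  if h : y = 0 then north
  else ⟨‖y‖⁻¹ • y, by
    rw [mem_sphere_zero_iff_norm, norm_smul, norm_inv, norm_norm,
      inv_mul_cancel₀ (norm_ne_zero_iff.mpr h)]⟩

/-- `S³`-dependent vectors of `𝕜⁴`; the tangent ones are the vector fields on `S³`, real for
`𝕜 = ℝ` and complexified for `𝕜 = ℂ`. By means of the round metric the same objects serve as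
one-forms on `S³`. -/
abbrev VF (𝕜 : Type) : Type := S3 → Fin 4 → 𝕜

/-- The derivative of a function on the sphere at `p` in the direction of the `i`-th coordinate
vector, projected to the tangent space at `p`: the function is extended to `ℝ⁴ ∖ {0}` by making it
constant along rays. -/
def tderiv {F : Type} [NormedAddCommGroup F] [NormedSpace ℝ F] (i : Fin 4) (f : S3 → F) (p : S3) :
    F :=
  fderiv ℝ (fun y : E4 => f (toS3 y)) p (EuclideanSpace.single i 1)

section Operators

variable {𝕜 : Type} [RCLike 𝕜]

/-- Pointwise tangency to the sphere. -/
def IsTangent (X : VF 𝕜) : Prop := ∀ p : S3, ∑ i, ((p.1 i : ℝ) : 𝕜) * X p i = 0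

/-- Smoothness of a vector field. -/
def IsSmooth (X : VF 𝕜) : Prop := ContMDiff (𝓡 3) 𝓘(ℝ, Fin 4 → 𝕜) ∞ X

/-- The Lie bracket `[X, Y] = X^j ∂_j Y - Y^j ∂_j X`. -/
def bracket (X Y : VF 𝕜) : VF 𝕜 := fun p i =>
  ∑ k, (X p k * tderiv k Y p i - Y p k * tderiv k X p i)

/-- The divergence with respect to the round volume form. -/
def div (X : VF 𝕜) : S3 → 𝕜 := fun p => ∑ i, tderiv i X p i

/-- The `i`-th coordinate vector of `𝕜⁴`. -/
def basisVec (𝕜 : Type) [RCLike 𝕜] (i : Fin 4) : Fin 4 → 𝕜 := Pi.single i 1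

/-- The round volume form `ε_{ijk} u^i v^j w^k` on the tangent space at `p`; the sphere is oriented
by its outward normal `p`. -/
def volForm (p : S3) (u v w : Fin 4 → 𝕜) : 𝕜 :=
  Matrix.det (Matrix.of ![fun i => ((p.1 i : ℝ) : 𝕜), u, v, w])

/-- The curl `ε^{ijk} ∂_j X_k` of a vector field (or one-form) with respect to the round metric. -/
def curl (X : VF 𝕜) : VF 𝕜 := fun p i =>
  ∑ k, volForm p (basisVec 𝕜 i) (basisVec 𝕜 k) (tderiv k X p)

end Operators

/-- The Lie algebra `sdiff(S³)` of smooth divergence-free vector fields (complexified for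
`𝕜 = ℂ`). -/
def sdiffS3 (𝕜 : Type) [RCLike 𝕜] : Set (VF 𝕜) :=
  {X | IsSmooth X ∧ IsTangent X ∧ ∀ p, div X p = 0}

/-- Complexification of a real vector field. -/
def toC (X : VF ℝ) : VF ℂ := fun p i => ((X p i : ℝ) : ℂ)

/-- The linear vector field `p ↦ B p`. -/
def linField (B : Matrix (Fin 4) (Fin 4) ℝ) : VF ℝ := fun p => B.mulVec (fun i => p.1 i)

/-- `K = so(4)`: the infinitesimal rotations of the sphere. -/
def so4 : Set (VF ℝ) := {X | ∃ B ∈ LieAlgebra.Orthogonal.so (Fin 4) ℝ, X = linField B}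

/-! ### The two `su(2)` factors of `so(4)` -/

/-- The left-invariant fields `p ↦ p i, p j, p k` on the unit quaternions
`p = p₀ + p₁ i + p₂ j + p₃ k`. -/
def leftInv (a : Fin 3) : VF ℝ :=
  linField (![!![0, -1, 0, 0; 1, 0, 0, 0; 0, 0, 0, 1; 0, 0, -1, 0],
    !![0, 0, -1, 0; 0, 0, 0, -1; 1, 0, 0, 0; 0, 1, 0, 0],
    !![0, 0, 0, -1; 0, 0, 1, 0; 0, -1, 0, 0; 1, 0, 0, 0]] a)

/-- The right-invariant fields `p ↦ i p, j p, k p` on the unit quaternions. -/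
def rightInv (a : Fin 3) : VF ℝ :=
  linField (![!![0, -1, 0, 0; 1, 0, 0, 0; 0, 0, 0, -1; 0, 0, 1, 0],
    !![0, 0, -1, 0; 0, 0, 0, 1; 1, 0, 0, 0; 0, -1, 0, 0],
    !![0, 0, 0, -1; 0, 0, -1, 0; 0, 1, 0, 0; 1, 0, 0, 0]] a)

/-- The element of `su(2) ⊕ su(2)` with the components `c 1` (sector `ε = +`) and `c (-1)` (sector
`ε = -`), as a vector field. The basis `(E₁, E₂, E₃)` of each factor used here, `- leftInv`
for `ε = +` and `rightInv` for `ε = -`, satisfies `[E_a, E_b] = - 2 ε_{abc} E_c`. -/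
def so4Field (c : ℤˣ → Fin 3 → ℝ) : VF ℝ := fun p i =>
  ∑ a, (c (-1) a * rightInv a p i - c 1 a * leftInv a p i)

/-! ### Divergence-free vector harmonics -/

/-- The index `α = (j, M, ε)` of a vector harmonic: `j ≥ 1`, `ε = ±1`. The spins are
`Q = (j + ε) / 2`, `Q' = (j - ε) / 2`, and `M = (m, m')` with `-Q ≤ m ≤ Q`, `-Q' ≤ m' ≤ Q'` is
encoded by the natural numbers `k = Q - m ≤ 2 Q` and `l = Q' - m' ≤ 2 Q'`. -/
@[ext]
structure HIndex where
  j : ℕ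
  one_le_j : 1 ≤ j
  ε : ℤˣ
  k : ℕ
  l : ℕ
  hk : (k : ℤ) ≤ j + ε
  hl : (l : ℤ) ≤ j - ε

namespace HIndex

/-- `2 Q = j + ε`. -/
def twoQ (α : HIndex) : ℕ := ((α.j : ℤ) + α.ε).toNat

/-- `2 Q' = j - ε`. -/
def twoQt (α : HIndex) : ℕ := ((α.j : ℤ) - α.ε).toNat

/-- The index `(j, -M, ε)`. -/
def neg (α : HIndex) : HIndex where
  j := α.j
  one_le_j := α.one_le_j
  ε := α.ε
  k := α.twoQ - α.k
  l := α.twoQt - α.l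
  hk := by have := α.hk; have := Int.natCast_nonneg α.k; simp only [twoQ]; omega
  hl := by have := α.hl; have := Int.natCast_nonneg α.l; simp only [twoQt]; omega

/-- The sign `(-1) ^ (m + m' + 1)`, where `m + m' = j - k - l`. -/
def conjSign (α : HIndex) : ℂ := (-1) ^ (α.j + α.k + α.l + 1)

end HIndex

/-- The lowering operator `J₁ - i J₂` of the first `su(2)`, where `J_a = (i / 2) ℒ_{leftInv a}`. -/
def lowerQ (X : VF ℂ) : VF ℂ :=
  (Complex.I / 2) • (bracket (toC (leftInv 0)) X - Complex.I • bracket (toC (leftInv 1)) X)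

/-- The lowering operator of the second `su(2)`, where `J_a = - (i / 2) ℒ_{rightInv a}`. -/
def lowerQt (X : VF ℂ) : VF ℂ :=
  (-(Complex.I / 2)) • (bracket (toC (rightInv 0)) X - Complex.I • bracket (toC (rightInv 1)) X)

/-- The highest weight field `z ^ (j - 1) (F₁ + i F₂)`, `z = p₁ + i p₂`, where `F` is the left-invariant
frame for `ε = +` and the right-invariant frame for `ε = -`. -/
def highestWeight (j : ℕ) (ε : ℤˣ) : VF ℂ := fun p i =>
  (((p.1 1 : ℝ) : ℂ) + Complex.I * ((p.1 2 : ℝ) : ℂ)) ^ (j - 1) *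
    (if ε = 1 then toC (leftInv 0) p i + Complex.I * toC (leftInv 1) p i
      else toC (rightInv 0) p i + Complex.I * toC (rightInv 1) p i)

open scoped Nat in
/-- The divergence-free vector harmonics `V_α`: the highest weight field, lowered `Q - m` and
`Q' - m'` times, and normalised. They form the `SO(4)` representation with spins `(Q, Q')`, with
`div V_α = 0`, `curl V_α = - ε (j + 1) V_α`, `∮ V_α* · V_β = δ_{αβ}` and
`V_{jMε}* = (-1) ^ (m + m' + 1) V_{j(-M)ε}`. -/
def V (α : HIndex) : VF ℂ :=
  ((α.ε : ℤ) * Complex.I * (Real.sqrt α.j / (2 * Real.pi) : ℝ) *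
      (Real.sqrt (((α.twoQ - α.k)! : ℝ) / ((α.twoQ)! * (α.k)!)) : ℝ) *
      (Real.sqrt (((α.twoQt - α.l)! : ℝ) / ((α.twoQt)! * (α.l)!)) : ℝ)) •
    (lowerQ^[α.k] (lowerQt^[α.l] (highestWeight α.j α.ε)))

/-- The coefficient of `V_α` in the harmonic expansion of `X`. -/
def coeff (X : VF ℂ) (α : HIndex) : ℂ := ∫ p, ∑ i, (starRingEnd ℂ) (V α p i) * X p i ∂S3vol

/-- The coefficients `E^{αβγ} = ∮ ε_{ijk} V_{iα} V_{jβ} V_{kγ}`. -/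
def E (α β γ : HIndex) : ℂ := ∫ p, volForm p (V α p) (V β p) (V γ p) ∂S3vol

/-- The complement `M` of `so(4)` in the basis of vector harmonics: the elements of `sdiff(S³)` whose
harmonic expansion contains no mode with `j = 1`. -/
def M : Set (VF ℝ) := {X | X ∈ sdiffS3 ℝ ∧ ∀ α : HIndex, α.j = 1 → coeff (toC X) α = 0}

/-- The complexification of `M`. -/
def MC : Set (VF ℂ) := {X | X ∈ sdiffS3 ℂ ∧ ∀ α : HIndex, α.j = 1 → coeff X α = 0}

/-- The complexification of `K`, spanned by the harmonics with `j = 1`. -/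
def KC : Submodule ℂ (VF ℂ) := Submodule.span ℂ (V '' {α | α.j = 1})

/-- The algebraic span of the harmonics with `j > 1`. -/
def harmonicSpan : Submodule ℂ (VF ℂ) := Submodule.span ℂ (V '' {α | 1 < α.j})

/-- The indices with `j = 1`. -/
abbrev SO4Index : Type := {α : HIndex // α.j = 1}

instance finiteSO4Index : Finite SO4Index := by
  have hb : ∀ α : SO4Index, α.1.k < 3 ∧ α.1.l < 3 := by
    rintro ⟨α, hα⟩
    have h1 := α.hk
    have h2 := α.hl
    rw [hα] at h1 h2
    rcases Int.units_eq_one_or α.ε with h | h <;> simp [h] at h1 h2 <;> constructor <;>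
      simp only <;> omega
  refine Finite.of_injective
    (fun α : SO4Index => ((α.1.ε, ⟨α.1.k, (hb α).1⟩, ⟨α.1.l, (hb α).2⟩) : ℤˣ × Fin 3 × Fin 3)) ?_
  rintro ⟨α, hα⟩ ⟨β, hβ⟩ h
  simp only [Prod.mk.injEq, Fin.mk.injEq] at h
  exact Subtype.ext (HIndex.ext (hα.trans hβ.symm) h.1 h.2.1 h.2.2)

instance fintypeSO4Index : Fintype SO4Index := Fintype.ofFinite _

/-! ### The Nambu-Chern-Simons theory, in a coordinate patch of the three-dimensional spacetime -/

/-- Spacetime coordinates. -/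
abbrev X3 : Type := Fin 3 → ℝ

/-- The partial derivative `∂_μ`. -/
def pd {F : Type} [NormedAddCommGroup F] [NormedSpace ℝ F] (μ : Fin 3) (f : X3 → F) (x : X3) : F :=
  fderiv ℝ f x (Pi.single μ 1)

/-- The component with respect to `dx⁰ ∧ dx¹ ∧ dx²` of a three-form given as
`T_{μνρ} dx^μ ∧ dx^ν ∧ dx^ρ`. -/
def topForm {R : Type} [AddCommGroup R] (T : Fin 3 → Fin 3 → Fin 3 → R) : R :=
  ∑ σ : Equiv.Perm (Fin 3), (Equiv.Perm.sign σ : ℤ) • T (σ 0) (σ 1) (σ 2)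

/-- A gauge field `s_μ^i(x, σ)`, or the family `A_{μ i}(x, σ)` of its potentials. -/
abbrev GaugeField : Type := X3 → Fin 3 → VF ℝ

/-- `A` is a potential of `s` over `U`: `s^i = ε^{ijk} ∂_j A_k`. -/
def IsPotential (U : Set X3) (s A : GaugeField) : Prop :=
  ∀ x ∈ U, ∀ μ, IsSmooth (A x μ) ∧ IsTangent (A x μ) ∧ curl (A x μ) = s x μ

/-- The Lagrangian `∮ (ds^i ∧ A_i - (1/3) ε_{ijk} s^i ∧ s^j ∧ s^k)`. -/
def ncsLagrangian (s A : GaugeField) (x : X3) : ℝ :=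
  ∫ p, topForm (fun μ ν ρ =>
    ∑ i, pd μ (fun y => s y ν p i) x * A x ρ p i
      - (1 / 3) * volForm p (s x μ p) (s x ν p) (s x ρ p)) ∂S3vol

/-- The action over `U`. -/
def ncsAction (U : Set X3) (s A : GaugeField) : ℝ := ∫ x in U, ncsLagrangian s A x

/-- The full field equations `F = 0`, i.e. `∂_μ s_ν - ∂_ν s_μ + [s_μ, s_ν] = 0`. -/
def NCSFieldEquation (U : Set X3) (s : GaugeField) : Prop :=
  ∀ x ∈ U, ∀ μ ν p i,
    pd μ (fun y => s y ν p i) x - pd ν (fun y => s y μ p i) x + bracket (s x μ) (s x ν) p i = 0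

/-- The infinitesimal gauge transformation `δ_ξ s = dξ - [ξ, s]`. -/
def gaugeVar (ξ : X3 → VF ℝ) (s : GaugeField) : GaugeField := fun x μ p i =>
  pd μ (fun y => ξ y p i) x - bracket (ξ x) (s x μ) p i

/-- An `su(2) ⊕ su(2)` gauge field; `A x ε μ a` is the component `A^a_μ(x)` in the sector `ε`. -/
abbrev SO4Connection : Type := X3 → ℤˣ → Fin 3 → Fin 3 → ℝ

/-- The `so(4)`-valued gauge field of an `SO4Connection`. -/
def so4GaugeField (A : SO4Connection) : GaugeField := fun x μ => so4Field (fun ε a => A x ε μ a)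

/-- The Levi-Civita symbol. -/
def levi (a b c : Fin 3) : ℝ :=
  Matrix.det ((1 : Matrix (Fin 3) (Fin 3) ℝ).submatrix ![a, b, c] id)

/-- `c^a σ_a` with the Pauli matrices `σ_a`. -/
def pauli (c : Fin 3 → ℝ) : Matrix (Fin 2) (Fin 2) ℂ :=
  (c 0 : ℂ) • !![0, 1; 1, 0] + (c 1 : ℂ) • !![0, -Complex.I; Complex.I, 0]
    + (c 2 : ℂ) • !![1, 0; 0, -1]

/-- The `SU(2)` Chern-Simons Lagrangian `tr (A ∧ dA + (2/3) i A ∧ A ∧ A)`, `A = A^a σ_a`, of the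
sector `ε`. -/
def csLagrangian (A : SO4Connection) (ε : ℤˣ) (x : X3) : ℂ :=
  topForm (fun μ ν ρ =>
    Matrix.trace (pauli (A x ε μ) * pauli (fun a => pd ν (fun y => A y ε ρ a) x)
      + (2 / 3 * Complex.I) • (pauli (A x ε μ) * pauli (A x ε ν) * pauli (A x ε ρ))))

/-- The Lagrangian of `SO(4)` Chern-Simons theory. -/
def so4CSLagrangian (A : SO4Connection) (x : X3) : ℂ := csLagrangian A (-1) x - csLagrangian A 1 x

/-- The action of `SO(4)` Chern-Simons theory. -/
def so4CSAction (U : Set X3) (A : SO4Connection) : ℂ := ∫ x in U, so4CSLagrangian A x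

/-- The `su(2) ⊕ su(2)` gauge transformation `dξ^c + 2 ε_{abc} ξ^a A^b`. -/
def so4GaugeVar (ξ : X3 → ℤˣ → Fin 3 → ℝ) (A : SO4Connection) : SO4Connection := fun x ε μ c =>
  pd μ (fun y => ξ y ε c) x + 2 * ∑ a, ∑ b, levi a b c * ξ x ε a * A x ε μ b

/-- The dreibein `e^a = A_+^a - A_-^a`. -/
def dreibein (A : SO4Connection) (x : X3) (μ a : Fin 3) : ℝ := A x 1 μ a - A x (-1) μ a

/-- The spin connection `ω^{ab} = ε_{abc} (A_+^c + A_-^c)`. -/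
def spinConn (A : SO4Connection) (x : X3) (μ a b : Fin 3) : ℝ :=
  ∑ c, levi a b c * (A x 1 μ c + A x (-1) μ c)

/-- The equations of Euclidean de Sitter gravity of unit radius in first-order form, vanishing torsion
`de^a + ω^{ab} ∧ e^b = 0` and curvature `dω^{ab} + ω^{ac} ∧ ω^{cb} = e^a ∧ e^b`. -/
def DeSitterGravity (U : Set X3) (A : SO4Connection) : Prop :=
  ∀ x ∈ U, ∀ μ ν,
    (∀ a, pd μ (fun y => dreibein A y ν a) x - pd ν (fun y => dreibein A y μ a) x
      + ∑ b, (spinConn A x μ a b * dreibein A x ν b - spinConn A x ν a b * dreibein A x μ b) = 0) ∧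
    (∀ a b, pd μ (fun y => spinConn A y ν a b) x - pd ν (fun y => spinConn A y μ a b) x
      + ∑ c, (spinConn A x μ a c * spinConn A x ν c b - spinConn A x ν a c * spinConn A x μ c b)
      = dreibein A x μ a * dreibein A x ν b - dreibein A x ν a * dreibein A x μ b)

/-! ### The theory in harmonics -/

/-- Modes `s_{α μ}(x)` of a gauge field `s_μ = ∑_α s_{α μ} V_α`. -/
abbrev Modes (ι : Type) : Type := ι → Fin 3 → X3 → ℂ

/-- The reality condition `(s_{jMε})* = (-1) ^ (m + m' + 1) s_{j(-M)ε}`. -/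
def RealModes (U : Set X3) (s : Modes HIndex) : Prop :=
  ∀ α μ, ∀ x ∈ U, (starRingEnd ℂ) (s α μ x) = α.conjSign * s α.neg μ x

/-- The components `(d (s_α)*)_{μν}`. -/
def dStar {ι : Type} (s : Modes ι) (α : ι) (μ ν : Fin 3) (x : X3) : ℂ :=
  pd μ (fun y => (starRingEnd ℂ) (s α ν y)) x - pd ν (fun y => (starRingEnd ℂ) (s α μ y)) x

/-- The components `(s_β ∧ s_γ)_{μν}`. -/
def wedge {ι : Type} (s : Modes ι) (β γ : ι) (μ ν : Fin 3) (x : X3) : ℂ :=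
  s β μ x * s γ ν x - s β ν x * s γ μ x

/-- The full field equations
`2 ε_α d(s_α)* + (j_α + 1) ∑_{β,γ} s_β ∧ s_γ E^{αβγ} = 0` for all `α`, the convergence of the series
being part of the equations. -/
def FullModeEquations (U : Set X3) (s : Modes HIndex) : Prop :=
  ∀ x ∈ U, ∀ α μ ν, ∃ T : ℂ,
    HasSum (fun q : HIndex × HIndex => wedge s q.1 q.2 μ ν x * E α q.1 q.2) T ∧
    2 * ((α.ε : ℤ) : ℂ) * dStar s α μ ν x + ((α.j : ℂ) + 1) * T = 0

/-- The truncated field equations: the same, with only the modes `j = 1` kept. -/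
def TruncatedModeEquations (U : Set X3) (s : Modes SO4Index) : Prop :=
  ∀ x ∈ U, ∀ (α : SO4Index) (μ ν : Fin 3),
    2 * ((α.1.ε : ℤ) : ℂ) * dStar s α μ ν x
      + ((α.1.j : ℂ) + 1) * ∑ β : SO4Index, ∑ γ : SO4Index, wedge s β γ μ ν x * E α β γ = 0

/-- Extension by zero of the modes with `j = 1` to all modes. -/
def extendByZero (s : Modes SO4Index) : Modes HIndex := fun α μ x =>
  if h : α.j = 1 then s ⟨α, h⟩ μ x else 0

/-- Smoothness of the modes over `U`. -/
def SmoothModes (U : Set X3) (s : Modes SO4Index) : Prop :=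
  ∀ α μ, ContDiffOn ℝ ∞ (s α μ) U

end

end NCS

open NCS

namespace NCS

/-! ### Radial extension of functions on the sphere -/

/-! Everything rests on the action of so(4) on functions and fields by derivatives along the linear
fields p ↦ Bp. With the sphere as the unit quaternions, so(4) is the sum of two commuting copies of
su(2), generated by left and by right multiplications; the basis `basisMat ε a` obeys the same
quaternion relations in both sectors. Rotations preserve the measure, so derivatives along these
fields integrate to zero (`integral_rot`), and the Lie derivative is skew-adjoint for the L² pairing
(`ip_lieD`).

The harmonics with j = 1 are the basis fields of so(4) up to a constant invertible matrix
(`V_so4Idx`, `spinOne_complete`). Hence M is the orthogonal complement of so(4) in sdiff, which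
gives the direct sum. A bracket with so(4) is a Lie derivative, which keeps a field tangent and
divergence-free (`IsTangent.lieD`, `div_lieD`) and, by skew-adjointness, orthogonal to so(4)
(`lieEnd_mem_perpSub`); so [M, K] ⊆ M. For the algebraic span of the higher harmonics one uses the
sl(2) string formulas in each sector. Positivity of the Hermitian form makes the strings stop at the
edge of the index range (`lower_pow_eq_zero`). The highest weight fields with j > 1 are orthogonal
to so(4) because their weight in the sector opposite to any given basis field is nonzero
(`topVF_mem_perpSub`).

For the Lagrangian, the basis fields are curl eigenfields with eigenvalue -2ε, and the curl is
symmetric when paired with them. So the pairing of an so(4) field with a potential depends only on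
the curl of the potential, whichever potential is taken (`ip_frame_curl`). The cubic term needs the
integrated triple product of a divergence-free X with two basis fields (`integral_volForm_comb`).
Within one sector the cross product of two basis fields is again a basis field. For one field from
each sector it is, up to a normal part, a gradient, hence orthogonal to X
(`integral_volForm_left_right`). The sectors therefore decouple into two Chern-Simons forms of
opposite sign. The same formula gives E^{αβγ} = 0 for j_α > 1 and j_β = j_γ = 1 (`E_eq_zero`), so
modes with j = 1 do not source the others and the truncation is consistent.

The remaining claims are linear algebra in the frame components. The truncated mode equations, F = 0
and the gravity equations all say that both su(2) curvatures vanish: torsion is the difference of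
the two, and the curvature equation is their sum. The gauge variation of the Chern-Simons form is
the exact form dA ∧ dξ, which integrates to zero for compactly supported ξ. -/

lemma coe_ne_zero (p : S3) : (p : E4) ≠ 0 := by
  intro h
  have := p.2
  rw [mem_sphere_zero_iff_norm, h, norm_zero] at this
  exact zero_ne_one this

lemma coe_toS3 {y : E4} (hy : y ≠ 0) : (toS3 y : E4) = ‖y‖⁻¹ • y := by
  simp [toS3, hy]

@[simp] lemma toS3_coe (p : S3) : toS3 (p : E4) = p := by
  apply Subtype.ext
  rw [coe_toS3 (coe_ne_zero p), mem_sphere_zero_iff_norm.1 p.2]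
  simp

lemma toS3_smul {r : ℝ} (hr : 0 < r) (y : E4) : toS3 (r • y) = toS3 y := by
  by_cases hy : y = 0
  · simp [hy]
  · apply Subtype.ext
    rw [coe_toS3 hy, coe_toS3 (smul_ne_zero hr.ne' hy), norm_smul, Real.norm_of_nonneg hr.le,
      smul_smul]
    congr 1
    field_simp

lemma contDiffOn_coe_toS3 : ContDiffOn ℝ ∞ (fun y : E4 => (toS3 y : E4)) {0}ᶜ := by
  have : ContDiffOn ℝ ∞ (fun y : E4 => ‖y‖⁻¹ • y) {0}ᶜ :=
    ContDiffOn.smul (ContDiffOn.inv (contDiffOn_id.norm ℝ fun x hx => hx)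
      fun (x : E4) (hx : x ≠ 0) => norm_ne_zero_iff.2 hx) contDiffOn_id
  exact this.congr fun y hy => coe_toS3 hy

lemma isOpen_compl_zero : IsOpen ({0}ᶜ : Set E4) := isOpen_compl_singleton

section Smooth

variable {F : Type} [NormedAddCommGroup F] [NormedSpace ℝ F]

/-- Smoothness of a function on the sphere, expressed by its radial extension. -/
def RadSmooth (f : S3 → F) : Prop := ContDiffOn ℝ ∞ (fun y => f (toS3 y)) {0}ᶜ

/-- The radial projection is smooth on the punctured space and restricts to the identity on the
sphere, so f and its radial extension are obtained from each other by composition with smooth maps.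
-/
lemma contMDiff_iff_radSmooth (f : S3 → F) :
    ContMDiff (𝓡 3) 𝓘(ℝ, F) ∞ f ↔ RadSmooth f := by
  constructor
  · intro hf
    -- Smoothness of a map into the sphere is a statement about maps of manifolds, so the punctured
    -- space is treated as an open submanifold.
    let U : TopologicalSpace.Opens E4 := ⟨{0}ᶜ, isOpen_compl_zero⟩
    have h0 : ContMDiff 𝓘(ℝ, E4) 𝓘(ℝ, E4) ∞ (fun y : U => (toS3 (y : E4) : E4)) := by
      intro y
      rw [contMDiffAt_subtype_iff (U := U) (f := fun y : E4 => (toS3 y : E4))]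
      exact (contDiffOn_coe_toS3.contDiffAt (isOpen_compl_zero.mem_nhds y.2)).contMDiffAt
    have h1 : ContMDiff 𝓘(ℝ, E4) (𝓡 3) ∞ (fun y : U => toS3 (y : E4)) := by
      have := h0.codRestrict_sphere (n := 3) (fun y => (toS3 (y : E4)).2)
      exact this
    intro y hy
    have h2 := (hf.comp h1) ⟨y, hy⟩
    have h3 := (contMDiffAt_subtype_iff (U := U) (f := fun y : E4 => f (toS3 y))
      (x := ⟨y, hy⟩)).1 h2
    exact h3.contDiffAt.contDiffWithinAt
  · intro hf p
    have h1 : ContMDiffAt (𝓡 3) 𝓘(ℝ, E4) ∞ (fun q : S3 => (q : E4)) p := contMDiff_coe_sphere p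
    have h2 : ContMDiffAt 𝓘(ℝ, E4) 𝓘(ℝ, F) ∞ (fun y => f (toS3 y)) (p : E4) :=
      (hf.contDiffAt (isOpen_compl_zero.mem_nhds (coe_ne_zero p))).contMDiffAt
    have h3 := ContMDiffAt.comp p h2 h1
    simpa [Function.comp_def] using h3

namespace RadSmooth

variable {f g : S3 → F}

lemma contDiffAt (hf : RadSmooth f) {y : E4} (hy : y ≠ 0) :
    ContDiffAt ℝ ∞ (fun y => f (toS3 y)) y :=
  ContDiffOn.contDiffAt hf (isOpen_compl_zero.mem_nhds hy)

lemma differentiableAt (hf : RadSmooth f) {y : E4} (hy : y ≠ 0) :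
    DifferentiableAt ℝ (fun y => f (toS3 y)) y :=
  (hf.contDiffAt hy).differentiableAt (by simp)

lemma continuous (hf : RadSmooth f) : Continuous f :=
  ((contMDiff_iff_radSmooth f).2 hf).continuous

lemma integrable (hf : RadSmooth f) : Integrable f S3vol := by
  have := hf.continuous.continuousOn.integrableOn_compact (μ := S3vol) isCompact_univ
  simpa using this

lemma of_contDiffOn {f : S3 → F} {G : E4 → F} (hG : ContDiffOn ℝ ∞ G {0}ᶜ)
    (h : ∀ p : S3, f p = G p) : RadSmooth f := by
  have : (fun y => f (toS3 y)) = G ∘ (fun y : E4 => (toS3 y : E4)) := by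
    funext y; simp [h]
  rw [RadSmooth, this]
  exact hG.comp contDiffOn_coe_toS3 fun y _ => coe_ne_zero _

lemma const (c : F) : RadSmooth (fun _ => c) := contDiffOn_const

lemma add (hf : RadSmooth f) (hg : RadSmooth g) : RadSmooth (fun p => f p + g p) :=
  ContDiffOn.add hf hg

lemma sub (hf : RadSmooth f) (hg : RadSmooth g) : RadSmooth (fun p => f p - g p) :=
  ContDiffOn.sub hf hg

lemma sum {ι : Type*} {s : Finset ι} {f : ι → S3 → F} (hf : ∀ i ∈ s, RadSmooth (f i)) :
    RadSmooth (fun p => ∑ i ∈ s, f i p) := ContDiffOn.sum hf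

lemma clm {G : Type} [NormedAddCommGroup G] [NormedSpace ℝ G] (L : F →L[ℝ] G)
    (hf : RadSmooth f) : RadSmooth (fun p => L (f p)) := L.contDiff.comp_contDiffOn hf

lemma mul {A : Type} [NormedRing A] [NormedAlgebra ℝ A] {f g : S3 → A} (hf : RadSmooth f)
    (hg : RadSmooth g) : RadSmooth (fun p => f p * g p) := ContDiffOn.mul hf hg

lemma pow {A : Type} [NormedCommRing A] [NormedAlgebra ℝ A] {f : S3 → A} (hf : RadSmooth f)
    (n : ℕ) : RadSmooth (fun p => f p ^ n) := ContDiffOn.pow hf n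

lemma coord (i : Fin 4) : RadSmooth (fun p : S3 => p.1 i) :=
  of_contDiffOn (G := fun y => y i) (by fun_prop) fun _ => rfl

lemma pi {ι : Type} [Fintype ι] {f : S3 → ι → F} (hf : ∀ i, RadSmooth (fun p => f p i)) :
    RadSmooth f := contDiffOn_pi.2 hf

lemma apply {ι : Type} [Fintype ι] {f : S3 → ι → F} (hf : RadSmooth f) (i : ι) :
    RadSmooth (fun p => f p i) := contDiffOn_pi.1 hf i

end RadSmooth

end Smooth

/-! ### Derivatives along linear vector fields -/

/-- A matrix as a continuous linear endomorphism of `ℝ⁴`. -/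
noncomputable abbrev mclm (B : Matrix (Fin 4) (Fin 4) ℝ) : E4 →L[ℝ] E4 :=
  Matrix.toEuclideanCLM (𝕜 := ℝ) B

lemma mclm_apply (B : Matrix (Fin 4) (Fin 4) ℝ) (y : E4) (i : Fin 4) :
    mclm B y i = ∑ k, B i k * y k := by
  simp [mclm, Matrix.mulVec, dotProduct]

lemma linField_apply (B : Matrix (Fin 4) (Fin 4) ℝ) (p : S3) (i : Fin 4) :
    linField B p i = ∑ k, B i k * p.1 k := by
  simp [linField, Matrix.mulVec, dotProduct]

section Rot

variable {F : Type} [NormedAddCommGroup F] [NormedSpace ℝ F]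

/-- The derivative of a function along the linear vector field `p ↦ B p`. -/
noncomputable def rot (B : Matrix (Fin 4) (Fin 4) ℝ) (f : S3 → F) (p : S3) : F :=
  fderiv ℝ (fun y : E4 => f (toS3 y)) p (mclm B p)

lemma sum_single (v : E4) : v = ∑ k, v k • EuclideanSpace.single k (1 : ℝ) := by
  ext i; simp [Pi.single_apply]

lemma rot_eq_sum (B : Matrix (Fin 4) (Fin 4) ℝ) (f : S3 → F) (p : S3) :
    rot B f p = ∑ k, linField B p k • tderiv k f p := by
  rw [rot, sum_single (mclm B p), map_sum]
  simp only [map_smul, tderiv, mclm_apply, linField_apply]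

/-- The radial derivative of a function that is constant along rays vanishes. -/
lemma fderiv_radial (f : S3 → F) {y : E4} :
    fderiv ℝ (fun y : E4 => f (toS3 y)) y y = 0 := by
  by_cases hd : DifferentiableAt ℝ (fun y : E4 => f (toS3 y)) y
  · have h1 : HasDerivAt (fun t : ℝ => t • y) y 1 := by
      simpa using (hasDerivAt_id (1 : ℝ)).smul_const y
    have h2 : HasFDerivAt (fun y : E4 => f (toS3 y))
        (fderiv ℝ (fun y : E4 => f (toS3 y)) y) ((1 : ℝ) • y) := by
      simpa using hd.hasFDerivAt
    have h3 := h2.comp_hasDerivAt (1 : ℝ) h1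
    have h4 : (fun t : ℝ => f (toS3 (t • y))) =ᶠ[nhds 1] fun _ => f (toS3 y) := by
      filter_upwards [lt_mem_nhds (zero_lt_one (α := ℝ))] with t ht
      rw [toS3_smul ht]
    have h5 : HasDerivAt (fun t : ℝ => f (toS3 (t • y))) 0 1 :=
      (hasDerivAt_const (1 : ℝ) (f (toS3 y))).congr_of_eventuallyEq h4
    exact h3.unique h5
  -- Where the extension is not differentiable, `fderiv` is zero by convention.
  · simp [fderiv_zero_of_not_differentiableAt hd]

lemma sum_coord_tderiv (f : S3 → F) (p : S3) : ∑ k, p.1 k • tderiv k f p = 0 := by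
  have := fderiv_radial f (y := (p : E4))
  rw [sum_single (p : E4), map_sum] at this
  simp only [map_smul] at this
  rw [← sum_single] at this
  exact this

/-- The derivative of the radial extension is homogeneous of degree `-1`. -/
lemma fderiv_smul_radial (f : S3 → F) {r : ℝ} (hr : 0 < r) (y v : E4) :
    fderiv ℝ (fun y : E4 => f (toS3 y)) (r • y) v
      = r⁻¹ • fderiv ℝ (fun y : E4 => f (toS3 y)) y v := by
  have h : (fun z : E4 => f (toS3 (r • z))) = fun z => f (toS3 z) := by
    funext z; rw [toS3_smul hr]
  have h2 := fderiv_comp_smul (𝕜 := ℝ) (f := fun y : E4 => f (toS3 y)) (c := r) (x := y)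
  rw [h] at h2
  rw [h2]
  simp [smul_smul, hr.ne']

/-- The derivative of a radially constant function has degree -1 and y ↦ By has degree 1, so the
factors ‖y‖ cancel. This makes derivatives along linear fields easy to iterate. -/
lemma rot_toS3 (B : Matrix (Fin 4) (Fin 4) ℝ) (f : S3 → F) {y : E4} (hy : y ≠ 0) :
    rot B f (toS3 y) = fderiv ℝ (fun y : E4 => f (toS3 y)) y (mclm B y) := by
  have hn : 0 < ‖y‖ := norm_pos_iff.2 hy
  rw [rot, coe_toS3 hy, fderiv_smul_radial f (inv_pos.2 hn), map_smul, map_smul, smul_smul]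
  simp [hn.ne']

lemma tderiv_toS3 (i : Fin 4) (f : S3 → F) {y : E4} (hy : y ≠ 0) :
    tderiv i f (toS3 y) = ‖y‖ • fderiv ℝ (fun y : E4 => f (toS3 y)) y
      (EuclideanSpace.single i 1) := by
  have hn : 0 < ‖y‖ := norm_pos_iff.2 hy
  rw [tderiv, coe_toS3 hy, fderiv_smul_radial f (inv_pos.2 hn), inv_inv]

lemma contDiffOn_fderiv_radial {f : S3 → F} (hf : RadSmooth f) :
    ContDiffOn ℝ ∞ (fderiv ℝ (fun y : E4 => f (toS3 y))) {0}ᶜ :=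
  ContDiffOn.fderiv_of_isOpen hf isOpen_compl_zero (by simp)

lemma RadSmooth.rot {f : S3 → F} (hf : RadSmooth f) (B : Matrix (Fin 4) (Fin 4) ℝ) :
    RadSmooth (rot B f) :=
  RadSmooth.of_contDiffOn (G := fun y => fderiv ℝ (fun y : E4 => f (toS3 y)) y
    (mclm B y)) ((contDiffOn_fderiv_radial hf).clm_apply (mclm B).contDiff.contDiffOn)
    fun _ => rfl

lemma rot_add_matrix (B C : Matrix (Fin 4) (Fin 4) ℝ) (f : S3 → F) (p : S3) :
    rot (B + C) f p = rot B f p + rot C f p := by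
  simp [rot, mclm]

lemma rot_smul_matrix (r : ℝ) (B : Matrix (Fin 4) (Fin 4) ℝ) (f : S3 → F) (p : S3) :
    rot (r • B) f p = r • rot B f p := by
  simp [rot, mclm]

lemma rot_add (B : Matrix (Fin 4) (Fin 4) ℝ) {f g : S3 → F} (hf : RadSmooth f)
    (hg : RadSmooth g) (p : S3) : rot B (fun p => f p + g p) p = rot B f p + rot B g p := by
  have := fderiv_fun_add (hf.differentiableAt (coe_ne_zero p)) (hg.differentiableAt (coe_ne_zero p))
  simp only [rot, this, add_apply]

lemma rot_clm {G : Type} [NormedAddCommGroup G] [NormedSpace ℝ G] (L : F →L[ℝ] G)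
    (B : Matrix (Fin 4) (Fin 4) ℝ) {f : S3 → F} (hf : RadSmooth f) (p : S3) :
    rot B (fun p => L (f p)) p = L (rot B f p) := by
  have := L.hasFDerivAt.comp (p : E4) (hf.differentiableAt (coe_ne_zero p)).hasFDerivAt
  have h2 := this.fderiv
  simp only [Function.comp_def] at h2
  simp [rot, h2]

lemma tderiv_clm {G : Type} [NormedAddCommGroup G] [NormedSpace ℝ G] (L : F →L[ℝ] G)
    (i : Fin 4) {f : S3 → F} (hf : RadSmooth f) (p : S3) :
    tderiv i (fun p => L (f p)) p = L (tderiv i f p) := by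
  have := L.hasFDerivAt.comp (p : E4) (hf.differentiableAt (coe_ne_zero p)).hasFDerivAt
  have h2 := this.fderiv
  simp only [Function.comp_def] at h2
  simp [tderiv, h2]

lemma tderiv_add (i : Fin 4) {f g : S3 → F} (hf : RadSmooth f)
    (hg : RadSmooth g) (p : S3) :
    tderiv i (fun p => f p + g p) p = tderiv i f p + tderiv i g p := by
  have := fderiv_fun_add (hf.differentiableAt (coe_ne_zero p)) (hg.differentiableAt (coe_ne_zero p))
  simp only [tderiv, this, add_apply]

lemma tderiv_sum {ι : Type*} {s : Finset ι} (i : Fin 4) {f : ι → S3 → F}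
    (hf : ∀ j ∈ s, RadSmooth (f j)) (p : S3) :
    tderiv i (fun p => ∑ j ∈ s, f j p) p = ∑ j ∈ s, tderiv i (f j) p := by
  have := fderiv_fun_sum (u := s) (A := fun j (y : E4) => f j (toS3 y)) (x := (p : E4)) (𝕜 := ℝ)
    (fun j hj => (hf j hj).differentiableAt (coe_ne_zero p))
  simp only [tderiv, this, sum_apply]

lemma tderiv_mul {A : Type} [NormedCommRing A] [NormedAlgebra ℝ A] (i : Fin 4) {f g : S3 → A}
    (hf : RadSmooth f) (hg : RadSmooth g) (p : S3) :
    tderiv i (fun p => f p * g p) p = f p * tderiv i g p + g p * tderiv i f p := by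
  have := fderiv_fun_mul (hf.differentiableAt (coe_ne_zero p)) (hg.differentiableAt (coe_ne_zero p))
  simp [tderiv, this]

lemma rot_mul {A : Type} [NormedCommRing A] [NormedAlgebra ℝ A] (B : Matrix (Fin 4) (Fin 4) ℝ)
    {f g : S3 → A} (hf : RadSmooth f) (hg : RadSmooth g) (p : S3) :
    rot B (fun p => f p * g p) p = f p * rot B g p + g p * rot B f p := by
  have := fderiv_fun_mul (hf.differentiableAt (coe_ne_zero p)) (hg.differentiableAt (coe_ne_zero p))
  simp [rot, this]

lemma rot_sum {ι : Type*} {s : Finset ι} (B : Matrix (Fin 4) (Fin 4) ℝ) {f : ι → S3 → F}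
    (hf : ∀ j ∈ s, RadSmooth (f j)) (p : S3) :
    rot B (fun p => ∑ j ∈ s, f j p) p = ∑ j ∈ s, rot B (f j) p := by
  have := fderiv_fun_sum (u := s) (A := fun j (y : E4) => f j (toS3 y)) (x := (p : E4)) (𝕜 := ℝ)
    (fun j hj => (hf j hj).differentiableAt (coe_ne_zero p))
  simp only [rot, this, sum_apply]

lemma rot_pow {A : Type} [NormedCommRing A] [NormedAlgebra ℝ A] (B : Matrix (Fin 4) (Fin 4) ℝ)
    {f : S3 → A} (hf : RadSmooth f) (n : ℕ) (p : S3) :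
    rot B (fun p => f p ^ n) p = n * f p ^ (n - 1) * rot B f p := by
  have := fderiv_fun_pow n (hf.differentiableAt (coe_ne_zero p))
  simp [rot, this, mul_assoc]

lemma tderiv_pow {A : Type} [NormedCommRing A] [NormedAlgebra ℝ A] (i : Fin 4)
    {f : S3 → A} (hf : RadSmooth f) (n : ℕ) (p : S3) :
    tderiv i (fun p => f p ^ n) p = n * f p ^ (n - 1) * tderiv i f p := by
  have := fderiv_fun_pow n (hf.differentiableAt (coe_ne_zero p))
  simp [tderiv, this, mul_assoc]

lemma tderiv_apply {ι : Type} [Fintype ι] (i : Fin 4) {f : S3 → ι → F} (hf : RadSmooth f) (j : ι)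
    (p : S3) : tderiv i (fun p => f p j) p = tderiv i f p j :=
  tderiv_clm (ContinuousLinearMap.proj j : (ι → F) →L[ℝ] F) i hf p

lemma rot_apply {ι : Type} [Fintype ι] (B : Matrix (Fin 4) (Fin 4) ℝ) {f : S3 → ι → F}
    (hf : RadSmooth f) (j : ι) (p : S3) : rot B (fun p => f p j) p = rot B f p j :=
  rot_clm (ContinuousLinearMap.proj j : (ι → F) →L[ℝ] F) B hf p

lemma tderiv_const (i : Fin 4) (c : F) (p : S3) : tderiv i (fun _ => c) p = 0 := by
  simp [tderiv]

/-- The tangential derivative of the restriction of a linear function. -/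
lemma tderiv_linear (L : E4 →L[ℝ] F) (i : Fin 4) (p : S3) :
    tderiv i (fun p : S3 => L p) p = L (EuclideanSpace.single i 1) - p.1 i • L p := by
  have hp : ‖(p : E4)‖ = 1 := mem_sphere_zero_iff_norm.1 p.2
  have h1 : (fun y : E4 => L (toS3 y)) =ᶠ[nhds (p : E4)] fun y => ‖y‖⁻¹ • L y := by
    filter_upwards [isOpen_compl_zero.mem_nhds (coe_ne_zero p)] with y hy
    rw [coe_toS3 hy, map_smul]
  have hn : HasFDerivAt (fun y : E4 => ‖y‖) (innerSL ℝ (p : E4)) (p : E4) := by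
    -- The norm is differentiated as the square root of ‖y‖², at a point where it equals 1.
    have h2 := (hasStrictFDerivAt_norm_sq (p : E4)).hasFDerivAt.sqrt (by simp)
    have h4 : (2⁻¹ : ℝ) • 2 • innerSL ℝ (p : E4) = innerSL ℝ (p : E4) := by
      rw [← Nat.cast_smul_eq_nsmul ℝ, smul_smul]; norm_num
    simpa [Real.sqrt_sq (norm_nonneg _), hp, h4] using h2
  have h3 := ((hasDerivAt_inv (x := ‖(p : E4)‖) (by simp)).comp_hasFDerivAt (p : E4) hn).fun_smul L.hasFDerivAt
  rw [tderiv, h1.fderiv_eq]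
  erw [h3.fderiv]
  simp [hp, EuclideanSpace.inner_single_right, sub_eq_add_neg]

/-- The commutator of derivatives along linear vector fields. -/
lemma rot_comm (B C : Matrix (Fin 4) (Fin 4) ℝ) {f : S3 → F} (hf : RadSmooth f) (p : S3) :
    rot B (rot C f) p - rot C (rot B f) p = rot (C * B - B * C) f p := by
  -- The Hessian term is symmetric in the two directions and cancels in the commutator; what
  -- survives is the derivative of the coefficient field, with the matrices in reversed order.
  have key : ∀ B C : Matrix (Fin 4) (Fin 4) ℝ, rot B (rot C f) p
      = fderiv ℝ (fderiv ℝ (fun y : E4 => f (toS3 y))) p (mclm B p) (mclm C p)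
        + fderiv ℝ (fun y : E4 => f (toS3 y)) p (mclm C (mclm B p)) := by
    intro B C
    have h1 : (fun y : E4 => rot C f (toS3 y)) =ᶠ[nhds (p : E4)]
        fun y => fderiv ℝ (fun y : E4 => f (toS3 y)) y (mclm C y) := by
      filter_upwards [isOpen_compl_zero.mem_nhds (coe_ne_zero p)] with y hy
      exact rot_toS3 C f hy
    have h2 : DifferentiableAt ℝ (fderiv ℝ (fun y : E4 => f (toS3 y))) p :=
      ((contDiffOn_fderiv_radial hf).contDiffAt
        (isOpen_compl_zero.mem_nhds (coe_ne_zero p))).differentiableAt (by simp)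
    have h3 := h2.hasFDerivAt.clm_apply (mclm C).hasFDerivAt (x := (p : E4))
    rw [rot, h1.fderiv_eq, h3.fderiv]
    simp [add_comm]
  have hs : IsSymmSndFDerivAt ℝ (fun y : E4 => f (toS3 y)) p :=
    (hf.contDiffAt (coe_ne_zero p)).isSymmSndFDerivAt (by simp only [minSmoothness_of_isRCLikeNormedField]; exact WithTop.coe_le_coe.2 le_top)
  rw [key, key, hs.eq (mclm B p) (mclm C p), rot]
  simp [mclm, sub_eq_add_neg]
  abel

end Rot

/-! ### Integration over the sphere -/

/-- The action of a linear isometry on the sphere. -/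
noncomputable def sphereMap (g : E4 ≃ₗᵢ[ℝ] E4) (p : S3) : S3 :=
  ⟨g p, by rw [mem_sphere_zero_iff_norm, g.norm_map]; exact mem_sphere_zero_iff_norm.1 p.2⟩

lemma continuous_sphereMap (g : E4 ≃ₗᵢ[ℝ] E4) : Continuous (sphereMap g) :=
  (g.continuous.comp continuous_subtype_val).subtype_mk _

-- The surface measure of s is a multiple of the volume of the cone (0,1)·s. A linear isometry maps
-- cones to cones and preserves Lebesgue measure.
open scoped Pointwise in
lemma measurePreserving_sphereMap (g : E4 ≃ₗᵢ[ℝ] E4) :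
    MeasurePreserving (sphereMap g) S3vol S3vol := by
  refine ⟨(continuous_sphereMap g).measurable, ?_⟩
  ext s hs
  have hm := (continuous_sphereMap g).measurable
  rw [Measure.map_apply hm hs, Measure.toSphere_apply' _ hs, Measure.toSphere_apply' _ (hm hs)]
  congr 1
  have h : Ioo (0 : ℝ) 1 • ((↑) '' (sphereMap g ⁻¹' s) : Set E4)
      = g ⁻¹' (Ioo (0 : ℝ) 1 • ((↑) '' s)) := by
    ext y
    simp only [mem_smul, mem_image, mem_preimage]
    constructor
    · rintro ⟨r, hr, _, ⟨p, hp, rfl⟩, rfl⟩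
      exact ⟨r, hr, _, ⟨_, hp, rfl⟩, by simp [sphereMap]⟩
    · rintro ⟨r, hr, _, ⟨p, hp, rfl⟩, h⟩
      refine ⟨r, hr, _, ⟨sphereMap g.symm p, ?_, rfl⟩, ?_⟩
      · have : sphereMap g (sphereMap g.symm p) = p := Subtype.ext (by simp [sphereMap])
        rwa [this]
      · apply g.injective
        simp [sphereMap, h]
  rw [h]
  exact g.measurePreserving.measure_preimage_equiv (f := g.toMeasurableEquiv) _

lemma integral_sphereMap {F : Type} [NormedAddCommGroup F] [NormedSpace ℝ F]
    (g : E4 ≃ₗᵢ[ℝ] E4) {f : S3 → F} (hf : Continuous f) :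
    ∫ p, f (sphereMap g p) ∂S3vol = ∫ p, f p ∂S3vol := by
  have h := measurePreserving_sphereMap g
  have h2 := integral_map (μ := S3vol) (φ := sphereMap g) (f := f) h.measurable.aemeasurable
    (by rw [h.map_eq]; exact hf.aestronglyMeasurable)
  rw [← h2, h.map_eq]

/-! ### Infinitesimal invariance of the measure -/

section Rotation

variable (B : Matrix (Fin 4) (Fin 4) ℝ)

lemma inner_mclm_self (hB : B.transpose = -B) (y : E4) : inner ℝ (mclm B y) y = 0 := by
  have h : ∀ i k, B i k = - B k i := fun i k => by
    have := congrFun (congrFun hB k) i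
    simpa using this
  have h2 : inner ℝ (mclm B y) y = ∑ i, ∑ k, B i k * y k * y i := by
    simp only [PiLp.inner_apply, mclm_apply]
    simp [Finset.mul_sum, mul_comm]
  have h3 : ∑ i, ∑ k, B i k * y k * y i = - ∑ i, ∑ k, B i k * y k * y i := by
    conv_lhs => rw [Finset.sum_comm]
    simp only [← Finset.sum_neg_distrib]
    refine Finset.sum_congr rfl fun i _ => Finset.sum_congr rfl fun k _ => ?_
    rw [h k i]; ring
  rw [h2]; linarith

lemma mclm_mul (B C : Matrix (Fin 4) (Fin 4) ℝ) (y : E4) : mclm (B * C) y = mclm B (mclm C y) := by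
  simp [mclm]

lemma inner_mclm (hB : B.transpose = -B) (x y : E4) :
    inner ℝ (mclm B x) y = - inner ℝ x (mclm B y) := by
  have h := inner_mclm_self B hB (x + y)
  simp only [map_add, inner_add_left, inner_add_right, inner_mclm_self B hB] at h
  rw [real_inner_comm (mclm B y) x]
  linarith

/-- Antisymmetry makes By orthogonal to y, and B² = -1 then gives ‖By‖ = ‖y‖, so the identity is
cos² + sin² = 1. -/
lemma norm_rotation (hB : B.transpose = -B) (hB2 : B * B = -1) (t : ℝ) (y : E4) :
    ‖(Real.cos t • ContinuousLinearMap.id ℝ E4 + Real.sin t • mclm B : E4 →L[ℝ] E4) y‖ = ‖y‖ := by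
  have h1 : inner ℝ (mclm B y) (mclm B y) = inner ℝ y y := by
    rw [inner_mclm B hB, ← mclm_mul, hB2]
    simp [mclm]
  have h0 := inner_mclm_self B hB y
  have h0' : inner ℝ y (mclm B y) = 0 := by rw [real_inner_comm]; exact h0
  rw [← sq_eq_sq₀ (norm_nonneg _) (norm_nonneg _), ← real_inner_self_eq_norm_sq,
    ← real_inner_self_eq_norm_sq]
  simp only [_root_.add_apply, _root_.smul_apply, ContinuousLinearMap.id_apply,
    inner_add_left, inner_add_right, inner_smul_left, inner_smul_right, h1, h0, h0']
  simp only [conj_trivial]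
  linear_combination (inner ℝ y y) * Real.cos_sq_add_sin_sq t

/-- The rotation `cos t + B sin t` generated by a complex structure `B`. -/
noncomputable def rotation (hB : B.transpose = -B) (hB2 : B * B = -1) (t : ℝ) : E4 ≃ₗᵢ[ℝ] E4 :=
  LinearIsometry.toLinearIsometryEquiv
    ⟨((Real.cos t • ContinuousLinearMap.id ℝ E4 + Real.sin t • mclm B : E4 →L[ℝ] E4) :
      E4 →ₗ[ℝ] E4), norm_rotation B hB hB2 t⟩ rfl

variable {F : Type} [NormedAddCommGroup F] [NormedSpace ℝ F]

/-- The mean of f over the rotated sphere does not depend on the angle; its derivative at angle 0,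
taken under the integral sign, is the mean of `rot B f`. -/
lemma integral_rot_of_sq (hB : B.transpose = -B) (hB2 : B * B = -1)
    {f : S3 → F} (hf : RadSmooth f) : ∫ p, rot B f p ∂S3vol = 0 := by
  set ρ := fun t p => sphereMap (rotation B hB hB2 t) p with hρ
  have hcoe : ∀ t p, ((ρ t p : S3) : E4) = Real.cos t • (p : E4) + Real.sin t • mclm B p :=
    fun t p => rfl
  have hderiv : ∀ p t, HasDerivAt (fun t => f (ρ t p)) (rot B f (ρ t p)) t := by
    intro p t
    have h1 : HasDerivAt (fun t : ℝ => ((ρ t p : S3) : E4)) (mclm B (ρ t p)) t := by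
      have h2 := ((Real.hasDerivAt_cos t).smul_const (p : E4)).add
        ((Real.hasDerivAt_sin t).smul_const (mclm B p))
      -- Because B² = -1, multiplication by B differentiates cos t + B sin t, so the orbits are
      -- integral curves of p ↦ Bp.
      have h4 : mclm B (ρ t p) = -Real.sin t • (p : E4) + Real.cos t • mclm B p := by
        rw [hcoe, map_add, map_smul, map_smul, ← mclm_mul, hB2]
        simp [mclm]
        abel
      rw [h4]
      exact h2
    have h3 := ((hf.differentiableAt (coe_ne_zero (ρ t p))).hasFDerivAt).comp_hasDerivAt t h1
    simpa only [Function.comp_def, toS3_coe, rot] using h3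
  -- Compactness of the sphere supplies a constant dominating the derivative.
  obtain ⟨C, hC⟩ := isCompact_univ.exists_bound_of_continuousOn
    (hf.rot B).continuous.continuousOn
  have hcont : ∀ t, Continuous (fun p => f (ρ t p)) := fun t =>
    hf.continuous.comp (continuous_sphereMap _)
  have key := hasDerivAt_integral_of_dominated_loc_of_deriv_le (μ := S3vol)
    (F := fun t p => f (ρ t p)) (F' := fun t p => rot B f (ρ t p)) (x₀ := 0)
    (bound := fun _ => C) (s := univ) Filter.univ_mem
    (Filter.Eventually.of_forall fun t => (hcont t).aestronglyMeasurable)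
    (by simpa using (hcont 0).continuousOn.integrableOn_compact (μ := S3vol) isCompact_univ)
    ((hf.rot B).continuous.comp (continuous_sphereMap _)).aestronglyMeasurable
    (Filter.Eventually.of_forall fun p t _ => hC _ (mem_univ _))
    (integrable_const _)
    (Filter.Eventually.of_forall fun p t _ => hderiv p t)
  have hconst : (fun t => ∫ p, f (ρ t p) ∂S3vol) = fun _ => ∫ p, f p ∂S3vol := by
    funext t
    exact integral_sphereMap _ hf.continuous
  have h0 : ∀ p, ρ 0 p = p := fun p => Subtype.ext (by simp [hcoe])
  have h := key.2
  rw [hconst] at h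
  simpa [h0] using h.unique (hasDerivAt_const (0 : ℝ) (∫ p, f p ∂S3vol))

end Rotation

/-! ### The basis of `so(4)` -/

/-- The matrices of the left-invariant fields. -/
def leftMat (a : Fin 3) : Matrix (Fin 4) (Fin 4) ℝ :=
  ![!![0, -1, 0, 0; 1, 0, 0, 0; 0, 0, 0, 1; 0, 0, -1, 0],
    !![0, 0, -1, 0; 0, 0, 0, -1; 1, 0, 0, 0; 0, 1, 0, 0],
    !![0, 0, 0, -1; 0, 0, 1, 0; 0, -1, 0, 0; 1, 0, 0, 0]] a

/-- The matrices of the right-invariant fields. -/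
def rightMat (a : Fin 3) : Matrix (Fin 4) (Fin 4) ℝ :=
  ![!![0, -1, 0, 0; 1, 0, 0, 0; 0, 0, 0, -1; 0, 0, 1, 0],
    !![0, 0, -1, 0; 0, 0, 0, 1; 1, 0, 0, 0; 0, -1, 0, 0],
    !![0, 0, 0, -1; 0, 0, -1, 0; 0, 1, 0, 0; 1, 0, 0, 0]] a

lemma leftInv_eq (a : Fin 3) : leftInv a = linField (leftMat a) := rfl

lemma rightInv_eq (a : Fin 3) : rightInv a = linField (rightMat a) := rfl

/-- The basis of `so(4)` adapted to the two `su(2)` factors. -/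
def basisMat (ε : ℤˣ) (a : Fin 3) : Matrix (Fin 4) (Fin 4) ℝ :=
  if ε = 1 then -leftMat a else rightMat a

@[simp] lemma basisMat_one (a : Fin 3) : basisMat 1 a = -leftMat a := rfl

@[simp] lemma basisMat_neg_one (a : Fin 3) : basisMat (-1) a = rightMat a := rfl

lemma sum_units {A : Type*} [AddCommMonoid A] (f : ℤˣ → A) : ∑ ε, f ε = f 1 + f (-1) := by
  have : (Finset.univ : Finset ℤˣ) = {1, -1} := by decide
  rw [this, Finset.sum_pair (by decide)]

lemma so4Field_apply (c : ℤˣ → Fin 3 → ℝ) (p : S3) (i : Fin 4) :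
    so4Field c p i = ∑ ε, ∑ a, c ε a * linField (basisMat ε a) p i := by
  rw [sum_units, so4Field, ← Finset.sum_add_distrib]
  refine Finset.sum_congr rfl fun a _ => ?_
  simp only [basisMat_one, basisMat_neg_one, leftInv_eq, rightInv_eq, linField_apply,
    Matrix.neg_apply, neg_mul, Finset.sum_neg_distrib]
  ring

/-- The matrix of the field with given components. -/
def so4Mat (c : ℤˣ → Fin 3 → ℝ) : Matrix (Fin 4) (Fin 4) ℝ := ∑ ε, ∑ a, c ε a • basisMat ε a

lemma so4Field_eq_linField (c : ℤˣ → Fin 3 → ℝ) : so4Field c = linField (so4Mat c) := by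
  funext p i
  rw [so4Field_apply, linField, so4Mat]
  simp only [Matrix.sum_mulVec, Matrix.smul_mulVec, Finset.sum_apply, Pi.smul_apply, smul_eq_mul,
    linField]

lemma leftMat_transpose (a : Fin 3) : (leftMat a).transpose = -leftMat a := by
  ext i k; fin_cases a <;> fin_cases i <;> fin_cases k <;> simp [leftMat]

lemma rightMat_transpose (a : Fin 3) : (rightMat a).transpose = -rightMat a := by
  ext i k; fin_cases a <;> fin_cases i <;> fin_cases k <;> simp [rightMat]

lemma leftMat_sq (a : Fin 3) : leftMat a * leftMat a = -1 := by
  ext i k; fin_cases a <;> fin_cases i <;> fin_cases k <;>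
    simp [leftMat, Matrix.mul_apply, Fin.sum_univ_four]

lemma rightMat_sq (a : Fin 3) : rightMat a * rightMat a = -1 := by
  ext i k; fin_cases a <;> fin_cases i <;> fin_cases k <;>
    simp [rightMat, Matrix.mul_apply, Fin.sum_univ_four]

lemma basisMat_transpose (ε : ℤˣ) (a : Fin 3) : (basisMat ε a).transpose = -basisMat ε a := by
  rcases Int.units_eq_one_or ε with rfl | rfl <;> simp [leftMat_transpose, rightMat_transpose]

lemma basisMat_sq (ε : ℤˣ) (a : Fin 3) : basisMat ε a * basisMat ε a = -1 := by
  rcases Int.units_eq_one_or ε with rfl | rfl <;> simp [leftMat_sq, rightMat_sq]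

lemma so4Mat_transpose (c : ℤˣ → Fin 3 → ℝ) : (so4Mat c).transpose = -so4Mat c := by
  simp only [so4Mat, Matrix.transpose_sum, Matrix.transpose_smul, basisMat_transpose, smul_neg,
    Finset.sum_neg_distrib]

/-- Every antisymmetric matrix is a combination of the basis. -/
lemma exists_so4Mat {B : Matrix (Fin 4) (Fin 4) ℝ} (hB : B.transpose = -B) :
    ∃ c, B = so4Mat c := by
  have h : ∀ i k, B i k = - B k i := fun i k => by
    have := congrFun (congrFun hB k) i
    simpa using this
  have h' : ∀ i, B i i = 0 := fun i => by linarith [h i i]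
  -- The six independent entries pair up as (10, 32), (20, 31), (30, 21); half-sums and
  -- half-differences within each pair separate the two su(2) components.
  refine ⟨fun ε => if ε = 1 then ![(-B 1 0 + B 3 2) / 2, (-B 2 0 - B 3 1) / 2, (-B 3 0 + B 2 1) / 2]
    else ![(B 1 0 + B 3 2) / 2, (B 2 0 - B 3 1) / 2, (B 3 0 + B 2 1) / 2], ?_⟩
  ext i k
  rw [so4Mat, sum_units]
  fin_cases i <;> fin_cases k <;>
    simp [leftMat, rightMat, Fin.sum_univ_three, h',
      h 0 1, h 0 2, h 0 3, h 1 2, h 1 3, h 2 3] <;> ring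

/-- The basis matrices are complex structures, for which the one-parameter group is explicit; the
general antisymmetric matrix follows by linearity. -/
lemma integral_rot {F : Type} [NormedAddCommGroup F] [NormedSpace ℝ F]
    {B : Matrix (Fin 4) (Fin 4) ℝ} (hB : B.transpose = -B)
    {f : S3 → F} (hf : RadSmooth f) : ∫ p, rot B f p ∂S3vol = 0 := by
  obtain ⟨c, rfl⟩ := exists_so4Mat hB
  have h : ∀ p, rot (so4Mat c) f p = ∑ ε, ∑ a, c ε a • rot (basisMat ε a) f p := by
    intro p
    simp [rot, so4Mat, mclm, map_sum]
  simp only [h]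
  have hi : ∀ ε a, Integrable (fun p => c ε a • rot (basisMat ε a) f p) S3vol := fun ε a =>
    ((hf.rot _).integrable).smul (c ε a)
  rw [integral_finsetSum _ fun ε _ => integrable_finsetSum _ fun a _ => hi ε a]
  refine Finset.sum_eq_zero fun ε _ => ?_
  rw [integral_finsetSum _ fun a _ => hi ε a]
  refine Finset.sum_eq_zero fun a _ => ?_
  rw [integral_smul, integral_rot_of_sq _ (basisMat_transpose ε a) (basisMat_sq ε a) hf, smul_zero]

/-- The volume of the unit three-sphere. -/
lemma S3vol_univ : S3vol.real univ = 2 * Real.pi ^ 2 := by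
  rw [Measure.toSphere_real_apply_univ, measureReal_def, EuclideanSpace.volume_ball]
  -- The sphere has dimension times ball volume, 4 · π² / Γ(3).
  have : Real.Gamma (4 / 2 + 1) = 2 := by
    rw [show (4 / 2 + 1 : ℝ) = (2 : ℕ) + 1 by norm_num, Real.Gamma_nat_eq_factorial]
    norm_num
  simp [this]
  rw [ENNReal.toReal_ofReal (by positivity)]
  rw [show √Real.pi ^ 4 = (√Real.pi ^ 2) ^ 2 by ring, Real.sq_sqrt Real.pi_pos.le]
  ring

/-! ### Lie derivatives along infinitesimal rotations -/

section LieDerivative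

variable {𝕜 : Type} [RCLike 𝕜]

lemma isSmooth_iff {X : VF 𝕜} : IsSmooth X ↔ RadSmooth X := contMDiff_iff_radSmooth X

/-- A linear vector field, with values in `𝕜⁴`. -/
noncomputable def lin (𝕜 : Type) [RCLike 𝕜] (B : Matrix (Fin 4) (Fin 4) ℝ) : VF 𝕜 :=
  fun p i => ((linField B p i : ℝ) : 𝕜)

lemma lin_real (B : Matrix (Fin 4) (Fin 4) ℝ) : lin ℝ B = linField B := rfl

lemma lin_complex (B : Matrix (Fin 4) (Fin 4) ℝ) : lin ℂ B = toC (linField B) := rfl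

/-- The Lie derivative along the infinitesimal rotation `p ↦ B p`. -/
noncomputable def lieD (B : Matrix (Fin 4) (Fin 4) ℝ) (X : VF 𝕜) : VF 𝕜 := fun p i =>
  rot B X p i - ∑ k, ((B i k : ℝ) : 𝕜) * X p k

/-- The bilinear `L²` pairing. -/
noncomputable def ip (X Y : VF 𝕜) : 𝕜 := ∫ p, ∑ i, X p i * Y p i ∂S3vol

lemma ip_comm (X Y : VF 𝕜) : ip X Y = ip Y X := by
  simp only [ip, mul_comm]

lemma skew_apply {B : Matrix (Fin 4) (Fin 4) ℝ} (hB : B.transpose = -B) (i k : Fin 4) :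
    B i k = - B k i := by
  have := congrFun (congrFun hB k) i
  simpa using this

lemma skew_sum {B : Matrix (Fin 4) (Fin 4) ℝ} (hB : B.transpose = -B) (u v : Fin 4 → 𝕜) :
    ∑ i, (∑ k, ((B i k : ℝ) : 𝕜) * u k) * v i = - ∑ i, u i * ∑ k, ((B i k : ℝ) : 𝕜) * v k := by
  simp only [Finset.sum_mul, Finset.mul_sum, ← Finset.sum_neg_distrib]
  rw [Finset.sum_comm]
  refine Finset.sum_congr rfl fun i _ => Finset.sum_congr rfl fun k _ => ?_
  rw [skew_apply hB i k]; push_cast; ring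

lemma radSmooth_ofReal {f : S3 → ℝ} (hf : RadSmooth f) : RadSmooth (fun p => ((f p : ℝ) : 𝕜)) :=
  (RCLike.ofRealCLM (K := 𝕜)).contDiff.comp_contDiffOn hf

lemma radSmooth_linField (B : Matrix (Fin 4) (Fin 4) ℝ) (i : Fin 4) :
    RadSmooth (fun p => linField B p i) := by
  simp only [linField_apply]
  exact RadSmooth.sum fun k _ => (RadSmooth.const _).mul (RadSmooth.coord k)

lemma radSmooth_lin (B : Matrix (Fin 4) (Fin 4) ℝ) : RadSmooth (lin 𝕜 B) :=
  RadSmooth.pi fun i => radSmooth_ofReal (radSmooth_linField B i)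

lemma radSmooth_dot {X Y : VF 𝕜} (hX : RadSmooth X) (hY : RadSmooth Y) :
    RadSmooth (fun p => ∑ i, X p i * Y p i) :=
  RadSmooth.sum fun i _ => (hX.apply i).mul (hY.apply i)

lemma radSmooth_mulVec (B : Matrix (Fin 4) (Fin 4) ℝ) {X : VF 𝕜} (hX : RadSmooth X) (i : Fin 4) :
    RadSmooth (fun p => ∑ k, ((B i k : ℝ) : 𝕜) * X p k) :=
  RadSmooth.sum fun k _ => (RadSmooth.const _).mul (hX.apply k)

lemma RadSmooth.lieD {X : VF 𝕜} (hX : RadSmooth X) (B : Matrix (Fin 4) (Fin 4) ℝ) :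
    RadSmooth (lieD B X) :=
  RadSmooth.pi fun i => ((hX.rot B).apply i).sub (radSmooth_mulVec B hX i)

lemma rot_dot (B : Matrix (Fin 4) (Fin 4) ℝ) {X Y : VF 𝕜} (hX : RadSmooth X)
    (hY : RadSmooth Y) (p : S3) :
    rot B (fun p => ∑ i, X p i * Y p i) p = ∑ i, (X p i * rot B Y p i + Y p i * rot B X p i) := by
  rw [rot_sum _ fun i _ => (hX.apply i).mul (hY.apply i)]
  refine Finset.sum_congr rfl fun i _ => ?_
  rw [rot_mul _ (hX.apply i) (hY.apply i), rot_apply _ hX, rot_apply _ hY]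

/-- The Lie derivative along an infinitesimal rotation is skew-adjoint. -/
lemma ip_lieD {B : Matrix (Fin 4) (Fin 4) ℝ} (hB : B.transpose = -B) {X Y : VF 𝕜}
    (hX : RadSmooth X) (hY : RadSmooth Y) : ip (lieD B X) Y = - ip X (lieD B Y) := by
  have h := integral_rot hB (radSmooth_dot hX hY)
  -- In the Leibniz rule the matrix parts of the two Lie derivatives can be inserted freely, since
  -- they cancel by antisymmetry of B.
  have h2 : ∀ p, rot B (fun p => ∑ i, X p i * Y p i) p
      = ∑ i, lieD B X p i * Y p i + ∑ i, X p i * lieD B Y p i := by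
    intro p
    have h3 := skew_sum hB (X p) (Y p)
    rw [rot_dot B hX hY]
    simp only [lieD, sub_mul, mul_sub, Finset.sum_sub_distrib, Finset.sum_add_distrib, h3]
    simp only [mul_comm]
    ring
  simp only [h2] at h
  rw [integral_add (radSmooth_dot (hX.lieD B) hY).integrable
    (radSmooth_dot hX (hY.lieD B)).integrable] at h
  exact eq_neg_of_add_eq_zero_left h

lemma rot_mulVec (B C : Matrix (Fin 4) (Fin 4) ℝ) {X : VF 𝕜} (hX : RadSmooth X) (i : Fin 4)
    (p : S3) : rot B (fun p => ∑ k, ((C i k : ℝ) : 𝕜) * X p k) p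
      = ∑ k, ((C i k : ℝ) : 𝕜) * rot B X p k := by
  rw [rot_sum _ fun k _ => (RadSmooth.const _).mul (hX.apply k)]
  refine Finset.sum_congr rfl fun k _ => ?_
  rw [rot_mul _ (RadSmooth.const _) (hX.apply k), rot_apply _ hX]
  simp [rot]

lemma rot_sub {F : Type} [NormedAddCommGroup F] [NormedSpace ℝ F]
    (B : Matrix (Fin 4) (Fin 4) ℝ) {f g : S3 → F} (hf : RadSmooth f)
    (hg : RadSmooth g) (p : S3) : rot B (fun p => f p - g p) p = rot B f p - rot B g p := by
  have := fderiv_fun_sub (hf.differentiableAt (coe_ne_zero p)) (hg.differentiableAt (coe_ne_zero p))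
  simp only [rot, this, _root_.sub_apply]

lemma rot_lieD (B C : Matrix (Fin 4) (Fin 4) ℝ) {X : VF 𝕜} (hX : RadSmooth X) (p : S3)
    (i : Fin 4) : rot B (lieD C X) p i = rot B (rot C X) p i
      - ∑ k, ((C i k : ℝ) : 𝕜) * rot B X p k := by
  rw [← rot_apply B (hX.lieD C), ← rot_mulVec B C hX, ← rot_apply B (hX.rot C)]
  exact rot_sub B ((hX.rot C).apply i) (radSmooth_mulVec C hX i) p

/-- The mixed terms, a matrix applied to a derivative, are symmetric in B and C and drop out. The
rest is `rot_comm` and the matrix commutator. -/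
lemma lieD_comm (B C : Matrix (Fin 4) (Fin 4) ℝ) {X : VF 𝕜} (hX : RadSmooth X) :
    lieD B (lieD C X) - lieD C (lieD B X) = lieD (C * B - B * C) X := by
  funext p i
  have h := congrFun (rot_comm B C hX p) i
  simp only [Pi.sub_apply] at h ⊢
  have h2 : ∀ B C : Matrix (Fin 4) (Fin 4) ℝ,
      ∑ k, ((B i k : ℝ) : 𝕜) * ∑ l, ((C k l : ℝ) : 𝕜) * X p l
        = ∑ l, (((B * C) i l : ℝ) : 𝕜) * X p l := by
    intro B C
    simp only [Finset.mul_sum, Matrix.mul_apply]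
    push_cast
    simp only [Finset.sum_mul]
    rw [Finset.sum_comm]
    simp only [mul_assoc]
  have h3 : ∀ B C : Matrix (Fin 4) (Fin 4) ℝ, lieD B (lieD C X) p i
      = rot B (rot C X) p i - ∑ k, ((C i k : ℝ) : 𝕜) * rot B X p k
        - ∑ k, ((B i k : ℝ) : 𝕜) * rot C X p k + ∑ l, (((B * C) i l : ℝ) : 𝕜) * X p l := by
    intro B C
    rw [lieD, rot_lieD B C hX]
    simp only [lieD, mul_sub, Finset.sum_sub_distrib, h2]
    ring
  rw [h3, h3, lieD, ← h]
  simp only [Matrix.sub_apply]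
  push_cast
  simp only [sub_mul, Finset.sum_sub_distrib]
  ring

lemma coord_sq (p : S3) : ∑ i, p.1 i * p.1 i = 1 := by
  have h := EuclideanSpace.norm_sq_eq (p : E4)
  rw [mem_sphere_zero_iff_norm.1 p.2] at h
  simp only [Real.norm_eq_abs, sq_abs] at h
  simp only [← sq]
  linarith

lemma coord_sq_cast (p : S3) : ∑ i, ((p.1 i : ℝ) : 𝕜) * ((p.1 i : ℝ) : 𝕜) = 1 := by
  have := congrArg (fun r : ℝ => (r : 𝕜)) (coord_sq p)
  push_cast at this
  exact this

lemma tderiv_coord (i k : Fin 4) (p : S3) :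
    tderiv k (fun p : S3 => ((p.1 i : ℝ) : 𝕜)) p
      = (if i = k then 1 else 0) - ((p.1 k : ℝ) : 𝕜) * ((p.1 i : ℝ) : 𝕜) := by
  have h := tderiv_linear ((RCLike.ofRealCLM (K := 𝕜)).comp (EuclideanSpace.proj i : E4 →L[ℝ] ℝ)) k p
  have hp : ∀ y : E4, (EuclideanSpace.proj i : E4 →L[ℝ] ℝ) y = y i := fun _ => rfl
  simp only [ContinuousLinearMap.comp_apply, hp, RCLike.ofRealCLM_apply] at h
  rw [h, RCLike.real_smul_eq_coe_mul]
  simp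

lemma radSmooth_coord_cast (i : Fin 4) : RadSmooth (fun p : S3 => ((p.1 i : ℝ) : 𝕜)) :=
  radSmooth_ofReal (RadSmooth.coord i)

lemma sum_coord_linField {B : Matrix (Fin 4) (Fin 4) ℝ} (hB : B.transpose = -B) (p : S3) :
    ∑ k, linField B p k * p.1 k = 0 := by
  have h := skew_sum (𝕜 := ℝ) hB (fun k => p.1 k) (fun k => p.1 k)
  simp only [RCLike.ofReal_real_eq_id, id] at h
  simp only [linField_apply]
  have h2 : ∑ i, p.1 i * ∑ k, B i k * p.1 k = ∑ i, (∑ k, B i k * p.1 k) * p.1 i :=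
    Finset.sum_congr rfl fun i _ => mul_comm _ _
  rw [h2] at h
  linarith

lemma rot_coord {B : Matrix (Fin 4) (Fin 4) ℝ} (hB : B.transpose = -B) (i : Fin 4) (p : S3) :
    rot B (fun p : S3 => ((p.1 i : ℝ) : 𝕜)) p = lin 𝕜 B p i := by
  rw [rot_eq_sum]
  simp only [tderiv_coord, RCLike.real_smul_eq_coe_mul, mul_sub, Finset.sum_sub_distrib,
    ← mul_assoc]
  have h := congrArg (fun r : ℝ => (r : 𝕜)) (sum_coord_linField hB p)
  push_cast at h
  rw [← Finset.sum_mul, h]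
  simp [lin]

lemma rot_lin {B : Matrix (Fin 4) (Fin 4) ℝ} (hB : B.transpose = -B)
    (C : Matrix (Fin 4) (Fin 4) ℝ) (p : S3) (i : Fin 4) :
    rot B (lin 𝕜 C) p i = lin 𝕜 (C * B) p i := by
  rw [← rot_apply B (radSmooth_lin C)]
  have : (fun p => lin 𝕜 C p i) = fun p : S3 => ∑ k, ((C i k : ℝ) : 𝕜) * ((p.1 k : ℝ) : 𝕜) := by
    funext p
    simp [lin, linField_apply]
  rw [this, rot_mulVec B C (X := fun (p : S3) k => ((p.1 k : ℝ) : 𝕜))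
    (RadSmooth.pi fun k => radSmooth_coord_cast k)]
  have h : ∀ k, rot B (fun (p : S3) k => ((p.1 k : ℝ) : 𝕜)) p k = lin 𝕜 B p k := fun k => by
    rw [← rot_apply B (RadSmooth.pi fun k => radSmooth_coord_cast k), rot_coord hB]
  simp only [h]
  simp only [lin, linField_apply, Matrix.mul_apply, Finset.sum_mul]
  push_cast
  simp only [Finset.mul_sum, mul_assoc]
  rw [Finset.sum_comm]

lemma lin_mul (B C : Matrix (Fin 4) (Fin 4) ℝ) (p : S3) (i : Fin 4) :
    ∑ k, ((B i k : ℝ) : 𝕜) * lin 𝕜 C p k = lin 𝕜 (B * C) p i := by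
  simp only [lin, linField_apply, Matrix.mul_apply, Finset.sum_mul]
  push_cast
  simp only [Finset.mul_sum, mul_assoc]
  rw [Finset.sum_comm]

lemma lin_sub (B C : Matrix (Fin 4) (Fin 4) ℝ) : lin 𝕜 (B - C) = lin 𝕜 B - lin 𝕜 C := by
  funext p i
  simp [lin, linField_apply, sub_mul]

lemma lin_add (B C : Matrix (Fin 4) (Fin 4) ℝ) : lin 𝕜 (B + C) = lin 𝕜 B + lin 𝕜 C := by
  funext p i
  simp [lin, linField_apply, add_mul, Finset.sum_add_distrib]

lemma lin_smul (r : ℝ) (B : Matrix (Fin 4) (Fin 4) ℝ) : lin 𝕜 (r • B) = (r : 𝕜) • lin 𝕜 B := by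
  funext p i
  simp [lin, linField_apply, mul_assoc, Finset.mul_sum]

lemma lin_neg (B : Matrix (Fin 4) (Fin 4) ℝ) : lin 𝕜 (-B) = -lin 𝕜 B := by
  funext p i
  simp [lin, linField_apply]

lemma lieD_lin {B : Matrix (Fin 4) (Fin 4) ℝ} (hB : B.transpose = -B)
    (C : Matrix (Fin 4) (Fin 4) ℝ) : lieD B (lin 𝕜 C) = lin 𝕜 (C * B - B * C) := by
  funext p i
  rw [lieD, rot_lin hB, lin_mul, lin_sub]
  rfl

lemma isTangent_lin {B : Matrix (Fin 4) (Fin 4) ℝ} (hB : B.transpose = -B) :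
    IsTangent (lin 𝕜 B) := by
  intro p
  have h := congrArg (fun r : ℝ => (r : 𝕜)) (sum_coord_linField hB p)
  push_cast at h
  rw [← h]
  exact Finset.sum_congr rfl fun i _ => mul_comm _ _

lemma tderiv_mulVec (j : Fin 4) (C : Matrix (Fin 4) (Fin 4) ℝ) {X : VF 𝕜} (hX : RadSmooth X)
    (i : Fin 4) (p : S3) : tderiv j (fun p => ∑ k, ((C i k : ℝ) : 𝕜) * X p k) p
      = ∑ k, ((C i k : ℝ) : 𝕜) * tderiv j X p k := by
  rw [tderiv_sum _ fun k _ => (RadSmooth.const _).mul (hX.apply k)]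
  refine Finset.sum_congr rfl fun k _ => ?_
  rw [tderiv_mul _ (RadSmooth.const _) (hX.apply k), tderiv_apply _ hX]
  simp [tderiv]

lemma tderiv_lin (C : Matrix (Fin 4) (Fin 4) ℝ) (k i : Fin 4) (p : S3) :
    tderiv k (lin 𝕜 C) p i = ((C i k : ℝ) : 𝕜) - ((p.1 k : ℝ) : 𝕜) * lin 𝕜 C p i := by
  rw [← tderiv_apply k (radSmooth_lin C)]
  have : (fun p => lin 𝕜 C p i) = fun p : S3 => ∑ k, ((C i k : ℝ) : 𝕜) * ((p.1 k : ℝ) : 𝕜) := by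
    funext p
    simp [lin, linField_apply]
  rw [this, tderiv_mulVec k C (X := fun (p : S3) k => ((p.1 k : ℝ) : 𝕜))
    (RadSmooth.pi fun k => radSmooth_coord_cast k)]
  have h : ∀ l, tderiv k (fun (p : S3) k => ((p.1 k : ℝ) : 𝕜)) p l
      = (if l = k then 1 else 0) - ((p.1 k : ℝ) : 𝕜) * ((p.1 l : ℝ) : 𝕜) := fun l => by
    rw [← tderiv_apply k (RadSmooth.pi fun k => radSmooth_coord_cast k), tderiv_coord]
  simp only [h, mul_sub, Finset.sum_sub_distrib]
  congr 1
  · simp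
  · simp only [lin, linField_apply]
    push_cast
    rw [Finset.mul_sum]
    exact Finset.sum_congr rfl fun i _ => by ring

/-- The bracket with an infinitesimal rotation is the Lie derivative. -/
lemma bracket_lin (B : Matrix (Fin 4) (Fin 4) ℝ) {X : VF 𝕜} (hT : IsTangent X) :
    bracket (lin 𝕜 B) X = lieD B X := by
  funext p i
  simp only [bracket, lieD, Finset.sum_sub_distrib, tderiv_lin, mul_sub]
  have h1 : rot B X p i = ∑ k, lin 𝕜 B p k * tderiv k X p i := by
    rw [rot_eq_sum]
    simp [lin, RCLike.real_smul_eq_coe_mul]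
  -- Projecting derivatives to the sphere adds a normal part to the derivative of the linear field;
  -- tangency of X removes it.
  have h2 : ∑ k, X p k * (((p.1 k : ℝ) : 𝕜) * lin 𝕜 B p i) = 0 := by
    have := hT p
    calc _ = (∑ k, ((p.1 k : ℝ) : 𝕜) * X p k) * lin 𝕜 B p i := by
          rw [Finset.sum_mul]; exact Finset.sum_congr rfl fun _ _ => by ring
      _ = 0 := by rw [this, zero_mul]
  rw [h1, h2, sub_zero]
  simp only [mul_comm]

lemma bracket_antisymm (X Y : VF 𝕜) : bracket X Y = - bracket Y X := by
  funext p i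
  simp only [bracket, Pi.neg_apply, ← Finset.sum_neg_distrib, neg_sub]

/-- Differentiate the identity p · X = 0 along Bp: the position vector contributes Bp · X, which
antisymmetry turns into the matrix term of the Lie derivative. -/
lemma IsTangent.lieD {B : Matrix (Fin 4) (Fin 4) ℝ} (hB : B.transpose = -B) {X : VF 𝕜}
    (hX : RadSmooth X) (hT : IsTangent X) : IsTangent (lieD B X) := by
  intro p
  have h0 : (fun p : S3 => ∑ i, ((p.1 i : ℝ) : 𝕜) * X p i) = fun _ => 0 := funext hT
  have hc : RadSmooth (fun (p : S3) k => ((p.1 k : ℝ) : 𝕜)) :=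
    RadSmooth.pi fun k => radSmooth_coord_cast k
  have h1 := rot_dot B hc hX p
  rw [h0] at h1
  have h2 : ∀ k, rot B (fun (p : S3) k => ((p.1 k : ℝ) : 𝕜)) p k = lin 𝕜 B p k := fun k => by
    rw [← rot_apply B hc, rot_coord hB]
  simp only [h2, Finset.sum_add_distrib] at h1
  have h3 := skew_sum hB (X p) (fun k => ((p.1 k : ℝ) : 𝕜))
  simp only [NCS.lieD, mul_sub, Finset.sum_sub_distrib]
  have h4 : ∀ i, ∑ k, ((B i k : ℝ) : 𝕜) * ((p.1 k : ℝ) : 𝕜) = lin 𝕜 B p i := fun i => by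
    simp [lin, linField_apply]
  simp only [h4] at h3
  have h5 : ∑ i, ((p.1 i : ℝ) : 𝕜) * ∑ k, ((B i k : ℝ) : 𝕜) * X p k
      = ∑ i, (∑ k, ((B i k : ℝ) : 𝕜) * X p k) * ((p.1 i : ℝ) : 𝕜) :=
    Finset.sum_congr rfl fun _ _ => mul_comm _ _
  rw [h5, h3]
  have h6 : rot B (fun _ : S3 => (0 : 𝕜)) p = 0 := by simp [rot]
  rw [h6] at h1
  linear_combination -h1

lemma div_eq {X : VF 𝕜} (p : S3) : div X p = ∑ i, tderiv i X p i := rfl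

lemma div_lin {B : Matrix (Fin 4) (Fin 4) ℝ} (hB : B.transpose = -B) (p : S3) :
    div (lin 𝕜 B) p = 0 := by
  have h := isTangent_lin (𝕜 := 𝕜) hB p
  simp only [div_eq, tderiv_lin, Finset.sum_sub_distrib, h, sub_zero]
  refine Finset.sum_eq_zero fun i _ => ?_
  have := skew_apply hB i i
  have : B i i = 0 := by linarith
  simp [this]

/-- Up to first-order terms the divergence commutes with the derivative along Bp. The two
first-order terms, one from differentiating the coefficients Bp and one from the matrix part, are
the same double sum with opposite signs. -/
lemma div_lieD (B : Matrix (Fin 4) (Fin 4) ℝ) {X : VF 𝕜} (hX : RadSmooth X)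
    (hd : ∀ p, div X p = 0) (p : S3) : div (lieD B X) p = 0 := by
  set G : E4 → Fin 4 → 𝕜 := fun y => X (toS3 y) with hG
  have hnhds := isOpen_compl_zero.mem_nhds (coe_ne_zero p)
  have hG2 : DifferentiableAt ℝ (fderiv ℝ G) p :=
    ((contDiffOn_fderiv_radial hX).contDiffAt hnhds).differentiableAt (by simp)
  have hs : IsSymmSndFDerivAt ℝ G p :=
    (hX.contDiffAt (coe_ne_zero p)).isSymmSndFDerivAt
      (by simp only [minSmoothness_of_isRCLikeNormedField]; exact WithTop.coe_le_coe.2 le_top)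
  have h1 : ∀ i, tderiv i (rot B X) p i
      = fderiv ℝ (fderiv ℝ G) p (mclm B p) (EuclideanSpace.single i 1) i
        + ∑ k, ((B k i : ℝ) : 𝕜) * tderiv k X p i := by
    intro i
    have h2 : (fun y : E4 => rot B X (toS3 y)) =ᶠ[nhds (p : E4)]
        fun y => fderiv ℝ G y (mclm B y) := by
      filter_upwards [hnhds] with y hy
      exact rot_toS3 B X hy
    have h3 := hG2.hasFDerivAt.clm_apply (mclm B).hasFDerivAt (x := (p : E4))
    have h4 : mclm B (EuclideanSpace.single i 1)
        = ∑ k, B k i • EuclideanSpace.single k (1 : ℝ) := by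
      rw [sum_single (mclm B (EuclideanSpace.single i 1))]
      refine Finset.sum_congr rfl fun k _ => ?_
      rw [mclm_apply]
      simp
    rw [tderiv, h2.fderiv_eq, h3.fderiv]
    simp only [_root_.add_apply, ContinuousLinearMap.comp_apply, ContinuousLinearMap.flip_apply,
      Pi.add_apply, h4, map_sum, map_smul, Finset.sum_apply, Pi.smul_apply]
    rw [hs.eq (EuclideanSpace.single i 1) (mclm B p), add_comm]
    simp [tderiv, RCLike.real_smul_eq_coe_mul, G]
  -- Off the sphere the divergence of the extension differs from `div X` by a factor ‖y‖ only, so it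
  -- vanishes near p and so does its derivative along Bp.
  have h5 : ∑ i, fderiv ℝ (fderiv ℝ G) p (mclm B p) (EuclideanSpace.single i 1) i = 0 := by
    have h6 : (fun y : E4 => ∑ i, fderiv ℝ G y (EuclideanSpace.single i 1) i)
        =ᶠ[nhds (p : E4)] fun _ => 0 := by
      filter_upwards [hnhds] with y hy
      have := hd (toS3 y)
      simp only [div_eq, tderiv_toS3 _ X hy, Pi.smul_apply, ← Finset.smul_sum] at this
      exact (smul_eq_zero.1 this).resolve_left (norm_ne_zero_iff.2 hy)
    have h7 : HasFDerivAt (fun y : E4 => ∑ i, fderiv ℝ G y (EuclideanSpace.single i 1) i)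
        (∑ i, (((ContinuousLinearMap.proj i : (Fin 4 → 𝕜) →L[ℝ] 𝕜).comp
          (ContinuousLinearMap.apply ℝ (Fin 4 → 𝕜)
            (EuclideanSpace.single i (1 : ℝ) : E4))).comp (fderiv ℝ (fderiv ℝ G) p))) (p : E4) := by
      refine HasFDerivAt.fun_sum fun i _ => ?_
      exact (((ContinuousLinearMap.proj i : (Fin 4 → 𝕜) →L[ℝ] 𝕜).comp
          (ContinuousLinearMap.apply ℝ (Fin 4 → 𝕜)
            (EuclideanSpace.single i (1 : ℝ) : E4))).hasFDerivAt
              (x := fderiv ℝ G p)).comp (p : E4) hG2.hasFDerivAt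
    have h8 := h7.unique ((hasFDerivAt_const (0 : 𝕜) (p : E4)).congr_of_eventuallyEq h6)
    have h9 := congrArg (fun L : E4 →L[ℝ] 𝕜 => L (mclm B p)) h8
    simpa using h9
  have h10 : ∀ i, tderiv i (lieD B X) p i = tderiv i (rot B X) p i
      - ∑ k, ((B i k : ℝ) : 𝕜) * tderiv i X p k := by
    intro i
    rw [← tderiv_apply i (hX.lieD B), ← tderiv_mulVec i B hX, ← tderiv_apply i (hX.rot B)]
    have := fderiv_fun_sub (((hX.rot B).apply i).differentiableAt (coe_ne_zero p))
      ((radSmooth_mulVec B hX i).differentiableAt (coe_ne_zero p))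
    simp only [tderiv, lieD]
    rw [this]
    rfl
  rw [div_eq]
  simp only [h10, h1, Finset.sum_sub_distrib, Finset.sum_add_distrib, h5, zero_add]
  rw [Finset.sum_comm, sub_self]

end LieDerivative

/-! ### The left- and right-invariant frames -/

lemma levi_eq : levi = fun a b c => (![![![0, 0, 0], ![0, 0, 1], ![0, -1, 0]],
    ![![0, 0, -1], ![0, 0, 0], ![1, 0, 0]], ![![0, 1, 0], ![-1, 0, 0], ![0, 0, 0]]] :
      Fin 3 → Fin 3 → Fin 3 → ℝ) a b c := by
  funext a b c
  rw [levi, Matrix.det_fin_three]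
  fin_cases a <;> fin_cases b <;> fin_cases c <;> simp [Matrix.one_apply]

/-- Left-invariant fields are right multiplications and vice versa, so this is associativity of the
quaternions. -/
lemma leftMat_mul_rightMat (a b : Fin 3) : leftMat a * rightMat b = rightMat b * leftMat a := by
  ext i k
  fin_cases a <;> fin_cases b <;> fin_cases i <;> fin_cases k <;>
    simp [leftMat, rightMat, Matrix.mul_apply, Fin.sum_univ_four]

lemma basisMat_mul_of_ne {ε δ : ℤˣ} (h : ε ≠ δ) (a b : Fin 3) :
    basisMat ε a * basisMat δ b = basisMat δ b * basisMat ε a := by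
  rcases Int.units_eq_one_or ε with rfl | rfl <;> rcases Int.units_eq_one_or δ with rfl | rfl
  · exact absurd rfl h
  · simp [leftMat_mul_rightMat]
  · simp [leftMat_mul_rightMat]
  · exact absurd rfl h

lemma leftMat_mul_leftMat (a b : Fin 3) : leftMat a * leftMat b
    = (if a = b then -1 else 0) - ∑ c, levi a b c • leftMat c := by
  rw [← Matrix.ext_iff]
  fin_cases a <;> fin_cases b <;> simp only [Fin.forall_fin_succ] <;>
    simp [leftMat, Matrix.mul_apply, Fin.sum_univ_four, Fin.sum_univ_three, levi_eq]

lemma rightMat_mul_rightMat (a b : Fin 3) : rightMat a * rightMat b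
    = (if a = b then -1 else 0) + ∑ c, levi a b c • rightMat c := by
  rw [← Matrix.ext_iff]
  fin_cases a <;> fin_cases b <;> simp only [Fin.forall_fin_succ] <;>
    simp [rightMat, Matrix.mul_apply, Fin.sum_univ_four, Fin.sum_univ_three, levi_eq]

/-- Right multiplications compose in reversed order; the minus sign in `basisMat 1` compensates, so
the quaternion relations read the same in both sectors. -/
lemma basisMat_mul (ε : ℤˣ) (a b : Fin 3) : basisMat ε a * basisMat ε b
    = (if a = b then -1 else 0) + ∑ c, levi a b c • basisMat ε c := by
  rcases Int.units_eq_one_or ε with rfl | rfl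
  · simp [leftMat_mul_leftMat, sub_eq_add_neg]
  · simp [rightMat_mul_rightMat]

lemma levi_swap (a b c : Fin 3) : levi b a c = -levi a b c := by
  rw [levi_eq]
  fin_cases a <;> fin_cases b <;> fin_cases c <;> simp

lemma basisMat_comm (ε : ℤˣ) (a b : Fin 3) :
    basisMat ε b * basisMat ε a - basisMat ε a * basisMat ε b
      = (-2 : ℝ) • ∑ c, levi a b c • basisMat ε c := by
  rw [basisMat_mul, basisMat_mul]
  simp only [levi_swap a b, eq_comm (a := b), neg_smul, Finset.sum_neg_distrib]
  module

section Frame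

variable {𝕜 : Type} [RCLike 𝕜]

variable (𝕜) in
/-- The basis fields of `so(4)`, with values in `𝕜⁴`. -/
noncomputable def frame (ε : ℤˣ) (a : Fin 3) : VF 𝕜 := lin 𝕜 (basisMat ε a)

lemma radSmooth_frame (ε : ℤˣ) (a : Fin 3) : RadSmooth (frame 𝕜 ε a) := radSmooth_lin _

lemma isTangent_frame (ε : ℤˣ) (a : Fin 3) : IsTangent (frame 𝕜 ε a) :=
  isTangent_lin (basisMat_transpose ε a)

lemma lin_sum {ι : Type*} (s : Finset ι) (B : ι → Matrix (Fin 4) (Fin 4) ℝ) :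
    lin 𝕜 (∑ i ∈ s, B i) = ∑ i ∈ s, lin 𝕜 (B i) := by
  classical
  induction s using Finset.induction_on with
  | empty => funext p i; simp [lin, linField_apply]
  | insert a s ha ih => rw [Finset.sum_insert ha, Finset.sum_insert ha, lin_add, ih]

lemma lieD_frame (ε : ℤˣ) (a b : Fin 3) :
    lieD (basisMat ε a) (frame 𝕜 ε b) = (-2 : 𝕜) • ∑ c, (levi a b c : 𝕜) • frame 𝕜 ε c := by
  rw [frame, lieD_lin (basisMat_transpose ε a), basisMat_comm, lin_smul, lin_sum]
  simp only [lin_smul, frame]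
  push_cast
  rfl

lemma lieD_frame_of_ne {ε δ : ℤˣ} (h : ε ≠ δ) (a b : Fin 3) :
    lieD (basisMat ε a) (frame 𝕜 δ b) = 0 := by
  rw [frame, lieD_lin (basisMat_transpose ε a), basisMat_mul_of_ne h, sub_self]
  funext p i
  simp [lin, linField_apply]

lemma sphere_eq (p : S3) : ((p.1 0 : ℝ) : 𝕜) ^ 2 + ((p.1 1 : ℝ) : 𝕜) ^ 2 + ((p.1 2 : ℝ) : 𝕜) ^ 2
    + ((p.1 3 : ℝ) : 𝕜) ^ 2 = 1 := by
  rw [← coord_sq_cast (𝕜 := 𝕜) p, Fin.sum_univ_four]; ring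

lemma frame_one (a : Fin 3) (p : S3) : frame 𝕜 1 a p =
    ![![((p.1 1 : ℝ) : 𝕜), -((p.1 0 : ℝ) : 𝕜), -((p.1 3 : ℝ) : 𝕜), ((p.1 2 : ℝ) : 𝕜)],
      ![((p.1 2 : ℝ) : 𝕜), ((p.1 3 : ℝ) : 𝕜), -((p.1 0 : ℝ) : 𝕜), -((p.1 1 : ℝ) : 𝕜)],
      ![((p.1 3 : ℝ) : 𝕜), -((p.1 2 : ℝ) : 𝕜), ((p.1 1 : ℝ) : 𝕜), -((p.1 0 : ℝ) : 𝕜)]] a := by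
  funext i
  fin_cases a <;> fin_cases i <;>
    simp [frame, lin, linField_apply, leftMat, Fin.sum_univ_four]

lemma frame_neg_one (a : Fin 3) (p : S3) : frame 𝕜 (-1) a p =
    ![![-((p.1 1 : ℝ) : 𝕜), ((p.1 0 : ℝ) : 𝕜), -((p.1 3 : ℝ) : 𝕜), ((p.1 2 : ℝ) : 𝕜)],
      ![-((p.1 2 : ℝ) : 𝕜), ((p.1 3 : ℝ) : 𝕜), ((p.1 0 : ℝ) : 𝕜), -((p.1 1 : ℝ) : 𝕜)],
      ![-((p.1 3 : ℝ) : 𝕜), -((p.1 2 : ℝ) : 𝕜), ((p.1 1 : ℝ) : 𝕜), ((p.1 0 : ℝ) : 𝕜)]] a := by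
  funext i
  fin_cases a <;> fin_cases i <;>
    simp [frame, lin, linField_apply, rightMat, Fin.sum_univ_four]

lemma frame_dot (ε : ℤˣ) (a b : Fin 3) (p : S3) :
    ∑ i, frame 𝕜 ε a p i * frame 𝕜 ε b p i = if a = b then 1 else 0 := by
  have h := sphere_eq (𝕜 := 𝕜) p
  rcases Int.units_eq_one_or ε with rfl | rfl <;> fin_cases a <;> fin_cases b <;>
    simp [frame_one, frame_neg_one, Fin.sum_univ_four] <;>
    first | ring1 | linear_combination h

/-- This is ε_{abc} ε_{bcd} = 2 δ_{ad}. It writes each basis field as a combination of brackets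
within its own sector: su(2) is perfect. -/
lemma frame_levi (ε : ℤˣ) (a : Fin 3) :
    frame 𝕜 ε a = (2⁻¹ : 𝕜) • ∑ b, ∑ c, (levi a b c : 𝕜) • ∑ d, (levi b c d : 𝕜) • frame 𝕜 ε d := by
  fin_cases a <;> simp [Fin.sum_univ_three, levi_eq] <;> rw [← two_smul 𝕜, smul_smul] <;> simp

lemma ip_add_left {X Y Z : VF 𝕜} (hX : RadSmooth X) (hY : RadSmooth Y) (hZ : RadSmooth Z) :
    ip (X + Y) Z = ip X Z + ip Y Z := by
  rw [ip, ip, ip, ← integral_add (radSmooth_dot hX hZ).integrable (radSmooth_dot hY hZ).integrable]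
  simp [add_mul, Finset.sum_add_distrib]

lemma ip_smul_left (r : 𝕜) (X Y : VF 𝕜) : ip (r • X) Y = r * ip X Y := by
  rw [ip, ip, ← integral_const_mul]
  simp [Finset.mul_sum, mul_assoc]

lemma ip_zero_left (Y : VF 𝕜) : ip 0 Y = 0 := by simp [ip]

lemma RadSmooth.smul_vf (r : 𝕜) {X : VF 𝕜} (hX : RadSmooth X) : RadSmooth (r • X) :=
  RadSmooth.pi fun i => (RadSmooth.const r).mul (hX.apply i)

lemma RadSmooth.add_vf {X Y : VF 𝕜} (hX : RadSmooth X) (hY : RadSmooth Y) : RadSmooth (X + Y) :=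
  hX.add hY

lemma RadSmooth.sum_vf {ι : Type*} {s : Finset ι} {X : ι → VF 𝕜} (hX : ∀ i ∈ s, RadSmooth (X i)) :
    RadSmooth (∑ i ∈ s, X i) := by
  have := RadSmooth.sum hX
  convert this using 1
  funext p
  simp

lemma ip_sum_left {ι : Type*} {s : Finset ι} {X : ι → VF 𝕜} (hX : ∀ i ∈ s, RadSmooth (X i))
    {Z : VF 𝕜} (hZ : RadSmooth Z) : ip (∑ i ∈ s, X i) Z = ∑ i ∈ s, ip (X i) Z := by
  classical
  induction s using Finset.induction_on with
  | empty => simp [ip_zero_left]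
  | insert a s ha ih =>
    rw [Finset.sum_insert ha, Finset.sum_insert ha, ip_add_left (hX a (Finset.mem_insert_self a s))
      (RadSmooth.sum_vf fun i hi => hX i (Finset.mem_insert_of_mem hi)) hZ,
      ih fun i hi => hX i (Finset.mem_insert_of_mem hi)]

/-- Within a sector the frame is orthonormal at each point, so only the volume 2π² appears. Fields
of different sectors are orthogonal only after integration: one of them is a sum of Lie derivatives
along its own sector, and skew-adjointness moves these onto the other field, which they annihilate.
-/
lemma ip_frame (ε δ : ℤˣ) (a b : Fin 3) : ip (frame 𝕜 ε a) (frame 𝕜 δ b)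
    = if ε = δ ∧ a = b then 2 * (Real.pi : 𝕜) ^ 2 else 0 := by
  by_cases h : ε = δ
  · subst h
    simp only [ip, frame_dot, true_and]
    rw [integral_const, S3vol_univ]
    split_ifs
    · simp only [RCLike.real_smul_eq_coe_mul]
      push_cast
      ring
    · simp
  · simp only [h, false_and, if_false]
    have h1 : ∀ b' c', ip (lieD (basisMat ε b') (frame 𝕜 ε c')) (frame 𝕜 δ b) = 0 := by
      intro b' c'
      rw [ip_lieD (basisMat_transpose ε b') (radSmooth_frame _ _) (radSmooth_frame _ _),
        lieD_frame_of_ne h, ip_comm, ip_zero_left, neg_zero]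
    have h2 : ∀ b' c', ip (∑ d, (levi b' c' d : 𝕜) • frame 𝕜 ε d) (frame 𝕜 δ b) = 0 := by
      intro b' c'
      have := h1 b' c'
      rw [lieD_frame, ip_smul_left] at this
      exact (mul_eq_zero.1 this).resolve_left (by simp)
    have hs : ∀ b' c', RadSmooth (∑ d, (levi b' c' d : 𝕜) • frame 𝕜 ε d) := fun b' c' =>
      RadSmooth.sum_vf fun d _ => (radSmooth_frame ε d).smul_vf _
    rw [frame_levi ε a, ip_smul_left, ip_sum_left (fun _ _ => RadSmooth.sum_vf fun _ _ =>
      (hs _ _).smul_vf _) (radSmooth_frame _ _)]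
    refine mul_eq_zero_of_right _ (Finset.sum_eq_zero fun b' _ => ?_)
    rw [ip_sum_left (fun _ _ => (hs _ _).smul_vf _) (radSmooth_frame _ _)]
    refine Finset.sum_eq_zero fun c' _ => ?_
    rw [ip_smul_left, h2, mul_zero]

/-! ### The divergence theorem -/

lemma sum_tderiv_coord (X : VF 𝕜) (p : S3) (i : Fin 4) :
    ∑ k, ((p.1 k : ℝ) : 𝕜) * tderiv k X p i = 0 := by
  have := congrFun (sum_coord_tderiv X p) i
  simpa [RCLike.real_smul_eq_coe_mul] using this

/-- In the orthonormal frame of one sector, the divergence is the sum over a of the derivative along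
E_a of E_a · Z, and each summand integrates to zero. -/
lemma integral_div {Z : VF 𝕜} (hZ : RadSmooth Z) (hT : IsTangent Z) :
    ∫ p, div Z p ∂S3vol = 0 := by
  have h : ∀ p, div Z p
      = ∑ a, rot (basisMat 1 a) (fun p => ∑ i, frame 𝕜 1 a p i * Z p i) p := by
    intro p
    have h1 := hT p
    have h2 := sum_tderiv_coord Z p
    have hs := sphere_eq (𝕜 := 𝕜) p
    have h3 : ∀ a i, rot (basisMat 1 a) Z p i = ∑ k, frame 𝕜 1 a p k * tderiv k Z p i := by
      intro a i
      rw [rot_eq_sum]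
      simp [frame, lin, RCLike.real_smul_eq_coe_mul]
    -- The orbits of E_a are great circles with acceleration -p, which is orthogonal to the tangent
    -- field Z.
    have h4 : ∀ a i, rot (basisMat 1 a) (frame 𝕜 1 a) p i = - ((p.1 i : ℝ) : 𝕜) := by
      intro a i
      rw [frame, rot_lin (basisMat_transpose 1 a), basisMat_sq, lin_neg]
      simp [lin, linField_apply, Matrix.one_apply]
    simp only [rot_dot _ (radSmooth_frame _ _) hZ, h3, h4, div_eq]
    have h20 := h2 0
    have h21 := h2 1
    have h22 := h2 2
    have h23 := h2 3
    simp only [Fin.sum_univ_four] at h1 h20 h21 h22 h23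
    simp only [Fin.sum_univ_three, Fin.sum_univ_four, frame_one]
    simp only [Matrix.cons_val]
    generalize ((p.1 0 : ℝ) : 𝕜) = x0 at *
    generalize ((p.1 1 : ℝ) : 𝕜) = x1 at *
    generalize ((p.1 2 : ℝ) : 𝕜) = x2 at *
    generalize ((p.1 3 : ℝ) : 𝕜) = x3 at *
    linear_combination -(tderiv 0 Z p 0 + tderiv 1 Z p 1 + tderiv 2 Z p 2 + tderiv 3 Z p 3) * hs
      + 3 * h1 + x0 * h20 + x1 * h21 + x2 * h22 + x3 * h23
  simp only [h]
  have hs : ∀ a, RadSmooth (fun p => ∑ i, frame 𝕜 1 a p i * Z p i) := fun a =>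
    radSmooth_dot (radSmooth_frame _ _) hZ
  rw [integral_finsetSum _ fun a _ => ((hs a).rot _).integrable]
  exact Finset.sum_eq_zero fun a _ => integral_rot (basisMat_transpose 1 a) (hs a)

/-- A divergence-free field is orthogonal to gradients. -/
lemma integral_sum_mul_tderiv {X : VF 𝕜} (hX : RadSmooth X) (hT : IsTangent X)
    (hd : ∀ p, div X p = 0) {f : S3 → 𝕜} (hf : RadSmooth f) :
    ∫ p, ∑ i, X p i * tderiv i f p ∂S3vol = 0 := by
  have hZ : RadSmooth (fun p i => X p i * f p) := RadSmooth.pi fun i => (hX.apply i).mul hf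
  rw [← integral_div hZ fun p => ?_]
  · congr 1
    funext p
    simp only [div_eq]
    have h := hd p
    rw [div_eq] at h
    have h2 : ∀ i, tderiv i (fun p i => X p i * f p) p i
        = X p i * tderiv i f p + f p * tderiv i X p i := fun i => by
      rw [← tderiv_apply i hZ, tderiv_mul i (hX.apply i) hf, tderiv_apply i hX]
    simp only [h2, Finset.sum_add_distrib, ← Finset.mul_sum, h, mul_zero, add_zero]
  · have := hT p
    simp only [← mul_assoc, ← Finset.sum_mul, this, zero_mul]

/-! ### The volume form and the curl -/

lemma volForm_eq (p : S3) (u v w : Fin 4 → 𝕜) : volForm p u v w =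
    ((p.1 0 : ℝ) : 𝕜) * (u 1 * (v 2 * w 3 - v 3 * w 2) - u 2 * (v 1 * w 3 - v 3 * w 1)
      + u 3 * (v 1 * w 2 - v 2 * w 1))
    - ((p.1 1 : ℝ) : 𝕜) * (u 0 * (v 2 * w 3 - v 3 * w 2) - u 2 * (v 0 * w 3 - v 3 * w 0)
      + u 3 * (v 0 * w 2 - v 2 * w 0))
    + ((p.1 2 : ℝ) : 𝕜) * (u 0 * (v 1 * w 3 - v 3 * w 1) - u 1 * (v 0 * w 3 - v 3 * w 0)
      + u 3 * (v 0 * w 1 - v 1 * w 0))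
    - ((p.1 3 : ℝ) : 𝕜) * (u 0 * (v 1 * w 2 - v 2 * w 1) - u 1 * (v 0 * w 2 - v 2 * w 0)
      + u 2 * (v 0 * w 1 - v 1 * w 0)) := by
  rw [volForm, Matrix.det_succ_row_zero]
  simp [Fin.sum_univ_four, Matrix.det_fin_three, Fin.succAbove]
  ring

/-- This is the cross product in the frame. With the outward-normal orientation, the frame of sector
+ is negatively and that of sector - positively oriented, hence the sign -ε. -/
lemma volForm_frame_frame (ε : ℤˣ) (a b : Fin 3) (w : Fin 4 → 𝕜) (p : S3) :
    volForm p (frame 𝕜 ε a p) (frame 𝕜 ε b p) w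
      = -((ε : ℤ) : 𝕜) * ∑ c, (levi a b c : 𝕜) * ∑ i, frame 𝕜 ε c p i * w i := by
  -- The factor |p|² = 1 makes both sides of the same degree in p, so the claim is a polynomial
  -- identity.
  have key : volForm p (frame 𝕜 ε a p) (frame 𝕜 ε b p) w
      = (((p.1 0 : ℝ) : 𝕜) ^ 2 + ((p.1 1 : ℝ) : 𝕜) ^ 2 + ((p.1 2 : ℝ) : 𝕜) ^ 2
        + ((p.1 3 : ℝ) : 𝕜) ^ 2) *
        (-((ε : ℤ) : 𝕜) * ∑ c, (levi a b c : 𝕜) * ∑ i, frame 𝕜 ε c p i * w i) := by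
    rw [volForm_eq, levi_eq]
    simp only [Fin.sum_univ_four, Fin.sum_univ_three]
    generalize w 0 = w0
    generalize w 1 = w1
    generalize w 2 = w2
    generalize w 3 = w3
    rcases Int.units_eq_one_or ε with rfl | rfl
    · simp only [frame_one]
      generalize ((p.1 0 : ℝ) : 𝕜) = x0
      generalize ((p.1 1 : ℝ) : 𝕜) = x1
      generalize ((p.1 2 : ℝ) : 𝕜) = x2
      generalize ((p.1 3 : ℝ) : 𝕜) = x3
      fin_cases a <;> fin_cases b <;> simp <;> ring
    · simp only [frame_neg_one]
      generalize ((p.1 0 : ℝ) : 𝕜) = x0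
      generalize ((p.1 1 : ℝ) : 𝕜) = x1
      generalize ((p.1 2 : ℝ) : 𝕜) = x2
      generalize ((p.1 3 : ℝ) : 𝕜) = x3
      fin_cases a <;> fin_cases b <;> simp <;> ring
  rw [key, sphere_eq, one_mul]

lemma volForm_swap (p : S3) (u v w : Fin 4 → 𝕜) : volForm p u v w = - volForm p u w v := by
  rw [volForm_eq, volForm_eq]; ring

lemma volForm_cycle (p : S3) (u v w : Fin 4 → 𝕜) : volForm p u v w = volForm p v w u := by
  rw [volForm_eq, volForm_eq]; ring

lemma curl_eq (X : VF 𝕜) (p : S3) : curl X p =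
    ![-((p.1 1 : ℝ) : 𝕜) * (tderiv 2 X p 3 - tderiv 3 X p 2)
        + ((p.1 2 : ℝ) : 𝕜) * (tderiv 1 X p 3 - tderiv 3 X p 1)
        - ((p.1 3 : ℝ) : 𝕜) * (tderiv 1 X p 2 - tderiv 2 X p 1),
      ((p.1 0 : ℝ) : 𝕜) * (tderiv 2 X p 3 - tderiv 3 X p 2)
        - ((p.1 2 : ℝ) : 𝕜) * (tderiv 0 X p 3 - tderiv 3 X p 0)
        + ((p.1 3 : ℝ) : 𝕜) * (tderiv 0 X p 2 - tderiv 2 X p 0),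
      -((p.1 0 : ℝ) : 𝕜) * (tderiv 1 X p 3 - tderiv 3 X p 1)
        + ((p.1 1 : ℝ) : 𝕜) * (tderiv 0 X p 3 - tderiv 3 X p 0)
        - ((p.1 3 : ℝ) : 𝕜) * (tderiv 0 X p 1 - tderiv 1 X p 0),
      ((p.1 0 : ℝ) : 𝕜) * (tderiv 1 X p 2 - tderiv 2 X p 1)
        - ((p.1 1 : ℝ) : 𝕜) * (tderiv 0 X p 2 - tderiv 2 X p 0)
        + ((p.1 2 : ℝ) : 𝕜) * (tderiv 0 X p 1 - tderiv 1 X p 0)] := by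
  funext i
  simp only [curl, volForm_eq, Fin.sum_univ_four, basisVec]
  fin_cases i <;> simp <;> ring

lemma curl_frame (ε : ℤˣ) (a : Fin 3) :
    curl (frame 𝕜 ε a) = (-2 * ((ε : ℤ) : 𝕜)) • frame 𝕜 ε a := by
  funext p
  have h : ∀ k i, tderiv k (frame 𝕜 ε a) p i = ((basisMat ε a i k : ℝ) : 𝕜)
      - ((p.1 k : ℝ) : 𝕜) * frame 𝕜 ε a p i := fun k i => tderiv_lin _ _ _ _
  rw [curl_eq]
  simp only [h, Pi.smul_apply]
  rcases Int.units_eq_one_or ε with rfl | rfl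
  · simp only [frame_one, basisMat_one, leftMat]
    fin_cases a <;> funext i <;> fin_cases i <;> simp <;> ring
  · simp only [frame_neg_one, basisMat_neg_one, rightMat]
    fin_cases a <;> funext i <;> fin_cases i <;> simp <;> ring

/-- Only derivatives along the frame occur on the right, so the curl can be integrated by parts with
`integral_rot`. -/
lemma dot_frame_curl (ε : ℤˣ) (a : Fin 3) (P : VF 𝕜) (p : S3) :
    ∑ i, frame 𝕜 ε a p i * curl P p i
      = -((ε : ℤ) : 𝕜) * ∑ b, ∑ c, (levi a b c : 𝕜) *
        ∑ i, frame 𝕜 ε c p i * rot (basisMat ε b) P p i := by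
  have h3 : ∀ a i, rot (basisMat ε a) P p i = ∑ k, frame 𝕜 ε a p k * tderiv k P p i := by
    intro a i
    rw [rot_eq_sum]
    simp [frame, lin, RCLike.real_smul_eq_coe_mul]
  simp only [h3, curl_eq, Fin.sum_univ_four, Fin.sum_univ_three]
  generalize tderiv 0 P p = t0
  generalize tderiv 1 P p = t1
  generalize tderiv 2 P p = t2
  generalize tderiv 3 P p = t3
  rw [levi_eq]
  rcases Int.units_eq_one_or ε with rfl | rfl
  · simp only [frame_one]
    fin_cases a <;> simp <;> ring
  · simp only [frame_neg_one]
    fin_cases a <;> simp <;> ring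

lemma ip_lin_rot {B : Matrix (Fin 4) (Fin 4) ℝ} (hB : B.transpose = -B)
    (C : Matrix (Fin 4) (Fin 4) ℝ) {P : VF 𝕜} (hP : RadSmooth P) :
    ∫ p, ∑ i, lin 𝕜 C p i * rot B P p i ∂S3vol = - ip (lin 𝕜 (C * B)) P := by
  have h := integral_rot hB (radSmooth_dot (radSmooth_lin (𝕜 := 𝕜) C) hP)
  simp only [rot_dot B (radSmooth_lin (𝕜 := 𝕜) C) hP, rot_lin hB, Finset.sum_add_distrib] at h
  rw [integral_add (radSmooth_dot (radSmooth_lin C) (hP.rot B)).integrable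
    (radSmooth_dot hP (radSmooth_lin _)).integrable] at h
  rw [ip_comm]
  exact eq_neg_of_add_eq_zero_left h

/-- The curl is symmetric on the basis fields of `so(4)`. -/
lemma ip_frame_curl (ε : ℤˣ) (a : Fin 3) {P : VF 𝕜} (hP : RadSmooth P) :
    ip (frame 𝕜 ε a) (curl P) = -2 * ((ε : ℤ) : 𝕜) * ip (frame 𝕜 ε a) P := by
  have hi : ∀ b c, Integrable (fun p => (levi a b c : 𝕜) *
      ∑ i, frame 𝕜 ε c p i * rot (basisMat ε b) P p i) S3vol := fun b c =>
    ((radSmooth_dot (radSmooth_frame ε c) (hP.rot (basisMat ε b))).integrable).const_mul _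
  rw [ip]
  simp only [dot_frame_curl]
  rw [integral_const_mul, integral_finsetSum _ fun b _ => integrable_finsetSum _ fun c _ => hi b c]
  have h1 : ∀ b, ∫ p, ∑ c, (levi a b c : 𝕜) *
      ∑ i, frame 𝕜 ε c p i * rot (basisMat ε b) P p i ∂S3vol
      = ip (lin 𝕜 (∑ c, (-levi a b c) • (basisMat ε c * basisMat ε b))) P := by
    intro b
    rw [integral_finsetSum _ fun c _ => hi b c, lin_sum,
      ip_sum_left (fun _ _ => radSmooth_lin _) hP]
    refine Finset.sum_congr rfl fun c _ => ?_
    rw [integral_const_mul, frame, ip_lin_rot (basisMat_transpose ε b) _ hP, lin_smul, ip_smul_left]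
    push_cast
    ring
  simp only [h1]
  rw [← ip_sum_left (fun _ _ => radSmooth_lin _) hP, ← lin_sum]
  -- By the quaternion relations this is the contraction ε_{abc} ε_{bcd} = 2 δ_{ad}; the scalar part
  -- drops because `levi` is antisymmetric.
  have h2 : ∑ b, ∑ c, (-levi a b c) • (basisMat ε c * basisMat ε b)
      = (2 : ℝ) • basisMat ε a := by
    simp only [basisMat_mul]
    fin_cases a <;> simp [levi_eq, Fin.sum_univ_three] <;> module
  rw [h2, lin_smul, ip_smul_left, frame]
  push_cast
  ring

/-- For a tangent vector `u`, the triple product with a left- and a right-invariant field. -/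
lemma volForm_left_right (a b : Fin 3) (u : Fin 4 → 𝕜) (p : S3)
    (hu : ∑ i, ((p.1 i : ℝ) : 𝕜) * u i = 0) :
    volForm p u (frame 𝕜 1 a p) (frame 𝕜 (-1) b p)
      = - ∑ i, u i * lin 𝕜 (basisMat 1 a * basisMat (-1) b) p i := by
  -- The homogeneous form of the identity; its last term is proportional to p · u and disappears for
  -- tangent u.
  have key : volForm p u (frame 𝕜 1 a p) (frame 𝕜 (-1) b p)
      = -(((p.1 0 : ℝ) : 𝕜) ^ 2 + ((p.1 1 : ℝ) : 𝕜) ^ 2 + ((p.1 2 : ℝ) : 𝕜) ^ 2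
        + ((p.1 3 : ℝ) : 𝕜) ^ 2) * ∑ i, u i * lin 𝕜 (basisMat 1 a * basisMat (-1) b) p i
        + (∑ i, ((p.1 i : ℝ) : 𝕜) * u i)
          * ∑ i, ((p.1 i : ℝ) : 𝕜) * lin 𝕜 (basisMat 1 a * basisMat (-1) b) p i := by
    have h : ∀ i, lin 𝕜 (basisMat (-1) b) p i = frame 𝕜 (-1) b p i := fun _ => rfl
    simp only [← lin_mul, Fin.sum_univ_four, h, frame_one, frame_neg_one, basisMat_one, leftMat,
      volForm_eq]
    generalize u 0 = u0
    generalize u 1 = u1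
    generalize u 2 = u2
    generalize u 3 = u3
    generalize ((p.1 0 : ℝ) : 𝕜) = x0
    generalize ((p.1 1 : ℝ) : 𝕜) = x1
    generalize ((p.1 2 : ℝ) : 𝕜) = x2
    generalize ((p.1 3 : ℝ) : 𝕜) = x3
    fin_cases a <;> fin_cases b <;> simp <;> ring
  rw [key, sphere_eq, hu]
  ring

/-- A divergence-free field has no component along the product of a left- and a right-invariant
field. -/
lemma integral_volForm_left_right (a b : Fin 3) {X : VF 𝕜} (hX : RadSmooth X) (hT : IsTangent X)
    (hd : ∀ p, div X p = 0) :
    ∫ p, volForm p (X p) (frame 𝕜 1 a p) (frame 𝕜 (-1) b p) ∂S3vol = 0 := by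
  set C := basisMat 1 a * basisMat (-1) b with hC
  -- A product of commuting antisymmetric matrices is symmetric. Hence the tangential part of Cp is
  -- half the gradient of the quadratic function p · Cp, and a divergence-free field is orthogonal
  -- to it.
  have hCt : C.transpose = C := by
    rw [hC, Matrix.transpose_mul, basisMat_transpose, basisMat_transpose, neg_mul_neg,
      basisMat_mul_of_ne (by decide)]
  have hf : RadSmooth (fun p : S3 => ∑ i, ((p.1 i : ℝ) : 𝕜) * lin 𝕜 C p i) :=
    RadSmooth.sum fun i _ => (radSmooth_coord_cast i).mul ((radSmooth_lin C).apply i)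
  have h := integral_sum_mul_tderiv hX hT hd hf
  have h2 : ∀ p, volForm p (X p) (frame 𝕜 1 a p) (frame 𝕜 (-1) b p)
      = (-2⁻¹ : 𝕜) * ∑ i, X p i * tderiv i (fun p : S3 => ∑ i, ((p.1 i : ℝ) : 𝕜) * lin 𝕜 C p i) p := by
    intro p
    have ht := hT p
    have h3 : ∀ k, tderiv k (fun p : S3 => ∑ i, ((p.1 i : ℝ) : 𝕜) * lin 𝕜 C p i) p
        = 2 * lin 𝕜 C p k - ((p.1 k : ℝ) : 𝕜) * (2 * ∑ i, ((p.1 i : ℝ) : 𝕜) * lin 𝕜 C p i) := by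
      intro k
      rw [tderiv_sum _ fun i _ => (radSmooth_coord_cast i).mul ((radSmooth_lin C).apply i)]
      simp only [tderiv_mul k (radSmooth_coord_cast _) ((radSmooth_lin C).apply _),
        tderiv_apply k (radSmooth_lin C), tderiv_lin, tderiv_coord, mul_sub,
        Finset.sum_sub_distrib, Finset.sum_add_distrib]
      have h4 : ∑ i, ((p.1 i : ℝ) : 𝕜) * ((C i k : ℝ) : 𝕜) = lin 𝕜 C p k := by
        simp only [lin, linField_apply]
        push_cast
        refine Finset.sum_congr rfl fun i _ => ?_
        rw [← congrFun (congrFun hCt i) k, Matrix.transpose_apply, mul_comm]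
      rw [h4]
      simp only [Finset.mul_sum, mul_ite, mul_one, mul_zero, Finset.sum_ite_eq', Finset.mem_univ,
        if_true]
      have h5 : ∀ i, ((p.1 i : ℝ) : 𝕜) * (((p.1 k : ℝ) : 𝕜) * lin 𝕜 C p i)
          = ((p.1 k : ℝ) : 𝕜) * (((p.1 i : ℝ) : 𝕜) * lin 𝕜 C p i) := fun i => by ring
      have h6 : ∀ i, lin 𝕜 C p i * (((p.1 k : ℝ) : 𝕜) * ((p.1 i : ℝ) : 𝕜))
          = ((p.1 k : ℝ) : 𝕜) * (((p.1 i : ℝ) : 𝕜) * lin 𝕜 C p i) := fun i => by ring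
      have h7 : ∀ i, ((p.1 k : ℝ) : 𝕜) * (2 * (((p.1 i : ℝ) : 𝕜) * lin 𝕜 C p i))
          = 2 * (((p.1 k : ℝ) : 𝕜) * (((p.1 i : ℝ) : 𝕜) * lin 𝕜 C p i)) := fun i => by ring
      simp only [h5, h6, h7, ← Finset.mul_sum]
      ring
    rw [volForm_left_right a b _ p ht]
    simp only [h3, mul_sub, Finset.sum_sub_distrib]
    have h8 : ∑ i, X p i * (((p.1 i : ℝ) : 𝕜) * (2 * ∑ i, ((p.1 i : ℝ) : 𝕜) * lin 𝕜 C p i)) = 0 := by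
      calc _ = (∑ i, ((p.1 i : ℝ) : 𝕜) * X p i)
            * (2 * ∑ i, ((p.1 i : ℝ) : 𝕜) * lin 𝕜 C p i) := by
            rw [Finset.sum_mul]; exact Finset.sum_congr rfl fun _ _ => by ring
        _ = 0 := by rw [ht, zero_mul]
    have h9 : ∀ i, X p i * (2 * lin 𝕜 C p i) = 2 * (X p i * lin 𝕜 C p i) := fun i => by ring
    simp only [h8, h9, ← Finset.mul_sum]
    field_simp
    ring
  simp only [h2]
  rw [integral_const_mul, h, mul_zero]

end Frame

/-! ### The two commuting `sl(2)` actions on smooth complex fields -/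

/-- The smooth complex fields. -/
def smoothVF : Submodule ℂ (VF ℂ) where
  carrier := {X | RadSmooth X}
  add_mem' := RadSmooth.add_vf
  zero_mem' := RadSmooth.const 0
  smul_mem' c _ hX := hX.smul_vf c

lemma lieD_add (B : Matrix (Fin 4) (Fin 4) ℝ) {X Y : VF ℂ} (hX : RadSmooth X) (hY : RadSmooth Y) :
    lieD B (X + Y) = lieD B X + lieD B Y := by
  funext p i
  have := congrFun (rot_add B hX hY p) i
  simp only [lieD, Pi.add_apply, mul_add, Finset.sum_add_distrib] at this ⊢
  have h : rot B (X + Y) p i = rot B X p i + rot B Y p i := this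
  rw [h]; ring

lemma lieD_smul (B : Matrix (Fin 4) (Fin 4) ℝ) (c : ℂ) {X : VF ℂ} (hX : RadSmooth X) :
    lieD B (c • X) = c • lieD B X := by
  funext p i
  have h : rot B (c • X) p i = c * rot B X p i := by
    rw [← rot_apply B (hX.smul_vf c), ← rot_apply B hX]
    exact rot_clm (c • ContinuousLinearMap.id ℝ ℂ) B (hX.apply i) p
  simp only [lieD, h, Pi.smul_apply, smul_eq_mul, mul_sub, Finset.mul_sum]
  congr 1
  exact Finset.sum_congr rfl fun _ _ => by ring

/-- The Lie derivative along an infinitesimal rotation, as an endomorphism. -/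
noncomputable def lieEnd (B : Matrix (Fin 4) (Fin 4) ℝ) : Module.End ℂ smoothVF where
  toFun X := ⟨lieD B X.1, X.2.lieD B⟩
  map_add' X Y := Subtype.ext (lieD_add B X.2 Y.2)
  map_smul' c X := Subtype.ext (lieD_smul B c X.2)

lemma lieEnd_apply (B : Matrix (Fin 4) (Fin 4) ℝ) (X : smoothVF) :
    (lieEnd B X : VF ℂ) = lieD B X.1 := rfl

lemma lieEnd_comm (B C : Matrix (Fin 4) (Fin 4) ℝ) :
    lieEnd B * lieEnd C = lieEnd C * lieEnd B + lieEnd (C * B - B * C) := by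
  refine LinearMap.ext fun X => Subtype.ext ?_
  exact sub_eq_iff_eq_add'.1 (lieD_comm B C X.2)

lemma lieEnd_add (B C : Matrix (Fin 4) (Fin 4) ℝ) : lieEnd (B + C) = lieEnd B + lieEnd C := by
  refine LinearMap.ext fun X => Subtype.ext ?_
  funext p i
  simp only [lieEnd_apply, LinearMap.add_apply, Submodule.coe_add, Pi.add_apply, lieD,
    rot_add_matrix, Matrix.add_apply]
  push_cast
  simp only [add_mul, Finset.sum_add_distrib]
  ring

lemma lieEnd_smul (r : ℝ) (B : Matrix (Fin 4) (Fin 4) ℝ) : lieEnd (r • B) = (r : ℂ) • lieEnd B := by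
  refine LinearMap.ext fun X => Subtype.ext ?_
  funext p i
  simp only [lieEnd_apply, LinearMap.smul_apply, Submodule.coe_smul, Pi.smul_apply, lieD,
    rot_smul_matrix, Matrix.smul_apply, smul_eq_mul, Complex.real_smul]
  simp only [Complex.coe_algebraMap, RCLike.ofReal_mul, mul_sub, Finset.mul_sum, mul_assoc]

lemma lieEnd_sum {ι : Type*} (s : Finset ι) (B : ι → Matrix (Fin 4) (Fin 4) ℝ) :
    lieEnd (∑ i ∈ s, B i) = ∑ i ∈ s, lieEnd (B i) := by
  classical
  induction s using Finset.induction_on with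
  | empty =>
    have := lieEnd_smul 0 0
    simpa using this
  | insert a s ha ih => rw [Finset.sum_insert ha, Finset.sum_insert ha, lieEnd_add, ih]

/-- The angular momentum operators of the sector `ε`. -/
noncomputable def angMom (ε : ℤˣ) (a : Fin 3) : Module.End ℂ smoothVF :=
  (-(Complex.I / 2)) • lieEnd (basisMat ε a)

/-- The factor -i/2 turns the structure constants -2 ε_{abc} of the basis fields into the usual i
ε_{abc} of angular momentum. -/
lemma angMom_comm (ε : ℤˣ) (a b : Fin 3) : angMom ε a * angMom ε b = angMom ε b * angMom ε a
    + Complex.I • ∑ c, (levi a b c : ℂ) • angMom ε c := by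
  have h := lieEnd_comm (basisMat ε a) (basisMat ε b)
  rw [basisMat_comm, lieEnd_smul, lieEnd_sum] at h
  simp only [lieEnd_smul] at h
  simp only [angMom, smul_mul_smul_comm, h, smul_add]
  congr 1
  simp only [Finset.smul_sum, smul_smul]
  refine Finset.sum_congr rfl fun c _ => ?_
  congr 1
  push_cast
  ring

lemma angMom_commute {ε δ : ℤˣ} (h : ε ≠ δ) (a b : Fin 3) :
    Commute (angMom ε a) (angMom δ b) := by
  have h1 := lieEnd_comm (basisMat ε a) (basisMat δ b)
  rw [basisMat_mul_of_ne h, sub_self] at h1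
  have h2 : lieEnd 0 = 0 := by simpa using lieEnd_smul 0 0
  rw [h2, add_zero] at h1
  exact (Commute.smul_left (show Commute (lieEnd (basisMat ε a)) (lieEnd (basisMat δ b)) from h1)
    _).smul_right _

/-- The raising operator of the sector `ε`. -/
noncomputable def raise (ε : ℤˣ) : Module.End ℂ smoothVF :=
  angMom ε 0 + Complex.I • angMom ε 1

/-- The lowering operator of the sector `ε`. -/
noncomputable def lower (ε : ℤˣ) : Module.End ℂ smoothVF :=
  angMom ε 0 + (-Complex.I) • angMom ε 1

/-- Twice the weight operator of the sector `ε`. -/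
noncomputable def weightOp (ε : ℤˣ) : Module.End ℂ smoothVF := (2 : ℂ) • angMom ε 2

lemma raise_mul_lower (ε : ℤˣ) : raise ε * lower ε = lower ε * raise ε + weightOp ε := by
  have h := angMom_comm ε 0 1
  simp [levi_eq, Fin.sum_univ_three] at h
  simp only [raise, lower, weightOp, add_mul, mul_add, mul_smul_comm, smul_mul_assoc, h]
  simp only [smul_add, smul_smul, neg_mul, mul_neg, Complex.I_mul_I]
  module

lemma weightOp_mul_lower (ε : ℤˣ) :
    weightOp ε * lower ε = lower ε * weightOp ε + (-2 : ℂ) • lower ε := by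
  have h := angMom_comm ε 2 0
  have h' := angMom_comm ε 2 1
  simp [levi_eq, Fin.sum_univ_three] at h h'
  simp only [lower, weightOp, mul_add, add_mul, mul_smul_comm, smul_mul_assoc, h, h']
  simp only [smul_add, smul_smul]
  match_scalars <;> ring_nf <;> simp [Complex.I_sq]

/-! ### Strings of lowered highest weight vectors -/

section Strings

variable {W : Type*} [AddCommGroup W] [Module ℂ W] {e f h : Module.End ℂ W} {v : W} {N : ℂ}

lemma weight_pow_lower (hf : h * f = f * h + (-2 : ℂ) • f) (hv : h v = N • v) (k : ℕ) :
    h ((f ^ k) v) = (N - 2 * k) • (f ^ k) v := by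
  induction k with
  | zero => simp [hv]
  | succ k ih =>
    rw [pow_succ', Module.End.mul_apply, ← Module.End.mul_apply h f, hf]
    simp only [LinearMap.add_apply, Module.End.mul_apply, LinearMap.smul_apply, ih, map_smul,
      ← add_smul]
    congr 1
    push_cast; ring

/-- Moving e to the right through the k + 1 factors f collects the weights N, N - 2, …, N - 2k,
whose sum is (k + 1)(N - k). -/
lemma raise_pow_lower (hf : h * f = f * h + (-2 : ℂ) • f) (he : e * f = f * e + h)
    (hv : h v = N • v) (hev : e v = 0) (k : ℕ) :
    e ((f ^ (k + 1)) v) = ((k + 1) * (N - k)) • (f ^ k) v := by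
  induction k with
  | zero =>
    rw [zero_add, pow_one, ← Module.End.mul_apply e f, he]
    simp [hev, hv]
  | succ k ih =>
    rw [pow_succ' f (k + 1), Module.End.mul_apply, ← Module.End.mul_apply e f, he]
    simp only [LinearMap.add_apply, Module.End.mul_apply, ih, weight_pow_lower hf hv, map_smul]
    rw [← Module.End.mul_apply, ← pow_succ', ← add_smul]
    congr 1
    push_cast; ring

end Strings

/-! ### The Hermitian form -/

/-- The bilinear pairing on smooth fields. -/
noncomputable def ipForm : smoothVF →ₗ[ℂ] smoothVF →ₗ[ℂ] ℂ :=
  LinearMap.mk₂ ℂ (fun X Y => ip X.1 Y.1) (fun X Y Z => ip_add_left X.2 Y.2 Z.2)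
    (fun c X Y => ip_smul_left c X.1 Y.1)
    (fun X Y Z => by
      simp only [ip_comm X.1]
      exact ip_add_left Y.2 Z.2 X.2)
    (fun c X Y => by
      simp only [ip_comm X.1]
      exact ip_smul_left c Y.1 X.1)

lemma ipForm_apply (X Y : smoothVF) : ipForm X Y = ip X.1 Y.1 := rfl

lemma ipForm_lieEnd {B : Matrix (Fin 4) (Fin 4) ℝ} (hB : B.transpose = -B) (X Y : smoothVF) :
    ipForm (lieEnd B X) Y = - ipForm X (lieEnd B Y) := ip_lieD hB X.2 Y.2

lemma ipForm_angMom (ε : ℤˣ) (a : Fin 3) (X Y : smoothVF) :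
    ipForm (angMom ε a X) Y = - ipForm X (angMom ε a Y) := by
  simp only [angMom, LinearMap.smul_apply, map_smul, smul_eq_mul,
    ipForm_lieEnd (basisMat_transpose ε a)]
  ring

lemma ipForm_raise (ε : ℤˣ) (X Y : smoothVF) :
    ipForm (raise ε X) Y = - ipForm X (raise ε Y) := by
  simp only [raise, LinearMap.add_apply, LinearMap.smul_apply, map_smul, map_add, smul_eq_mul,
    ipForm_angMom]
  ring

/-- Complex conjugation of fields. -/
noncomputable def conjVF (X : smoothVF) : smoothVF :=
  ⟨fun p i => (starRingEnd ℂ) (X.1 p i), RadSmooth.pi fun i =>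
    (X.2.apply i).clm (Complex.conjCLE : ℂ →L[ℝ] ℂ)⟩

lemma conjVF_add (X Y : smoothVF) : conjVF (X + Y) = conjVF X + conjVF Y := by
  refine Subtype.ext ?_
  funext p i
  simp [conjVF]

lemma conjVF_smul (c : ℂ) (X : smoothVF) :
    conjVF (c • X) = (starRingEnd ℂ) c • conjVF X := by
  refine Subtype.ext ?_
  funext p i
  simp [conjVF]

lemma conjVF_lieEnd (B : Matrix (Fin 4) (Fin 4) ℝ) (X : smoothVF) :
    conjVF (lieEnd B X) = lieEnd B (conjVF X) := by
  refine Subtype.ext ?_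
  funext p i
  have h : rot B (conjVF X).1 p i = (starRingEnd ℂ) (rot B X.1 p i) := by
    rw [← rot_apply B (conjVF X).2, ← rot_apply B X.2]
    exact rot_clm (Complex.conjCLE : ℂ →L[ℝ] ℂ) B (X.2.apply i) p
  show (starRingEnd ℂ) (lieD B X.1 p i) = lieD B (conjVF X).1 p i
  simp only [lieD, h, map_sub, map_sum, map_mul]
  congr 1
  refine Finset.sum_congr rfl fun k _ => ?_
  congr 1
  exact Complex.conj_ofReal _

lemma conjVF_angMom (ε : ℤˣ) (a : Fin 3) (X : smoothVF) :
    conjVF (angMom ε a X) = - angMom ε a (conjVF X) := by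
  simp only [angMom, LinearMap.smul_apply, conjVF_smul, conjVF_lieEnd, ← neg_smul]
  congr 1
  rw [map_neg, map_div₀, Complex.conj_I, Complex.conj_ofNat]
  ring

lemma conjVF_lower (ε : ℤˣ) (X : smoothVF) :
    conjVF (lower ε X) = - raise ε (conjVF X) := by
  have : lower ε X = angMom ε 0 X + (-Complex.I) • angMom ε 1 X := by
    simp only [lower, LinearMap.add_apply, LinearMap.smul_apply]
  rw [this, conjVF_add, conjVF_smul, conjVF_angMom, conjVF_angMom]
  simp only [raise, LinearMap.add_apply, LinearMap.smul_apply, map_neg, Complex.conj_I]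
  module

/-- Lowering and raising are adjoint for the Hermitian form: the sign from integration by parts
cancels the sign from conjugating the factor i. -/
lemma herm_lower (ε : ℤˣ) (X Y : smoothVF) :
    ipForm (conjVF (lower ε X)) Y = ipForm (conjVF X) (raise ε Y) := by
  rw [conjVF_lower, map_neg, LinearMap.neg_apply, ipForm_raise, neg_neg]

lemma herm_self (X : smoothVF) : ipForm (conjVF X) X
    = ((∫ p, ∑ i, Complex.normSq (X.1 p i) ∂S3vol : ℝ) : ℂ) := by
  rw [ipForm_apply, ip, ← integral_complex_ofReal]
  congr 1
  funext p
  push_cast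
  refine Finset.sum_congr rfl fun i _ => ?_
  exact (Complex.normSq_eq_conj_mul_self).symm

lemma continuous_normSq (X : smoothVF) :
    Continuous fun p => ∑ i, Complex.normSq (X.1 p i) :=
  continuous_finsetSum _ fun i _ =>
    Complex.continuous_normSq.comp (X.2.apply i).continuous

/-- A continuous nonnegative function with integral zero vanishes almost everywhere, hence
everywhere, because the surface measure charges every nonempty open set. -/
lemma eq_zero_of_herm_nonpos {X : smoothVF}
    (h : ∫ p, ∑ i, Complex.normSq (X.1 p i) ∂S3vol ≤ 0) : X = 0 := by
  have hn : ∀ p, 0 ≤ ∑ i, Complex.normSq (X.1 p i) := fun p =>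
    Finset.sum_nonneg fun i _ => Complex.normSq_nonneg _
  have hc := continuous_normSq X
  have hi : Integrable (fun p => ∑ i, Complex.normSq (X.1 p i)) S3vol := by
    simpa using hc.continuousOn.integrableOn_compact (μ := S3vol) isCompact_univ
  have h0 : ∫ p, ∑ i, Complex.normSq (X.1 p i) ∂S3vol = 0 :=
    le_antisymm h (integral_nonneg hn)
  rw [integral_eq_zero_iff_of_nonneg hn hi] at h0
  have h1 := (Continuous.ae_eq_iff_eq S3vol hc continuous_const).1 h0
  refine Subtype.ext ?_
  funext p i
  have h2 := congrFun h1 p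
  have h3 := (Finset.sum_eq_zero_iff_of_nonneg fun i _ => Complex.normSq_nonneg _).1 h2 i
    (Finset.mem_univ i)
  exact Complex.normSq_eq_zero.1 h3

/-- A highest weight vector of weight `N` is killed by `N + 1` lowering operators. -/
lemma lower_pow_eq_zero (ε : ℤˣ) {v : smoothVF} {N : ℕ} (hv : weightOp ε v = (N : ℂ) • v)
    (hev : raise ε v = 0) {k : ℕ} (hk : N < k) : (lower ε ^ k) v = 0 := by
  have hw : (lower ε ^ (N + 1)) v = 0 := by
    set w := (lower ε ^ (N + 1)) v with hw
    -- The coefficient (k + 1)(N - k) vanishes at k = N.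
    have h1 : raise ε w = 0 := by
      rw [hw, raise_pow_lower (weightOp_mul_lower ε) (raise_mul_lower ε) hv hev]
      simp
    have h2 : weightOp ε w = (-(N + 2) : ℂ) • w := by
      rw [hw, weight_pow_lower (weightOp_mul_lower ε) hv]
      congr 1
      push_cast; ring
    have h3 : raise ε (lower ε w) = (-(N + 2) : ℂ) • w := by
      rw [← Module.End.mul_apply, raise_mul_lower, LinearMap.add_apply, Module.End.mul_apply, h1,
        map_zero, zero_add, h2]
    -- Adjointness gives ‖fw‖² = ⟨w, e f w⟩ = -(N + 2) ‖w‖², which forces w = 0.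
    have h4 := herm_lower ε w (lower ε w)
    rw [h3, map_smul, herm_self, herm_self, smul_eq_mul] at h4
    have h5 : ∫ p, ∑ i, Complex.normSq ((lower ε w).1 p i) ∂S3vol
        = -(N + 2) * ∫ p, ∑ i, Complex.normSq (w.1 p i) ∂S3vol := by exact_mod_cast h4
    have h6 : 0 ≤ ∫ p, ∑ i, Complex.normSq ((lower ε w).1 p i) ∂S3vol :=
      integral_nonneg fun p => Finset.sum_nonneg fun i _ => Complex.normSq_nonneg _
    apply eq_zero_of_herm_nonpos
    by_contra hlt
    push Not at hlt
    have : (0 : ℝ) < (N + 2) * ∫ p, ∑ i, Complex.normSq (w.1 p i) ∂S3vol := by positivity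
    linarith
  obtain ⟨m, rfl⟩ := Nat.exists_eq_add_of_lt hk
  rw [show N + m + 1 = m + (N + 1) by ring, pow_add, Module.End.mul_apply, hw, map_zero]

lemma raise_commute_lower {ε δ : ℤˣ} (h : ε ≠ δ) : Commute (raise ε) (lower δ) := by
  have hc := fun a b => angMom_commute h a b
  exact ((hc 0 0).add_right ((hc 0 1).smul_right _)).add_left
    (((hc 1 0).add_right ((hc 1 1).smul_right _)).smul_left _)

lemma lower_commute_lower {ε δ : ℤˣ} (h : ε ≠ δ) : Commute (lower ε) (lower δ) := by
  have hc := fun a b => angMom_commute h a b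
  exact ((hc 0 0).add_right ((hc 0 1).smul_right _)).add_left
    (((hc 1 0).add_right ((hc 1 1).smul_right _)).smul_left _)

lemma weightOp_commute_lower {ε δ : ℤˣ} (h : ε ≠ δ) : Commute (weightOp ε) (lower δ) := by
  have hc := fun a b => angMom_commute h a b
  exact (((hc 2 0).add_right ((hc 2 1).smul_right _)).smul_left _)

/-! ### The vector harmonics -/

/-- The basis fields of `so(4)` as smooth complex fields. -/
noncomputable def frameVF (ε : ℤˣ) (a : Fin 3) : smoothVF := ⟨frame ℂ ε a, radSmooth_frame ε a⟩

lemma lieEnd_frameVF (ε : ℤˣ) (a b : Fin 3) : lieEnd (basisMat ε a) (frameVF ε b)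
    = (-2 : ℂ) • ∑ c, (levi a b c : ℂ) • frameVF ε c := by
  refine Subtype.ext ?_
  rw [lieEnd_apply]
  refine (lieD_frame ε a b).trans ?_
  simp [frameVF]

lemma lieEnd_frameVF_of_ne {ε δ : ℤˣ} (h : ε ≠ δ) (a b : Fin 3) :
    lieEnd (basisMat ε a) (frameVF δ b) = 0 :=
  Subtype.ext (lieD_frame_of_ne h a b)

/-- The smooth divergence-free tangent fields. -/
noncomputable def sdiffSub : Submodule ℂ smoothVF where
  carrier := {X | IsTangent X.1 ∧ ∀ p, div X.1 p = 0}
  add_mem' := by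
    rintro X Y ⟨hX, hX'⟩ ⟨hY, hY'⟩
    refine ⟨fun p => ?_, fun p => ?_⟩
    · simp only [Submodule.coe_add, Pi.add_apply, mul_add, Finset.sum_add_distrib, hX p, hY p,
        add_zero]
    · have h : ∀ i, tderiv i (X.1 + Y.1) p i = tderiv i X.1 p i + tderiv i Y.1 p i := fun i =>
        congrFun (tderiv_add i X.2 Y.2 p) i
      have h1 := hX' p
      have h2 := hY' p
      rw [div_eq] at h1 h2
      simp only [div_eq, Submodule.coe_add, h, Finset.sum_add_distrib, h1, h2, add_zero]
  zero_mem' := ⟨fun p => by simp, fun p => by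
    have h : ∀ i, tderiv i (0 : VF ℂ) p = 0 := fun i => tderiv_const i 0 p
    simp [div_eq, h]⟩
  smul_mem' := by
    rintro c X ⟨hX, hX'⟩
    refine ⟨fun p => ?_, fun p => ?_⟩
    · have h : ∀ i, ((p.1 i : ℝ) : ℂ) * (c * X.1 p i) = c * (((p.1 i : ℝ) : ℂ) * X.1 p i) :=
        fun i => by ring
      have := hX p
      show ∑ i, ((p.1 i : ℝ) : ℂ) * (c * X.1 p i) = 0
      simp only [h, ← Finset.mul_sum]
      exact mul_eq_zero_of_right _ this
    · have h : ∀ i, tderiv i (c • X.1) p i = c * tderiv i X.1 p i := fun i => by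
        rw [← tderiv_apply i (X.2.smul_vf c), ← tderiv_apply i X.2]
        exact tderiv_clm (c • ContinuousLinearMap.id ℝ ℂ) i (X.2.apply i) p
      have h1 := hX' p
      rw [div_eq] at h1
      simp only [div_eq, Submodule.coe_smul, h, ← Finset.mul_sum, h1, mul_zero]

lemma mem_sdiffS3_iff {X : VF ℂ} : X ∈ sdiffS3 ℂ ↔ ∃ h : RadSmooth X, (⟨X, h⟩ : smoothVF) ∈ sdiffSub := by
  constructor
  · rintro ⟨h1, h2, h3⟩
    exact ⟨isSmooth_iff.1 h1, h2, h3⟩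
  · rintro ⟨h1, h2, h3⟩
    exact ⟨isSmooth_iff.2 h1, h2, h3⟩

lemma frameVF_mem_sdiffSub (ε : ℤˣ) (a : Fin 3) : frameVF ε a ∈ sdiffSub :=
  ⟨isTangent_frame ε a, div_lin (basisMat_transpose ε a)⟩

lemma lieEnd_mem_sdiffSub {B : Matrix (Fin 4) (Fin 4) ℝ} (hB : B.transpose = -B) {X : smoothVF}
    (hX : X ∈ sdiffSub) : lieEnd B X ∈ sdiffSub :=
  ⟨IsTangent.lieD hB X.2 hX.1, div_lieD B X.2 hX.2⟩

/-- The fields that are orthogonal to `so(4)`. -/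
noncomputable def perpSub : Submodule ℂ smoothVF where
  carrier := {X | ∀ ε a, ipForm (frameVF ε a) X = 0}
  add_mem' := fun hX hY ε a => by rw [map_add, hX ε a, hY ε a, add_zero]
  zero_mem' := fun ε a => map_zero _
  smul_mem' := fun c X hX ε a => by rw [map_smul, hX ε a, smul_zero]

/-- Skew-adjointness moves the Lie derivative onto a basis field, and so(4) is stable under it. -/
lemma lieEnd_mem_perpSub (ε : ℤˣ) (a : Fin 3) {X : smoothVF} (hX : X ∈ perpSub) :
    lieEnd (basisMat ε a) X ∈ perpSub := by
  intro δ b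
  have h := ipForm_lieEnd (basisMat_transpose ε a) (frameVF δ b) X
  rw [eq_comm, neg_eq_iff_eq_neg] at h
  rw [h, neg_eq_zero]
  by_cases hε : ε = δ
  · subst hε
    simp only [lieEnd_frameVF, map_smul, map_sum, LinearMap.smul_apply, LinearMap.sum_apply,
      hX ε _, smul_zero, Finset.sum_const_zero]
  · rw [lieEnd_frameVF_of_ne hε, map_zero, LinearMap.zero_apply]

lemma lower_mem {S : Submodule ℂ smoothVF} (hS : ∀ ε a, ∀ X ∈ S, lieEnd (basisMat ε a) X ∈ S)
    (ε : ℤˣ) {X : smoothVF} (hX : X ∈ S) : lower ε X ∈ S :=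
  S.add_mem (S.smul_mem _ (hS _ _ _ hX)) (S.smul_mem _ (S.smul_mem _ (hS _ _ _ hX)))

lemma lower_pow_mem {S : Submodule ℂ smoothVF} (hS : ∀ ε a, ∀ X ∈ S, lieEnd (basisMat ε a) X ∈ S)
    (ε : ℤˣ) {X : smoothVF} (hX : X ∈ S) (k : ℕ) : (lower ε ^ k) X ∈ S := by
  induction k with
  | zero => simpa using hX
  | succ k ih =>
    rw [pow_succ', Module.End.mul_apply]
    exact lower_mem hS ε ih

lemma lieEnd_basisMat_mem_sdiffSub : ∀ ε a, ∀ X ∈ sdiffSub, lieEnd (basisMat ε a) X ∈ sdiffSub :=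
  fun ε a _ hX => lieEnd_mem_sdiffSub (basisMat_transpose ε a) hX

/-! ### The highest weight fields -/

/-- The function `p₁ + i p₂`. -/
noncomputable def zfun (p : S3) : ℂ := ((p.1 1 : ℝ) : ℂ) + Complex.I * ((p.1 2 : ℝ) : ℂ)

lemma radSmooth_zfun : RadSmooth zfun :=
  (radSmooth_coord_cast (𝕜 := ℂ) 1).add
    ((RadSmooth.const Complex.I).mul (radSmooth_coord_cast (𝕜 := ℂ) 2))

lemma rot_zfun (ε : ℤˣ) (a : Fin 3) (p : S3) : rot (basisMat ε a) zfun p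
    = frame ℂ ε a p 1 + Complex.I * frame ℂ ε a p 2 := by
  have h := rot_add (basisMat ε a) (radSmooth_coord_cast (𝕜 := ℂ) 1)
    ((RadSmooth.const Complex.I).mul (radSmooth_coord_cast (𝕜 := ℂ) 2)) p
  have h2 := rot_mul (basisMat ε a) (RadSmooth.const Complex.I) (radSmooth_coord_cast (𝕜 := ℂ) 2) p
  rw [h2] at h
  have h3 : rot (basisMat ε a) (fun _ : S3 => Complex.I) p = 0 := by simp [rot]
  have h4 := fun i => rot_coord (𝕜 := ℂ) (basisMat_transpose ε a) i p
  rw [h3, mul_zero, add_zero, h4, h4] at h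
  exact h

/-- Together with `rot_zfun_raise` this says that z = p₁ + i p₂ is a highest weight vector of spin
1/2 in both sectors, among the linear functions. -/
lemma rot_zfun_two (ε : ℤˣ) (p : S3) : rot (basisMat ε 2) zfun p = Complex.I * zfun p := by
  rw [rot_zfun]
  rcases Int.units_eq_one_or ε with rfl | rfl
  · simp [frame_one, zfun]
    linear_combination -((p.1 2 : ℝ) : ℂ) * Complex.I_sq
  · simp [frame_neg_one, zfun]
    linear_combination -((p.1 2 : ℝ) : ℂ) * Complex.I_sq

lemma rot_zfun_raise (ε : ℤˣ) (p : S3) :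
    rot (basisMat ε 0) zfun p + Complex.I * rot (basisMat ε 1) zfun p = 0 := by
  rw [rot_zfun, rot_zfun]
  rcases Int.units_eq_one_or ε with rfl | rfl
  · simp [frame_one]
    linear_combination -((p.1 0 : ℝ) : ℂ) * Complex.I_sq
  · simp [frame_neg_one]
    linear_combination ((p.1 0 : ℝ) : ℂ) * Complex.I_sq

/-- Multiplication of a field by a power of `p₁ + i p₂`. -/
noncomputable def zpowMul (n : ℕ) (X : smoothVF) : smoothVF :=
  ⟨fun p i => zfun p ^ n * X.1 p i, RadSmooth.pi fun i =>
    (radSmooth_zfun.pow n).mul (X.2.apply i)⟩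

lemma lieEnd_zpowMul (B : Matrix (Fin 4) (Fin 4) ℝ) (n : ℕ) (X : smoothVF) (p : S3) (i : Fin 4) :
    (lieEnd B (zpowMul n X)).1 p i = zfun p ^ n * (lieEnd B X).1 p i
      + n * zfun p ^ (n - 1) * rot B zfun p * X.1 p i := by
  show lieD B (zpowMul n X).1 p i = zfun p ^ n * lieD B X.1 p i + _
  have h : rot B (zpowMul n X).1 p i
      = zfun p ^ n * rot B X.1 p i + X.1 p i * (n * zfun p ^ (n - 1) * rot B zfun p) := by
    rw [← rot_apply B (zpowMul n X).2, ← rot_apply B X.2, ← rot_pow B radSmooth_zfun]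
    exact rot_mul B (radSmooth_zfun.pow n) (X.2.apply i) p
  have h2 : ∑ k, (RCLike.ofReal (B i k) : ℂ) * (zpowMul n X).1 p k
      = zfun p ^ n * ∑ k, (RCLike.ofReal (B i k) : ℂ) * X.1 p k := by
    rw [Finset.mul_sum]
    exact Finset.sum_congr rfl fun k _ => mul_left_comm _ _ _
  simp only [lieD, h]
  rw [mul_sub]
  refine (congrArg _ h2).trans ?_
  ring

/-- The highest weight element of the sector `ε` of `so(4)`. -/
noncomputable def frameTop (ε : ℤˣ) : smoothVF := frameVF ε 0 + Complex.I • frameVF ε 1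

lemma angMom_two_frameTop (ε : ℤˣ) :
    lieEnd (basisMat ε 2) (frameTop ε) = (2 * Complex.I) • frameTop ε := by
  simp only [frameTop, map_add, map_smul, lieEnd_frameVF]
  simp [levi_eq, Fin.sum_univ_three]
  match_scalars <;> ring_nf
  simp

lemma lieEnd_frameTop_raise (ε : ℤˣ) : lieEnd (basisMat ε 0) (frameTop ε)
    + Complex.I • lieEnd (basisMat ε 1) (frameTop ε) = 0 := by
  simp only [frameTop, map_add, map_smul, lieEnd_frameVF]
  simp [levi_eq, Fin.sum_univ_three]
  module

lemma lieEnd_frameTop_of_ne {ε δ : ℤˣ} (h : ε ≠ δ) (a : Fin 3) :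
    lieEnd (basisMat ε a) (frameTop δ) = 0 := by
  simp only [frameTop, map_add, map_smul, lieEnd_frameVF_of_ne h]
  simp

/-- The highest weight fields. -/
noncomputable def topVF (j : ℕ) (ε : ℤˣ) : smoothVF :=
  (-((ε : ℤ) : ℂ)) • zpowMul (j - 1) (frameTop ε)

/-- The sign -ε undoes the one in `basisMat 1`, which is minus the left-invariant matrix. -/
lemma topVF_eq (j : ℕ) (ε : ℤˣ) : (topVF j ε).1 = highestWeight j ε := by
  funext p i
  show (-((ε : ℤ) : ℂ)) * (zfun p ^ (j - 1) * (frame ℂ ε 0 p i + Complex.I * frame ℂ ε 1 p i)) = _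
  rw [highestWeight]
  rcases Int.units_eq_one_or ε with rfl | rfl
  · simp only [if_true, frame, basisMat_one, lin_neg, lin_complex, ← leftInv_eq, zfun,
      Pi.neg_apply]
    push_cast
    ring
  · simp only [frame, basisMat_neg_one, lin_complex, ← rightInv_eq, zfun]
    rw [if_neg (by decide)]
    push_cast
    ring

/-- Twice the spin with respect to the sector `δ`. -/
def topWeight (j : ℕ) (ε δ : ℤˣ) : ℕ := if δ = ε then j + 1 else j - 1

/-- Weights add under products: the power of z contributes j - 1 in each sector, and the so(4)
factor contributes 2 in its own sector and 0 in the other. -/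
lemma weightOp_topVF {j : ℕ} (hj : 1 ≤ j) (ε δ : ℤˣ) :
    weightOp δ (topVF j ε) = (topWeight j ε δ : ℂ) • topVF j ε := by
  have hw : ∀ X, weightOp δ X = (-Complex.I) • lieEnd (basisMat δ 2) X := by
    intro X
    simp only [weightOp, angMom, LinearMap.smul_apply, smul_smul]
    congr 1; ring
  rw [topVF, map_smul, smul_comm]
  congr 1
  have h : ∀ c : ℂ, lieEnd (basisMat δ 2) (frameTop ε) = c • frameTop ε →
      weightOp δ (zpowMul (j - 1) (frameTop ε))
        = (((j - 1 : ℕ) : ℂ) + -Complex.I * c) • zpowMul (j - 1) (frameTop ε) := by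
    intro c hc
    rw [hw]
    refine Subtype.ext ?_
    funext p i
    show -Complex.I * (lieEnd (basisMat δ 2) (zpowMul (j - 1) (frameTop ε))).1 p i
      = (((j - 1 : ℕ) : ℂ) + -Complex.I * c) * (zfun p ^ (j - 1) * (frameTop ε).1 p i)
    rw [lieEnd_zpowMul, hc, rot_zfun_two]
    show -Complex.I * (zfun p ^ (j - 1) * (c * (frameTop ε).1 p i) + _) = _
    -- The Leibniz rule has exponent j - 2, which is a truncated subtraction when j = 1; then the
    -- coefficient is zero.
    rcases Nat.eq_zero_or_pos (j - 1) with h0 | h0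
    · rw [h0]; push_cast; ring
    · have hz : zfun p ^ (j - 1 - 1) * zfun p = zfun p ^ (j - 1) := by
        rw [← pow_succ]; congr 1; omega
      linear_combination (-Complex.I * ((j - 1 : ℕ) : ℂ) * Complex.I * (frameTop ε).1 p i) * hz
        - ((j - 1 : ℕ) : ℂ) * zfun p ^ (j - 1) * (frameTop ε).1 p i * Complex.I_sq
  rw [topWeight]
  split_ifs with hd
  · subst hd
    rw [h _ (angMom_two_frameTop δ)]
    congr 1
    push_cast [Nat.cast_sub hj]
    linear_combination -2 * Complex.I_sq
  · rw [h 0 (by rw [lieEnd_frameTop_of_ne hd, zero_smul])]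
    simp

/-- The raising operators act as derivations and annihilate both z and the so(4) factor. -/
lemma raise_topVF (j : ℕ) (ε δ : ℤˣ) : raise δ (topVF j ε) = 0 := by
  rw [topVF, map_smul]
  refine smul_eq_zero_of_right _ ?_
  have h : lieEnd (basisMat δ 0) (frameTop ε)
      + Complex.I • lieEnd (basisMat δ 1) (frameTop ε) = 0 := by
    by_cases hd : δ = ε
    · subst hd; exact lieEnd_frameTop_raise δ
    · simp [lieEnd_frameTop_of_ne hd]
  have hr : ∀ X, raise δ X = (-(Complex.I / 2)) •
      (lieEnd (basisMat δ 0) X + Complex.I • lieEnd (basisMat δ 1) X) := by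
    intro X
    simp only [raise, angMom, LinearMap.add_apply, LinearMap.smul_apply, smul_add]
    rw [smul_comm]
  rw [hr]
  refine smul_eq_zero_of_right _ (Subtype.ext ?_)
  funext p i
  show (lieEnd (basisMat δ 0) (zpowMul (j - 1) (frameTop ε))).1 p i
    + Complex.I * (lieEnd (basisMat δ 1) (zpowMul (j - 1) (frameTop ε))).1 p i = 0
  have h2 := congrFun (congrFun (congrArg Subtype.val h) p) i
  change (lieEnd (basisMat δ 0) (frameTop ε)).1 p i
    + Complex.I * (lieEnd (basisMat δ 1) (frameTop ε)).1 p i = 0 at h2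
  rw [lieEnd_zpowMul, lieEnd_zpowMul]
  linear_combination zfun p ^ (j - 1) * h2
    + ((j - 1 : ℕ) : ℂ) * zfun p ^ (j - 1 - 1) * (frameTop ε).1 p i * rot_zfun_raise δ p

/-- For the divergence of zⁿF with F divergence-free only n zⁿ⁻¹ F · ∇z remains, and F · ∇z is the
raising derivative of z. -/
lemma topVF_mem_sdiffSub (j : ℕ) (ε : ℤˣ) : topVF j ε ∈ sdiffSub := by
  refine sdiffSub.smul_mem _ ?_
  have hF : frameTop ε ∈ sdiffSub :=
    sdiffSub.add_mem (frameVF_mem_sdiffSub ε 0) (sdiffSub.smul_mem _ (frameVF_mem_sdiffSub ε 1))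
  refine ⟨fun p => ?_, fun p => ?_⟩
  · have h := hF.1 p
    have h2 : ∀ i, ((p.1 i : ℝ) : ℂ) * (zpowMul (j - 1) (frameTop ε)).1 p i
        = zfun p ^ (j - 1) * (((p.1 i : ℝ) : ℂ) * (frameTop ε).1 p i) := fun i => by
      show ((p.1 i : ℝ) : ℂ) * (zfun p ^ (j - 1) * (frameTop ε).1 p i) = _
      ring
    refine (Finset.sum_congr rfl fun i _ => h2 i).trans ?_
    rw [← Finset.mul_sum]
    exact mul_eq_zero_of_right _ h
  · have h := hF.2 p
    rw [div_eq] at h ⊢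
    have h2 : ∀ i, tderiv i (zpowMul (j - 1) (frameTop ε)).1 p i
        = zfun p ^ (j - 1) * tderiv i (frameTop ε).1 p i
          + (((j - 1 : ℕ) : ℂ) * zfun p ^ (j - 1 - 1)) *
            ((frameTop ε).1 p i * tderiv i zfun p) := by
      intro i
      rw [← tderiv_apply i (zpowMul (j - 1) (frameTop ε)).2, ← tderiv_apply i (frameTop ε).2]
      refine (tderiv_mul i (radSmooth_zfun.pow (j - 1)) ((frameTop ε).2.apply i) p).trans ?_
      rw [tderiv_pow i radSmooth_zfun]
      ring
    have h3 : ∑ i, (frameTop ε).1 p i * tderiv i zfun p = 0 := by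
      have h4 := rot_zfun_raise ε p
      rw [rot_eq_sum, rot_eq_sum, Finset.mul_sum, ← Finset.sum_add_distrib] at h4
      rw [← h4]
      refine Finset.sum_congr rfl fun i _ => ?_
      show (frame ℂ ε 0 p i + Complex.I * frame ℂ ε 1 p i) * tderiv i zfun p = _
      simp only [frame, lin, Complex.real_smul]
      simp only [Complex.coe_algebraMap]
      ring
    simp only [h2, Finset.sum_add_distrib, ← Finset.mul_sum, h, h3, mul_zero, add_zero]

/-- Test against a basis field of sector δ using the weight operator of the opposite sector: it
annihilates the basis field, while its eigenvalue on the highest weight field is j + 1 or j - 1,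
nonzero for j > 1. Skew-adjointness then gives orthogonality. -/
lemma topVF_mem_perpSub {j : ℕ} (hj : 1 < j) (ε : ℤˣ) : topVF j ε ∈ perpSub := by
  intro δ a
  have key : ∀ δ' : ℤˣ, δ' ≠ δ → ipForm (frameVF δ a) (topVF j ε) = 0 := by
    intro δ' hd
    have h1 : ipForm (frameVF δ a) (weightOp δ' (topVF j ε)) = 0 := by
      have h2 : ∀ X, weightOp δ' X = (2 : ℂ) • (-(Complex.I / 2)) • lieEnd (basisMat δ' 2) X :=
        fun X => rfl
      have h3 := ipForm_lieEnd (basisMat_transpose δ' 2) (frameVF δ a) (topVF j ε)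
      rw [lieEnd_frameVF_of_ne hd, map_zero, LinearMap.zero_apply, eq_comm, neg_eq_zero] at h3
      rw [h2, map_smul, map_smul, h3, smul_zero, smul_zero]
    rw [weightOp_topVF hj.le, map_smul, smul_eq_mul] at h1
    refine (mul_eq_zero.1 h1).resolve_left ?_
    have : topWeight j ε δ' ≠ 0 := by
      rw [topWeight]; split_ifs <;> omega
    exact_mod_cast this
  exact key (-δ) (by rcases Int.units_eq_one_or δ with rfl | rfl <;> decide)

/-! ### The harmonics as lowered highest weight fields, and their stability under so(4) -/

lemma lowerQ_eq {X : smoothVF} (hT : IsTangent X.1) : lowerQ X.1 = (lower 1 X).1 := by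
  have h : ∀ a, bracket (toC (leftInv a)) X.1 = -(lieEnd (basisMat 1 a) X).1 := by
    intro a
    -- Tangency is what identifies the bracket with the Lie derivative; the sign comes from
    -- `basisMat 1 a = -leftMat a`.
    rw [leftInv_eq, ← lin_complex, bracket_lin _ hT, basisMat_one, lieEnd_apply]
    funext p i
    have := congrFun (rot_smul_matrix (-1) (leftMat a) X.1 p) i
    simp only [neg_smul, one_smul] at this
    simp only [lieD, Pi.neg_apply, this, Matrix.neg_apply]
    simp
    ring
  rw [lowerQ, h, h]
  show _ = (-(Complex.I / 2)) • (lieEnd (basisMat 1 0) X).1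
    + (-Complex.I) • (-(Complex.I / 2)) • (lieEnd (basisMat 1 1) X).1
  module

lemma lowerQt_eq {X : smoothVF} (hT : IsTangent X.1) : lowerQt X.1 = (lower (-1) X).1 := by
  have h : ∀ a, bracket (toC (rightInv a)) X.1 = (lieEnd (basisMat (-1) a) X).1 := by
    intro a
    rw [rightInv_eq, ← lin_complex, bracket_lin _ hT, basisMat_neg_one, lieEnd_apply]
  rw [lowerQt, h, h]
  show _ = (-(Complex.I / 2)) • (lieEnd (basisMat (-1) 0) X).1
    + (-Complex.I) • (-(Complex.I / 2)) • (lieEnd (basisMat (-1) 1) X).1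
  module

lemma iterate_eq_lower_pow {Λ : VF ℂ → VF ℂ} {ε : ℤˣ}
    (hΛ : ∀ X : smoothVF, IsTangent X.1 → Λ X.1 = (lower ε X).1) {X : smoothVF}
    (hX : X ∈ sdiffSub) (k : ℕ) : Λ^[k] X.1 = ((lower ε ^ k) X).1 := by
  induction k with
  | zero => simp
  | succ k ih =>
    rw [Function.iterate_succ_apply', ih,
      hΛ _ (lower_pow_mem lieEnd_basisMat_mem_sdiffSub ε hX k).1, pow_succ', Module.End.mul_apply]

/-- The normalisation of the harmonics. -/
noncomputable def normFactor (α : HIndex) : ℂ :=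
  (α.ε : ℤ) * Complex.I * (Real.sqrt α.j / (2 * Real.pi) : ℝ) *
    (Real.sqrt (((α.twoQ - α.k).factorial : ℝ) / ((α.twoQ).factorial * (α.k).factorial)) : ℝ) *
    (Real.sqrt (((α.twoQt - α.l).factorial : ℝ) / ((α.twoQt).factorial * (α.l).factorial)) : ℝ)

lemma normFactor_ne_zero (α : HIndex) : normFactor α ≠ 0 := by
  have hj : (0 : ℝ) < α.j := by exact_mod_cast α.one_le_j
  have h1 : ((α.ε : ℤ) : ℂ) ≠ 0 := by exact_mod_cast α.ε.ne_zero
  have h2 : (Real.sqrt α.j / (2 * Real.pi) : ℝ) ≠ 0 := by positivity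
  have h3 : ∀ a b c : ℕ, Real.sqrt ((a.factorial : ℝ) / (b.factorial * c.factorial)) ≠ 0 := by
    intro a b c
    have : (0 : ℝ) < (a.factorial : ℝ) / (b.factorial * c.factorial) := by positivity
    positivity
  unfold normFactor
  refine mul_ne_zero (mul_ne_zero (mul_ne_zero (mul_ne_zero h1 Complex.I_ne_zero) ?_) ?_) ?_
  · exact_mod_cast h2
  · exact_mod_cast h3 _ _ _
  · exact_mod_cast h3 _ _ _

/-- The unnormalised harmonics. -/
noncomputable def harmVF (j : ℕ) (ε : ℤˣ) (k l : ℕ) : smoothVF :=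
  (lower 1 ^ k) ((lower (-1) ^ l) (topVF j ε))

lemma harmVF_mem {S : Submodule ℂ smoothVF}
    (hS : ∀ ε a, ∀ X ∈ S, lieEnd (basisMat ε a) X ∈ S) {j : ℕ} {ε : ℤˣ} (h : topVF j ε ∈ S)
    (k l : ℕ) : harmVF j ε k l ∈ S :=
  lower_pow_mem hS 1 (lower_pow_mem hS (-1) h l) k

lemma V_eq (α : HIndex) : V α = normFactor α • (harmVF α.j α.ε α.k α.l).1 := by
  have ht := topVF_mem_sdiffSub α.j α.ε
  rw [V, ← topVF_eq, iterate_eq_lower_pow (fun X => lowerQt_eq) ht,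
    iterate_eq_lower_pow (fun X => lowerQ_eq) (lower_pow_mem lieEnd_basisMat_mem_sdiffSub (-1) ht _)]
  rfl

lemma twoQ_eq (α : HIndex) : α.twoQ = topWeight α.j α.ε 1 := by
  have := α.one_le_j
  rw [HIndex.twoQ, topWeight]
  rcases Int.units_eq_one_or α.ε with h | h <;> rw [h]
  · simp
  · rw [if_neg (by decide)]; simp; omega

lemma twoQt_eq (α : HIndex) : α.twoQt = topWeight α.j α.ε (-1) := by
  have := α.one_le_j
  rw [HIndex.twoQt, topWeight]
  rcases Int.units_eq_one_or α.ε with h | h <;> rw [h]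
  · rw [if_neg (by decide)]; simp
  · simp

lemma harmVF_eq_zero {j : ℕ} (hj : 1 ≤ j) (ε : ℤˣ) {k l : ℕ}
    (h : topWeight j ε 1 < k ∨ topWeight j ε (-1) < l) : harmVF j ε k l = 0 := by
  rw [harmVF]
  rcases h with h | h
  · rw [← Module.End.mul_apply, ((lower_commute_lower (by decide)).pow_pow k l).eq,
      Module.End.mul_apply,
      lower_pow_eq_zero 1 (weightOp_topVF hj ε 1) (raise_topVF j ε 1) h, map_zero]
  · rw [lower_pow_eq_zero (-1) (weightOp_topVF hj ε (-1)) (raise_topVF j ε (-1)) h, map_zero]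

/-- The harmonics of spin at least two, as a space of smooth fields. -/
noncomputable def harmonicSub : Submodule ℂ smoothVF := harmonicSpan.comap smoothVF.subtype

/-- Inside the index range a lowered field is a nonzero multiple of a harmonic; outside it is zero.
Lowering therefore never leaves the span. -/
lemma harmVF_mem_harmonicSub {j : ℕ} (hj : 1 < j) (ε : ℤˣ) (k l : ℕ) :
    harmVF j ε k l ∈ harmonicSub := by
  by_cases h : topWeight j ε 1 < k ∨ topWeight j ε (-1) < l
  · rw [harmVF_eq_zero hj.le ε h]; exact harmonicSub.zero_mem
  · push Not at h
    have hε : (k : ℤ) ≤ j + ε ∧ (l : ℤ) ≤ j - ε := by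
      simp only [topWeight] at h
      rcases Int.units_eq_one_or ε with rfl | rfl
      · rw [if_pos rfl, if_neg (by decide)] at h
        simp; omega
      · rw [if_pos rfl, if_neg (by decide)] at h
        simp; omega
    let α : HIndex := ⟨j, hj.le, ε, k, l, hε.1, hε.2⟩
    have h1 : V α ∈ harmonicSpan := Submodule.subset_span ⟨α, hj, rfl⟩
    rw [V_eq] at h1
    exact (harmonicSpan.smul_mem_iff (normFactor_ne_zero α)).1 h1

lemma lower_harmVF_one (j : ℕ) (ε : ℤˣ) (k l : ℕ) :
    lower 1 (harmVF j ε k l) = harmVF j ε (k + 1) l := by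
  rw [harmVF, harmVF, pow_succ', Module.End.mul_apply]

lemma lower_harmVF_neg_one (j : ℕ) (ε : ℤˣ) (k l : ℕ) :
    lower (-1) (harmVF j ε k l) = harmVF j ε k (l + 1) := by
  rw [harmVF, harmVF, ← Module.End.mul_apply,
    ((lower_commute_lower (ε := -1) (δ := 1) (by decide)).pow_right k).eq, Module.End.mul_apply,
    pow_succ' (lower (-1)), Module.End.mul_apply]

/-- The operators of one sector pass through the lowering operators of the other, so each sector is
a single string and its formulas apply. -/
lemma raise_weight_harmVF {j : ℕ} (hj : 1 < j) (ε δ : ℤˣ) (k l : ℕ) :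
    weightOp δ (harmVF j ε k l) ∈ harmonicSub ∧ raise δ (harmVF j ε k l) ∈ harmonicSub := by
  have hw := weightOp_topVF hj.le ε
  have hr := raise_topVF j ε
  rcases Int.units_eq_one_or δ with rfl | rfl
  · have h1 : weightOp 1 ((lower (-1) ^ l) (topVF j ε))
        = (topWeight j ε 1 : ℂ) • (lower (-1) ^ l) (topVF j ε) := by
      rw [← Module.End.mul_apply, ((weightOp_commute_lower (by decide)).pow_right l).eq,
        Module.End.mul_apply, hw, map_smul]
    have h2 : raise 1 ((lower (-1) ^ l) (topVF j ε)) = 0 := by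
      rw [← Module.End.mul_apply, ((raise_commute_lower (by decide)).pow_right l).eq,
        Module.End.mul_apply, hr, map_zero]
    constructor
    · rw [harmVF, weight_pow_lower (weightOp_mul_lower 1) h1]
      exact harmonicSub.smul_mem _ (harmVF_mem_harmonicSub hj ε k l)
    · cases k with
      | zero => rw [harmVF, pow_zero, Module.End.one_apply, h2]; exact harmonicSub.zero_mem
      | succ k =>
        rw [harmVF, raise_pow_lower (weightOp_mul_lower 1) (raise_mul_lower 1) h1 h2]
        exact harmonicSub.smul_mem _ (harmVF_mem_harmonicSub hj ε k l)
  · have h1 : weightOp (-1) (harmVF j ε k l)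
        = (lower 1 ^ k) (weightOp (-1) ((lower (-1) ^ l) (topVF j ε))) := by
      rw [harmVF, ← Module.End.mul_apply,
        ((weightOp_commute_lower (by decide)).pow_right k).eq, Module.End.mul_apply]
    have h2 : raise (-1) (harmVF j ε k l)
        = (lower 1 ^ k) (raise (-1) ((lower (-1) ^ l) (topVF j ε))) := by
      rw [harmVF, ← Module.End.mul_apply,
        ((raise_commute_lower (by decide)).pow_right k).eq, Module.End.mul_apply]
    constructor
    · rw [h1, weight_pow_lower (weightOp_mul_lower (-1)) (hw (-1)), map_smul]
      exact harmonicSub.smul_mem _ (harmVF_mem_harmonicSub hj ε k l)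
    · cases l with
      | zero =>
        rw [h2, pow_zero, Module.End.one_apply, hr, map_zero]; exact harmonicSub.zero_mem
      | succ l =>
        rw [h2, raise_pow_lower (weightOp_mul_lower (-1)) (raise_mul_lower (-1)) (hw (-1))
          (hr (-1)), map_smul]
        exact harmonicSub.smul_mem _ (harmVF_mem_harmonicSub hj ε k l)

/-- The three generators of a sector are linear combinations of its raising, lowering and weight
operators, each of which maps harmonics to multiples of harmonics of the same j and ε. -/
lemma lieEnd_harmVF {j : ℕ} (hj : 1 < j) (ε δ : ℤˣ) (a : Fin 3) (k l : ℕ) :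
    lieEnd (basisMat δ a) (harmVF j ε k l) ∈ harmonicSub := by
  obtain ⟨h1, h2⟩ := raise_weight_harmVF hj ε δ k l
  have h3 : lower δ (harmVF j ε k l) ∈ harmonicSub := by
    rcases Int.units_eq_one_or δ with rfl | rfl
    · rw [lower_harmVF_one]; exact harmVF_mem_harmonicSub hj _ _ _
    · rw [lower_harmVF_neg_one]; exact harmVF_mem_harmonicSub hj _ _ _
  set X := harmVF j ε k l
  have e1 : weightOp δ X = (2 : ℂ) • (-(Complex.I / 2)) • lieEnd (basisMat δ 2) X := rfl
  have e2 : raise δ X = (-(Complex.I / 2)) • lieEnd (basisMat δ 0) X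
    + Complex.I • (-(Complex.I / 2)) • lieEnd (basisMat δ 1) X := rfl
  have e3 : lower δ X = (-(Complex.I / 2)) • lieEnd (basisMat δ 0) X
    + (-Complex.I) • (-(Complex.I / 2)) • lieEnd (basisMat δ 1) X := rfl
  fin_cases a
  · have : lieEnd (basisMat δ 0) X = Complex.I • (raise δ X + lower δ X) := by
      rw [e2, e3]
      match_scalars <;> ring_nf
      all_goals simp
    exact this ▸ harmonicSub.smul_mem _ (harmonicSub.add_mem h2 h3)
  · have : lieEnd (basisMat δ 1) X = raise δ X + (-1 : ℂ) • lower δ X := by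
      rw [e2, e3]
      match_scalars <;> ring_nf
      all_goals simp
    exact this ▸ harmonicSub.add_mem h2 (harmonicSub.smul_mem _ h3)
  · have : lieEnd (basisMat δ 2) X = Complex.I • weightOp δ X := by
      rw [e1]
      match_scalars
      ring_nf
      simp
    exact this ▸ harmonicSub.smul_mem _ h1

/-! ### The harmonics with `j = 1` -/

/-- The components of the harmonics with `j = 1` in the basis of `so(4)`. -/
noncomputable def spinOne (n : Fin 3) (a : Fin 3) : ℂ :=
  (-Complex.I / (2 * Real.pi)) *
    (![![1, Complex.I, 0], ![0, 0, -(Real.sqrt 2 : ℂ)], ![-1, Complex.I, 0]] n a : ℂ)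

lemma sqrt_two_mul_self : (Real.sqrt 2 : ℂ) * (Real.sqrt 2 : ℂ) = 2 := by
  norm_cast
  rw [Real.mul_self_sqrt (by norm_num)]

lemma pi_ne_zero' : (Real.pi : ℂ) ≠ 0 := by exact_mod_cast Real.pi_ne_zero

lemma conj_spinOne (n a : Fin 3) : (starRingEnd ℂ) (spinOne n a)
    = (-1) ^ (n : ℕ) * spinOne (2 - n) a := by
  fin_cases n <;> fin_cases a <;> simp [spinOne, Complex.conj_ofNat] <;> ring

lemma spinOne_orthogonal (n m : Fin 3) : ∑ a, (starRingEnd ℂ) (spinOne n a) * spinOne m a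
    = if n = m then 1 / (2 * (Real.pi : ℂ) ^ 2) else 0 := by
  have hp := pi_ne_zero'
  have hs := sqrt_two_mul_self
  simp only [spinOne, Fin.sum_univ_three]
  fin_cases n <;> fin_cases m <;> simp <;> field_simp <;> ring_nf <;>
    simp [pow_two, hs, Complex.conj_ofNat] <;> norm_num

/-- With `spinOne_orthogonal` it says that `spinOne` is unitary up to the norm 2π² of the basis
fields; this inverts the passage from frame components to modes. -/
lemma spinOne_complete (a b : Fin 3) : ∑ n, (starRingEnd ℂ) (spinOne n a) * spinOne n b
    = if a = b then 1 / (2 * (Real.pi : ℂ) ^ 2) else 0 := by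
  have hp := pi_ne_zero'
  have hs := sqrt_two_mul_self
  simp only [spinOne, Fin.sum_univ_three]
  fin_cases a <;> fin_cases b <;> simp <;> field_simp <;> ring_nf <;>
    simp [pow_two, hs, Complex.conj_ofNat]

lemma lower_frameTop (ε : ℤˣ) : lower ε (frameTop ε) = (-2 : ℂ) • frameVF ε 2 := by
  have e3 : ∀ X, lower ε X = (-(Complex.I / 2)) • lieEnd (basisMat ε 0) X
    + (-Complex.I) • (-(Complex.I / 2)) • lieEnd (basisMat ε 1) X := fun _ => rfl
  rw [e3, frameTop]
  simp only [map_add, map_smul, lieEnd_frameVF]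
  simp [levi_eq, Fin.sum_univ_three]
  match_scalars
  ring_nf
  simp

lemma lower_frameVF_two (ε : ℤˣ) :
    lower ε (frameVF ε 2) = frameVF ε 0 + (-Complex.I) • frameVF ε 1 := by
  have e3 : ∀ X, lower ε X = (-(Complex.I / 2)) • lieEnd (basisMat ε 0) X
    + (-Complex.I) • (-(Complex.I / 2)) • lieEnd (basisMat ε 1) X := fun _ => rfl
  rw [e3]
  simp only [lieEnd_frameVF]
  simp [levi_eq, Fin.sum_univ_three]
  match_scalars <;> ring_nf
  simp

/-- The index of the harmonic with `j = 1` in the sector `ε`, lowered `n` times. -/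
def so4Idx (ε : ℤˣ) (n : Fin 3) : SO4Index :=
  ⟨⟨1, le_rfl, ε, if ε = 1 then n else 0, if ε = 1 then 0 else n, by
    rcases Int.units_eq_one_or ε with rfl | rfl
    · have := n.2; simp; omega
    · simp, by
    rcases Int.units_eq_one_or ε with rfl | rfl
    · simp
    · have := n.2; rw [if_neg (by decide)]; simp; omega⟩, rfl⟩

lemma so4Idx_eq (α : SO4Index) : ∃ ε n, so4Idx ε n = α := by
  obtain ⟨⟨j, hj, ε, k, l, hk, hl⟩, h⟩ := α
  simp only at h
  subst h
  rcases Int.units_eq_one_or ε with rfl | rfl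
  · simp at hk hl
    refine ⟨1, ⟨k, by omega⟩, ?_⟩
    simp only [so4Idx, Subtype.mk.injEq, HIndex.mk.injEq]
    simp; omega
  · simp at hk hl
    refine ⟨-1, ⟨l, by omega⟩, ?_⟩
    simp only [so4Idx, Subtype.mk.injEq, HIndex.mk.injEq]
    simp; omega

/-- The harmonics with `j = 1` are indexed by the sector and the number of lowerings. -/
noncomputable def so4IdxEquiv : ℤˣ × Fin 3 ≃ SO4Index :=
  Equiv.ofBijective (fun q => so4Idx q.1 q.2) ⟨by
    rintro ⟨ε, n⟩ ⟨δ, m⟩ h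
    simp only [so4Idx, Subtype.mk.injEq, HIndex.mk.injEq] at h
    obtain ⟨-, rfl, h1, h2⟩ := h
    refine Prod.ext rfl (Fin.ext ?_)
    rcases Int.units_eq_one_or ε with rfl | rfl
    · simpa using h1
    · simpa using h2, fun α => by
    obtain ⟨ε, n, h⟩ := so4Idx_eq α
    exact ⟨(ε, n), h⟩⟩

lemma sum_so4Index {A : Type*} [AddCommMonoid A] (f : SO4Index → A) :
    ∑ α, f α = ∑ ε, ∑ n, f (so4Idx ε n) := by
  rw [← Fintype.sum_prod_type', ← so4IdxEquiv.sum_comp]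
  rfl

lemma forall_so4Index {P : SO4Index → Prop} : (∀ α, P α) ↔ ∀ ε n, P (so4Idx ε n) := by
  constructor
  · intro h ε n; exact h _
  · intro h α
    obtain ⟨ε, n, rfl⟩ := so4Idx_eq α
    exact h ε n

lemma topVF_one (ε : ℤˣ) : topVF 1 ε = (-((ε : ℤ) : ℂ)) • frameTop ε := by
  rw [topVF]
  congr 1
  refine Subtype.ext ?_
  funext p i
  simp [zpowMul]

lemma lower_pow_frameTop (ε : ℤˣ) (n : Fin 3) : (lower ε ^ (n : ℕ)) (frameTop ε)
    = ∑ a, (![![1, Complex.I, 0], ![0, 0, -2], ![-2, 2 * Complex.I, 0]] n a : ℂ) • frameVF ε a := by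
  fin_cases n
  · simp [frameTop, Fin.sum_univ_three]
  · simp [lower_frameTop, Fin.sum_univ_three]
  · rw [show ((⟨2, by norm_num⟩ : Fin 3) : ℕ) = 2 from rfl, pow_two, Module.End.mul_apply,
      lower_frameTop, map_smul, lower_frameVF_two]
    simp [Fin.sum_univ_three, smul_smul]
    module

lemma sqrt_factorial (n : Fin 3) :
    Real.sqrt (((2 - (n : ℕ)).factorial : ℝ) / ((2 : ℕ).factorial * (n : ℕ).factorial))
      = ![1, Real.sqrt 2 / 2, 1 / 2] n := by
  fin_cases n
  · simp
  · rw [Real.sqrt_eq_iff_mul_self_eq_of_pos (by simp)]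
    simp [div_mul_div_comm]
  · rw [Real.sqrt_eq_iff_mul_self_eq_of_pos (by simp)]
    norm_num [Nat.factorial]

/-- The ε in the normalisation meets the -ε of the highest weight field, and ε² = 1, so the
components are the same in both sectors. The square roots absorb the factors produced by lowering.
-/
lemma V_so4Idx (ε : ℤˣ) (n : Fin 3) : V (so4Idx ε n) = ∑ a, spinOne n a • frame ℂ ε a := by
  have h1 : (harmVF (so4Idx ε n).1.j (so4Idx ε n).1.ε (so4Idx ε n).1.k (so4Idx ε n).1.l)
      = (-((ε : ℤ) : ℂ)) • (lower ε ^ (n : ℕ)) (frameTop ε) := by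
    rw [harmVF]
    rcases Int.units_eq_one_or ε with rfl | rfl
    · simp only [so4Idx, topVF_one]
      simp
    · simp only [so4Idx, topVF_one]
      simp
  have h2 : normFactor (so4Idx ε n) = ((ε : ℤ) : ℂ) * Complex.I * (1 / (2 * Real.pi) : ℝ)
      * (![1, Real.sqrt 2 / 2, 1 / 2] n : ℝ) := by
    rw [normFactor, twoQ_eq, twoQt_eq, ← sqrt_factorial]
    rcases Int.units_eq_one_or ε with rfl | rfl
    · simp [so4Idx, topWeight]
    · simp [so4Idx, topWeight]
  have h3 : ((ε : ℤ) : ℂ) * ((ε : ℤ) : ℂ) = 1 := by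
    rcases Int.units_eq_one_or ε with rfl | rfl <;> simp
  rw [V_eq, h1, h2, lower_pow_frameTop]
  have h4 : ∀ (Y : Fin 3 → ℂ), (∑ a, Y a • frameVF ε a).1 = ∑ a, Y a • frame ℂ ε a := by
    intro Y
    simp [frameVF]
  rw [Submodule.coe_smul, h4, smul_smul, Finset.smul_sum]
  refine Finset.sum_congr rfl fun a _ => ?_
  rw [smul_smul]
  congr 1
  have hs := sqrt_two_mul_self
  have h5 : ∀ x y : ℂ, ((ε : ℤ) : ℂ) * Complex.I * x * y * -((ε : ℤ) : ℂ) = -Complex.I * x * y :=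
    fun x y => by linear_combination (-Complex.I * x * y) * h3
  rw [h5, spinOne]
  fin_cases n <;> fin_cases a <;> simp <;> ring

/-! ### The subalgebra `so(4)` and its complement -/

lemma mem_so4_iff {X : VF ℝ} : X ∈ so4 ↔ ∃ c, X = so4Field c := by
  constructor
  · rintro ⟨B, hB, rfl⟩
    obtain ⟨c, rfl⟩ := exists_so4Mat ((LieAlgebra.Orthogonal.mem_so (Fin 4) ℝ B).1 hB)
    exact ⟨c, (so4Field_eq_linField c).symm⟩
  · rintro ⟨c, rfl⟩
    exact ⟨so4Mat c, (LieAlgebra.Orthogonal.mem_so (Fin 4) ℝ _).2 (so4Mat_transpose c),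
      so4Field_eq_linField c⟩

/-! ### Components in the basis of so(4) -/

section Components

variable {𝕜 : Type} [RCLike 𝕜]

/-- A combination of the basis fields. -/
noncomputable def comb (c : ℤˣ → Fin 3 → 𝕜) : VF 𝕜 := ∑ ε, ∑ a, c ε a • frame 𝕜 ε a

lemma comb_apply (c : ℤˣ → Fin 3 → 𝕜) (p : S3) (i : Fin 4) :
    comb c p i = ∑ ε, ∑ a, c ε a * frame 𝕜 ε a p i := by
  simp [comb]

lemma so4Field_eq_comb (c : ℤˣ → Fin 3 → ℝ) : so4Field c = comb c := by
  funext p i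
  rw [so4Field_apply, comb_apply]
  rfl

lemma toC_so4Field (c : ℤˣ → Fin 3 → ℝ) : toC (so4Field c) = comb fun ε a => (c ε a : ℂ) := by
  funext p i
  rw [comb_apply, toC, so4Field_apply]
  push_cast
  rfl

lemma radSmooth_comb (c : ℤˣ → Fin 3 → 𝕜) : RadSmooth (comb c) :=
  RadSmooth.sum_vf fun ε _ => RadSmooth.sum_vf fun a _ => (radSmooth_frame ε a).smul_vf _

lemma ip_frame_comb (c : ℤˣ → Fin 3 → 𝕜) (ε : ℤˣ) (a : Fin 3) :
    ip (frame 𝕜 ε a) (comb c) = 2 * (Real.pi : 𝕜) ^ 2 * c ε a := by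
  rw [ip_comm, comb, ip_sum_left (fun δ _ => RadSmooth.sum_vf fun b _ =>
    (radSmooth_frame δ b).smul_vf _) (radSmooth_frame ε a)]
  have h : ∀ δ, ip (∑ b, c δ b • frame 𝕜 δ b) (frame 𝕜 ε a)
      = ∑ b, if δ = ε ∧ b = a then c δ b * (2 * (Real.pi : 𝕜) ^ 2) else 0 := by
    intro δ
    rw [ip_sum_left (fun b _ => (radSmooth_frame δ b).smul_vf _) (radSmooth_frame ε a)]
    refine Finset.sum_congr rfl fun b _ => ?_
    rw [ip_smul_left, ip_frame]
    split_ifs <;> simp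
  simp only [h]
  rw [Finset.sum_eq_single ε (fun δ _ hδ => by simp [hδ])
        fun h => absurd (Finset.mem_univ ε) h]
  simp
  ring

lemma two_pi_sq_ne_zero : 2 * (Real.pi : 𝕜) ^ 2 ≠ 0 := by
  have : (Real.pi : 𝕜) ≠ 0 := by exact_mod_cast Real.pi_ne_zero
  exact mul_ne_zero two_ne_zero (pow_ne_zero _ this)

lemma comb_injective : Function.Injective (comb : (ℤˣ → Fin 3 → 𝕜) → VF 𝕜) := by
  intro c d h
  funext ε a
  have h1 := ip_frame_comb c ε a
  rw [h, ip_frame_comb] at h1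
  exact (mul_left_cancel₀ two_pi_sq_ne_zero h1).symm

end Components

lemma radSmooth_toC_iff {X : VF ℝ} : RadSmooth (toC X) ↔ RadSmooth X := by
  constructor
  · intro h
    exact RadSmooth.pi fun i => (h.apply i).clm Complex.reCLM
  · intro h
    exact RadSmooth.pi fun i => (h.apply i).clm Complex.ofRealCLM

lemma tderiv_toC {X : VF ℝ} (hX : RadSmooth X) (k i : Fin 4) (p : S3) :
    tderiv k (toC X) p i = (tderiv k X p i : ℂ) := by
  rw [← tderiv_apply k (radSmooth_toC_iff.2 hX), ← tderiv_apply k hX]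
  exact tderiv_clm Complex.ofRealCLM k (hX.apply i) p

lemma toC_mem_sdiffS3_iff {X : VF ℝ} : toC X ∈ sdiffS3 ℂ ↔ X ∈ sdiffS3 ℝ := by
  simp only [sdiffS3, mem_ofPred_eq, isSmooth_iff, radSmooth_toC_iff]
  refine and_congr_right fun h => and_congr (forall_congr' fun p => ?_) (forall_congr' fun p => ?_)
  · have : ∑ i, ((p.1 i : ℝ) : ℂ) * toC X p i = ((∑ i, p.1 i * X p i : ℝ) : ℂ) := by
      push_cast; rfl
    rw [← Complex.ofReal_eq_zero]
    exact Eq.congr_left this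
  · have : div (toC X) p = ((div X p : ℝ) : ℂ) := by
      simp only [div_eq, tderiv_toC h]
      push_cast; rfl
    rw [this, Complex.ofReal_eq_zero]

lemma toC_bracket {X Y : VF ℝ} (hX : RadSmooth X) (hY : RadSmooth Y) :
    toC (bracket X Y) = bracket (toC X) (toC Y) := by
  funext p i
  simp only [bracket, tderiv_toC hX, tderiv_toC hY, toC]
  push_cast
  rfl

lemma comb_mem_sdiffS3 (c : ℤˣ → Fin 3 → ℂ) : comb c ∈ sdiffS3 ℂ := by
  refine mem_sdiffS3_iff.2 ⟨radSmooth_comb c, ?_⟩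
  have : (⟨comb c, radSmooth_comb c⟩ : smoothVF) = ∑ ε, ∑ a, c ε a • frameVF ε a := by
    refine Subtype.ext ?_
    simp [comb, frameVF]
  rw [this]
  exact sdiffSub.sum_mem fun ε _ => sdiffSub.sum_mem fun a _ =>
    sdiffSub.smul_mem _ (frameVF_mem_sdiffSub ε a)

lemma so4_subset_sdiffS3 : so4 ⊆ sdiffS3 ℝ := by
  intro X hX
  obtain ⟨c, rfl⟩ := mem_so4_iff.1 hX
  rw [← toC_mem_sdiffS3_iff, toC_so4Field]
  exact comb_mem_sdiffS3 _

/-- Completeness of `spinOne` inverts `V_so4Idx`, so the basis fields lie in the span of the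
harmonics. -/
lemma frame_eq_sum_V (ε : ℤˣ) (b : Fin 3) : frame ℂ ε b
    = (2 * (Real.pi : ℂ) ^ 2) • ∑ n, (starRingEnd ℂ) (spinOne n b) • V (so4Idx ε n) := by
  simp only [V_so4Idx, Finset.smul_sum, smul_smul]
  rw [Finset.sum_comm]
  simp only [← Finset.sum_smul, ← Finset.mul_sum, spinOne_complete]
  have : 2 * (Real.pi : ℂ) ^ 2 * (1 / (2 * (Real.pi : ℂ) ^ 2)) = 1 :=
    mul_one_div_cancel (two_pi_sq_ne_zero (𝕜 := ℂ))
  simp only [mul_ite, mul_zero, ite_smul, zero_smul, Finset.sum_ite_eq, Finset.mem_univ, if_true]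
  exact (by rw [this, one_smul])

lemma mem_KC_iff {X : VF ℂ} : X ∈ KC ↔ ∃ c, X = comb c := by
  constructor
  · intro h
    rw [KC] at h
    induction h using Submodule.span_induction with
    | mem x hx =>
      obtain ⟨α, hα, rfl⟩ := hx
      obtain ⟨ε, n, h⟩ := so4Idx_eq ⟨α, hα⟩
      have h2 : V α = V (so4Idx ε n).1 := by rw [h]
      rw [h2, V_so4Idx]
      refine ⟨fun δ a => if δ = ε then spinOne n a else 0, ?_⟩
      rw [comb, Finset.sum_eq_single ε (fun δ _ hδ => by simp [hδ])
        fun h => absurd (Finset.mem_univ ε) h]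
      simp
    | zero => exact ⟨0, by simp [comb]⟩
    | add x y _ _ hx hy =>
      obtain ⟨c, rfl⟩ := hx
      obtain ⟨d, rfl⟩ := hy
      exact ⟨c + d, by simp [comb, add_smul, Finset.sum_add_distrib]⟩
    | smul r x _ hx =>
      obtain ⟨c, rfl⟩ := hx
      exact ⟨r • c, by simp [comb, Finset.smul_sum, smul_smul]⟩
  · rintro ⟨c, rfl⟩
    refine Submodule.sum_mem _ fun ε _ => Submodule.sum_mem _ fun a _ => Submodule.smul_mem _ _ ?_
    rw [frame_eq_sum_V]
    exact Submodule.smul_mem _ _ (Submodule.sum_mem _ fun n _ => Submodule.smul_mem _ _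
      (Submodule.subset_span ⟨_, (so4Idx ε n).2, rfl⟩))

lemma mem_so4_iff_mem_KC (X : VF ℝ) : X ∈ so4 ↔ X ∈ sdiffS3 ℝ ∧ toC X ∈ KC := by
  constructor
  · intro h
    refine ⟨so4_subset_sdiffS3 h, ?_⟩
    obtain ⟨c, rfl⟩ := mem_so4_iff.1 h
    exact mem_KC_iff.2 ⟨_, toC_so4Field c⟩
  · rintro ⟨-, h⟩
    obtain ⟨c, hc⟩ := mem_KC_iff.1 h
    -- The basis fields are real, so the real part of the combination has the real parts of the
    -- coefficients as its coefficients.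
    refine mem_so4_iff.2 ⟨fun ε a => (c ε a).re, ?_⟩
    funext p i
    have h1 := congrArg Complex.re (congrFun (congrFun hc p) i)
    rw [so4Field_apply, comb_apply, Complex.re_sum] at *
    simp only [Complex.re_sum] at h1
    refine h1.trans (Finset.sum_congr rfl fun ε _ => Finset.sum_congr rfl fun a _ => ?_)
    exact Complex.re_mul_ofReal _ _

lemma bracket_so4 {X Y : VF ℝ} (hX : X ∈ so4) (hY : Y ∈ so4) : bracket X Y ∈ so4 := by
  obtain ⟨B, hB, rfl⟩ := hX
  obtain ⟨C, hC, rfl⟩ := hY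
  have hB' := (LieAlgebra.Orthogonal.mem_so (Fin 4) ℝ B).1 hB
  have hC' := (LieAlgebra.Orthogonal.mem_so (Fin 4) ℝ C).1 hC
  refine ⟨C * B - B * C, (LieAlgebra.Orthogonal.mem_so (Fin 4) ℝ _).2 ?_, ?_⟩
  · rw [Matrix.transpose_sub, Matrix.transpose_mul, Matrix.transpose_mul, hB', hC']
    simp
  · rw [← lin_real, ← lin_real, ← lin_real, bracket_lin B (isTangent_lin hC'), lieD_lin hB']

lemma mem_so4_iff_existsUnique (X : VF ℝ) : X ∈ so4 ↔ ∃! c : ℤˣ → Fin 3 → ℝ, X = so4Field c := by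
  rw [mem_so4_iff]
  constructor
  · rintro ⟨c, rfl⟩
    refine ⟨c, rfl, fun d h => ?_⟩
    change so4Field c = so4Field d at h
    rw [so4Field_eq_comb, so4Field_eq_comb] at h
    exact (comb_injective h).symm
  · rintro ⟨c, h, -⟩
    exact ⟨c, h⟩

lemma coeff_so4Idx {X : VF ℂ} (hX : RadSmooth X) (ε : ℤˣ) (n : Fin 3) :
    coeff X (so4Idx ε n) = ∑ a, (starRingEnd ℂ) (spinOne n a) * ip (frame ℂ ε a) X := by
  have h : ∀ p i, (starRingEnd ℂ) (V (so4Idx ε n) p i)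
      = (∑ a, (starRingEnd ℂ) (spinOne n a) • frame ℂ ε a) p i := by
    intro p i
    rw [V_so4Idx]
    simp only [Finset.sum_apply, Pi.smul_apply, smul_eq_mul, map_sum, map_mul]
    refine Finset.sum_congr rfl fun a _ => ?_
    congr 1
    exact Complex.conj_ofReal _
  simp only [coeff, h]
  have h2 := ip_sum_left (s := Finset.univ) (X := fun a => (starRingEnd ℂ) (spinOne n a) • frame ℂ ε a)
    (fun a _ => (radSmooth_frame ε a).smul_vf _) hX
  rw [ip] at h2
  rw [h2]
  exact Finset.sum_congr rfl fun a _ => ip_smul_left _ _ _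

/-- The coefficients with j = 1 are the pairings with the basis fields multiplied by an invertible
matrix, so they vanish together. -/
lemma coeff_eq_zero_iff {X : smoothVF} :
    (∀ α : HIndex, α.j = 1 → coeff X.1 α = 0) ↔ X ∈ perpSub := by
  have h0 : (∀ α : HIndex, α.j = 1 → coeff X.1 α = 0) ↔ ∀ α : SO4Index, coeff X.1 α = 0 :=
    ⟨fun h α => h α.1 α.2, fun h α hα => h ⟨α, hα⟩⟩
  rw [h0, forall_so4Index]
  simp only [coeff_so4Idx X.2]
  constructor
  · intro h ε a
    rw [ipForm_apply]
    have h1 : ∑ n, spinOne n a * ∑ b, (starRingEnd ℂ) (spinOne n b) * ip (frame ℂ ε b) X.1 = 0 :=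
      Finset.sum_eq_zero fun n _ => by rw [h ε n, mul_zero]
    simp only [Finset.mul_sum, ← mul_assoc] at h1
    rw [Finset.sum_comm] at h1
    simp only [mul_comm (spinOne _ a), ← Finset.sum_mul, spinOne_complete] at h1
    have h2 := two_pi_sq_ne_zero (𝕜 := ℂ)
    simp only [ite_mul, zero_mul, Finset.sum_ite_eq', Finset.mem_univ, if_true] at h1
    exact (mul_eq_zero.1 h1).resolve_left (one_div_ne_zero h2)
  · intro h ε n
    refine Finset.sum_eq_zero fun a _ => ?_
    have := h ε a
    rw [ipForm_apply] at this
    exact mul_eq_zero_of_right _ this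

lemma mem_MC_iff {X : VF ℂ} :
    X ∈ MC ↔ ∃ h : RadSmooth X, (⟨X, h⟩ : smoothVF) ∈ sdiffSub ⊓ perpSub := by
  rw [MC, mem_ofPred_eq, mem_sdiffS3_iff]
  constructor
  · rintro ⟨⟨h, h1⟩, h2⟩
    exact ⟨h, h1, coeff_eq_zero_iff.1 h2⟩
  · rintro ⟨h, h1, h2⟩
    exact ⟨⟨h, h1⟩, coeff_eq_zero_iff.2 h2⟩

lemma mem_M_iff {X : VF ℝ} : X ∈ M ↔ toC X ∈ MC := by
  simp only [M, MC, mem_ofPred_eq, toC_mem_sdiffS3_iff]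

lemma ip_toC (X Y : VF ℝ) : ip (toC X) (toC Y) = ((ip X Y : ℝ) : ℂ) := by
  rw [ip, ip, ← integral_complex_ofReal]
  congr 1
  funext p
  push_cast
  rfl

lemma mem_M_iff' {X : VF ℝ} : X ∈ M ↔ X ∈ sdiffS3 ℝ ∧ ∀ ε a, ip (frame ℝ ε a) X = 0 := by
  rw [mem_M_iff, mem_MC_iff, ← toC_mem_sdiffS3_iff, mem_sdiffS3_iff]
  constructor
  · rintro ⟨h, h1, h2⟩
    refine ⟨⟨h, h1⟩, fun ε a => ?_⟩
    have := h2 ε a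
    change ip (toC (frame ℝ ε a)) (toC X) = 0 at this
    rw [ip_toC] at this
    exact_mod_cast this
  · rintro ⟨⟨h, h1⟩, h2⟩
    refine ⟨h, h1, fun ε a => ?_⟩
    show ip (toC (frame ℝ ε a)) (toC X) = 0
    rw [ip_toC, h2]
    rfl

lemma sdiffS3_add {X Y : VF ℝ} (hX : X ∈ sdiffS3 ℝ) (hY : Y ∈ sdiffS3 ℝ) :
    X + Y ∈ sdiffS3 ℝ := by
  rw [← toC_mem_sdiffS3_iff, mem_sdiffS3_iff] at *
  obtain ⟨h1, h1'⟩ := hX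
  obtain ⟨h2, h2'⟩ := hY
  have h : toC (X + Y) = toC X + toC Y := by funext p i; simp [toC]
  rw [h]
  exact ⟨h1.add_vf h2, sdiffSub.add_mem h1' h2'⟩

lemma sdiffS3_smul {X : VF ℝ} (r : ℝ) (hX : X ∈ sdiffS3 ℝ) : r • X ∈ sdiffS3 ℝ := by
  rw [← toC_mem_sdiffS3_iff, mem_sdiffS3_iff] at *
  obtain ⟨h1, h1'⟩ := hX
  have h : toC (r • X) = (r : ℂ) • toC X := by funext p i; simp [toC]
  rw [h]
  refine ⟨h1.smul_vf _, ?_⟩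
  rw [show (⟨(r : ℂ) • toC X, h1.smul_vf _⟩ : smoothVF) = (r : ℂ) • ⟨toC X, h1⟩ from
    Subtype.ext rfl]
  exact sdiffSub.smul_mem _ h1'

lemma mem_sdiffS3_iff_existsUnique (X : VF ℝ) : X ∈ sdiffS3 ℝ ↔
    ∃! YZ : VF ℝ × VF ℝ, YZ.1 ∈ so4 ∧ YZ.2 ∈ M ∧ X = YZ.1 + YZ.2 := by
  constructor
  · intro hX
    have hXs : RadSmooth X := isSmooth_iff.1 hX.1
    -- The coefficients of the orthogonal projection onto so(4), the basis fields having squared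
    -- norm 2π².
    set c : ℤˣ → Fin 3 → ℝ := fun ε a => (2 * Real.pi ^ 2)⁻¹ * ip (frame ℝ ε a) X with hc
    have hpi : 2 * Real.pi ^ 2 ≠ 0 := by positivity
    refine ⟨(so4Field c, X + (-1 : ℝ) • so4Field c), ⟨mem_so4_iff.2 ⟨c, rfl⟩, ?_, ?_⟩, ?_⟩
    · refine mem_M_iff'.2 ⟨sdiffS3_add hX (sdiffS3_smul _ (so4_subset_sdiffS3
        (mem_so4_iff.2 ⟨c, rfl⟩))), fun ε a => ?_⟩
      rw [so4Field_eq_comb, ip_comm, ip_add_left hXs ((radSmooth_comb c).smul_vf _)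
        (radSmooth_frame ε a), ip_smul_left, ip_comm (comb c), ip_frame_comb, ip_comm X, hc]
      simp only [RCLike.ofReal_real_eq_id, id]
      field_simp
      ring
    · simp
    · rintro ⟨Y, Z⟩ ⟨hY, hZ, rfl⟩
      simp only at hY hZ hX hXs
      obtain ⟨d, rfl⟩ := mem_so4_iff.1 hY
      have hZ' := mem_M_iff'.1 hZ
      have hcd : c = d := by
        funext ε a
        simp only [hc]
        rw [so4Field_eq_comb, ip_comm, ip_add_left (radSmooth_comb d) (isSmooth_iff.1 hZ'.1.1)
          (radSmooth_frame ε a), ip_comm (comb d), ip_frame_comb, ip_comm Z, hZ'.2 ε a]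
        simp only [RCLike.ofReal_real_eq_id, id]
        field_simp
        ring
      rw [hcd]
      simp
  · rintro ⟨⟨Y, Z⟩, ⟨hY, hZ, h⟩, -⟩
    rw [h]
    exact sdiffS3_add (so4_subset_sdiffS3 hY) (mem_M_iff'.1 hZ).1

/-! ### The inclusions [M, K] ⊆ M -/

/-- The bracket with a combination of the basis fields. -/
lemma bracket_comb (c : ℤˣ → Fin 3 → ℂ) {X : smoothVF} (hT : IsTangent X.1) :
    bracket X.1 (comb c) = (-∑ ε, ∑ a, c ε a • lieEnd (basisMat ε a) X : smoothVF).1 := by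
  rw [bracket_antisymm]
  have h : ∀ k p i, tderiv k (comb c) p i = ∑ ε, ∑ a, c ε a * tderiv k (frame ℂ ε a) p i := by
    intro k p i
    have h1 := tderiv_sum (s := Finset.univ) k (f := fun ε => ∑ a, c ε a • frame ℂ ε a)
      (fun ε _ => RadSmooth.sum_vf fun a _ => (radSmooth_frame ε a).smul_vf _) p
    have h2 : ∀ ε, tderiv k (∑ a, c ε a • frame ℂ ε a) p
        = ∑ a, tderiv k (c ε a • frame ℂ ε a) p := by
      intro ε
      have := tderiv_sum (s := Finset.univ) k (f := fun a => c ε a • frame ℂ ε a)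
        (fun a _ => (radSmooth_frame ε a).smul_vf _) p
      rw [← this]
      congr 1
    have h3 : ∀ ε a, tderiv k (c ε a • frame ℂ ε a) p i = c ε a * tderiv k (frame ℂ ε a) p i := by
      intro ε a
      rw [← tderiv_apply k ((radSmooth_frame ε a).smul_vf _), ← tderiv_apply k (radSmooth_frame ε a)]
      exact tderiv_clm (c ε a • ContinuousLinearMap.id ℝ ℂ) k ((radSmooth_frame ε a).apply i) p
    have h4 : tderiv k (comb c) p = ∑ ε, tderiv k (∑ a, c ε a • frame ℂ ε a) p := by
      rw [← h1]
      congr 1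
    rw [h4]
    simp only [h2, Finset.sum_apply, h3]
  have h5 : bracket (comb c) X.1 = ∑ ε, ∑ a, c ε a • bracket (frame ℂ ε a) X.1 := by
    funext p i
    simp only [bracket, h, comb_apply, Finset.sum_apply, Pi.smul_apply, smul_eq_mul,
      Finset.sum_mul, Finset.mul_sum, ← Finset.sum_sub_distrib]
    rw [Finset.sum_comm]
    refine Finset.sum_congr rfl fun ε _ => ?_
    rw [Finset.sum_comm]
    refine Finset.sum_congr rfl fun a _ => Finset.sum_congr rfl fun k _ => ?_
    ring
  rw [h5]
  simp only [frame, bracket_lin _ hT, Submodule.coe_neg]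
  congr 1

lemma bracket_MC {X Y : VF ℂ} (hX : X ∈ MC) (hY : Y ∈ KC) : bracket X Y ∈ MC := by
  obtain ⟨hs, hX1, hX2⟩ := mem_MC_iff.1 hX
  obtain ⟨c, rfl⟩ := mem_KC_iff.1 hY
  have h := bracket_comb c (X := ⟨X, hs⟩) hX1.1
  change bracket X (comb c) = _ at h
  rw [h]
  refine mem_MC_iff.2 ⟨Subtype.prop _, ?_⟩
  refine Submodule.neg_mem _ (Submodule.sum_mem _ fun ε _ => Submodule.sum_mem _ fun a _ =>
    Submodule.smul_mem _ _ ⟨?_, ?_⟩)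
  · exact lieEnd_basisMat_mem_sdiffSub ε a _ hX1
  · exact lieEnd_mem_perpSub ε a hX2

lemma bracket_M {X Y : VF ℝ} (hX : X ∈ M) (hY : Y ∈ so4) : bracket X Y ∈ M := by
  rw [mem_M_iff] at *
  have hX' := (mem_MC_iff.1 hX).1
  have hY' := (mem_so4_iff_mem_KC Y).1 hY
  rw [toC_bracket (radSmooth_toC_iff.1 hX') (isSmooth_iff.1 hY'.1.1)]
  exact bracket_MC hX hY'.2

lemma V_mem_MC {α : HIndex} (hα : 1 < α.j) : V α ∈ MC := by
  rw [V_eq]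
  refine mem_MC_iff.2 ⟨Subtype.prop (normFactor α • harmVF α.j α.ε α.k α.l), ?_⟩
  refine Submodule.smul_mem _ _ ⟨?_, ?_⟩
  · exact harmVF_mem lieEnd_basisMat_mem_sdiffSub (topVF_mem_sdiffSub _ _) _ _
  · exact harmVF_mem (fun ε a X hX => lieEnd_mem_perpSub ε a hX) (topVF_mem_perpSub hα _) _ _

/-- The highest weight fields with j > 1 are divergence-free and orthogonal to so(4), and both
properties survive lowering. -/
lemma harmonicSpan_subset_MC : (harmonicSpan : Set (VF ℂ)) ⊆ MC := by
  have h : harmonicSpan ≤ (sdiffSub ⊓ perpSub).map smoothVF.subtype := by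
    refine Submodule.span_le.2 ?_
    rintro _ ⟨α, hα, rfl⟩
    obtain ⟨h1, h2⟩ := mem_MC_iff.1 (V_mem_MC hα)
    exact ⟨_, h2, rfl⟩
  intro X hX
  obtain ⟨Y, hY, rfl⟩ := h hX
  exact mem_MC_iff.2 ⟨Y.2, hY⟩

lemma lieEnd_harmonicSub (ε : ℤˣ) (a : Fin 3) {X : smoothVF} (hX : X ∈ harmonicSub) :
    lieEnd (basisMat ε a) X ∈ harmonicSub := by
  -- The fields whose Lie derivative stays in the span form a subspace, so it suffices to check the
  -- generators.
  have h : harmonicSpan ≤ (harmonicSub.comap (lieEnd (basisMat ε a))).map smoothVF.subtype := by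
    refine Submodule.span_le.2 ?_
    rintro _ ⟨α, hα, rfl⟩
    refine ⟨normFactor α • harmVF α.j α.ε α.k α.l, ?_, (V_eq α).symm⟩
    exact Submodule.smul_mem _ _ (lieEnd_harmVF hα _ _ _ _ _)
  obtain ⟨Y, hY, hXY⟩ := h hX
  rw [← Subtype.ext hXY]
  exact hY

lemma bracket_harmonicSpan {X Y : VF ℂ} (hX : X ∈ harmonicSpan) (hY : Y ∈ KC) :
    bracket X Y ∈ harmonicSpan := by
  obtain ⟨hs, hX1, -⟩ := mem_MC_iff.1 (harmonicSpan_subset_MC hX)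
  obtain ⟨c, rfl⟩ := mem_KC_iff.1 hY
  have h := bracket_comb c (X := ⟨X, hs⟩) hX1.1
  change bracket X (comb c) = _ at h
  rw [h]
  refine harmonicSub.neg_mem (harmonicSub.sum_mem fun ε _ => harmonicSub.sum_mem fun a _ =>
    harmonicSub.smul_mem _ ?_)
  exact lieEnd_harmonicSub ε a hX

/-! ### Integrals of the volume form, and brackets, on `so(4)` -/

section VolForm

variable {𝕜 : Type} [RCLike 𝕜]

lemma volForm_sum_right {ι : Type*} (s : Finset ι) (p : S3) (u v : Fin 4 → 𝕜) (r : ι → 𝕜)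
    (w : ι → Fin 4 → 𝕜) :
    volForm p u v (fun i => ∑ a ∈ s, r a * w a i) = ∑ a ∈ s, r a * volForm p u v (w a) := by
  classical
  induction s using Finset.induction_on with
  | empty => simp [volForm_eq]
  | insert a s ha ih =>
    simp only [Finset.sum_insert ha]
    rw [← ih]
    simp only [volForm_eq]
    ring

lemma volForm_comb_right (p : S3) (u v : Fin 4 → 𝕜) (c : ℤˣ → Fin 3 → 𝕜) :
    volForm p u v (comb c p) = ∑ ε, ∑ a, c ε a * volForm p u v (frame 𝕜 ε a p) := by
  have h1 : comb c p = fun i => ∑ q : ℤˣ × Fin 3, c q.1 q.2 * frame 𝕜 q.1 q.2 p i := by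
    funext i
    rw [comb_apply, Fintype.sum_prod_type]
  rw [h1, volForm_sum_right Finset.univ p u v (fun q : ℤˣ × Fin 3 => c q.1 q.2)
    (fun q => frame 𝕜 q.1 q.2 p), Fintype.sum_prod_type]

lemma volForm_comb_comb (p : S3) (u : Fin 4 → 𝕜) (b c : ℤˣ → Fin 3 → 𝕜) :
    volForm p u (comb b p) (comb c p) = ∑ ε, ∑ a, ∑ δ, ∑ a', b δ a' * c ε a
      * volForm p u (frame 𝕜 δ a' p) (frame 𝕜 ε a p) := by
  rw [volForm_comb_right]
  refine Finset.sum_congr rfl fun ε _ => Finset.sum_congr rfl fun a _ => ?_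
  rw [volForm_swap, volForm_comb_right, ← Finset.sum_neg_distrib, Finset.mul_sum]
  refine Finset.sum_congr rfl fun δ _ => ?_
  rw [← Finset.sum_neg_distrib, Finset.mul_sum]
  refine Finset.sum_congr rfl fun a' _ => ?_
  rw [volForm_swap p u (frame 𝕜 ε a p)]
  ring

lemma RadSmooth.volForm {X Y Z : VF 𝕜} (hX : RadSmooth X) (hY : RadSmooth Y) (hZ : RadSmooth Z) :
    RadSmooth (fun p => NCS.volForm p (X p) (Y p) (Z p)) := by
  have hc : ∀ i, RadSmooth (fun p : S3 => ((p.1 i : ℝ) : 𝕜)) := fun i =>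
    (RadSmooth.coord i).clm (RCLike.ofRealCLM (K := 𝕜))
  have hX := fun i => hX.apply i
  have hY := fun i => hY.apply i
  have hZ := fun i => hZ.apply i
  have h2 : ∀ i k, RadSmooth (fun p => Y p i * Z p k - Y p k * Z p i) := fun i k =>
    ((hY i).mul (hZ k)).sub ((hY k).mul (hZ i))
  have h3 : ∀ i k l, RadSmooth (fun p => X p i * (Y p k * Z p l - Y p l * Z p k)
      - X p k * (Y p i * Z p l - Y p l * Z p i) + X p l * (Y p i * Z p k - Y p k * Z p i)) :=
    fun i k l => (((hX i).mul (h2 k l)).sub ((hX k).mul (h2 i l))).add ((hX l).mul (h2 i k))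
  have := (((hc 0).mul (h3 1 2 3)).sub ((hc 1).mul (h3 0 2 3))).add ((hc 2).mul (h3 0 1 3)) |>.sub
    ((hc 3).mul (h3 0 1 2))
  have e : (fun p => NCS.volForm p (X p) (Y p) (Z p)) = _ := funext fun p => volForm_eq p _ _ _
  rw [e]
  exact this

/-- Within a sector the cross product is a basis field, giving pairings of X with so(4); across
sectors it is a gradient up to a normal part, giving zero. Both the decoupling of the two
Chern-Simons terms and the consistency of the truncation come from here. -/
lemma integral_volForm_frame {X : VF 𝕜} (hX : RadSmooth X) (hT : IsTangent X)
    (hd : ∀ p, div X p = 0) (ε δ : ℤˣ) (a b : Fin 3) :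
    ∫ p, volForm p (X p) (frame 𝕜 ε a p) (frame 𝕜 δ b p) ∂S3vol
      = if ε = δ then -((ε : ℤ) : 𝕜) * ∑ c, (levi a b c : 𝕜) * ip (frame 𝕜 ε c) X else 0 := by
  split_ifs with h
  · subst h
    simp only [volForm_cycle _ (X _), volForm_frame_frame]
    rw [integral_const_mul, integral_finsetSum _ fun c _ =>
      (radSmooth_dot (radSmooth_frame ε c) hX).integrable.const_mul _]
    simp only [integral_const_mul]
    rfl
  · rcases Int.units_eq_one_or ε with rfl | rfl <;> rcases Int.units_eq_one_or δ with rfl | rfl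
    · exact absurd rfl h
    · exact integral_volForm_left_right a b hX hT hd
    · simp only [volForm_swap _ (X _) (frame 𝕜 (-1) a _)]
      rw [integral_neg, integral_volForm_left_right b a hX hT hd, neg_zero]
    · exact absurd rfl h

lemma integral_volForm_comb {X : VF 𝕜} (hX : RadSmooth X) (hT : IsTangent X)
    (hd : ∀ p, div X p = 0) (b c : ℤˣ → Fin 3 → 𝕜) :
    ∫ p, volForm p (X p) (comb b p) (comb c p) ∂S3vol
      = ∑ ε : ℤˣ, -((ε : ℤ) : 𝕜) * ∑ a, ∑ a', ∑ d, (levi a a' d : 𝕜) * b ε a * c ε a'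
        * ip (frame 𝕜 ε d) X := by
  simp only [volForm_comb_comb]
  have hi : ∀ ε a δ a', Integrable (fun p => b δ a' * c ε a
      * volForm p (X p) (frame 𝕜 δ a' p) (frame 𝕜 ε a p)) S3vol := fun ε a δ a' =>
    (RadSmooth.volForm hX (radSmooth_frame δ a') (radSmooth_frame ε a)).integrable.const_mul _
  rw [integral_finsetSum _ fun ε _ => integrable_finsetSum _ fun a _ => integrable_finsetSum _
    fun δ _ => integrable_finsetSum _ fun a' _ => hi ε a δ a']
  refine Finset.sum_congr rfl fun ε _ => ?_
  rw [integral_finsetSum _ fun a _ => integrable_finsetSum _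
    fun δ _ => integrable_finsetSum _ fun a' _ => hi ε a δ a', Finset.sum_comm (s := Finset.univ)
    (t := Finset.univ) (f := fun a a' => ∑ d, (levi a a' d : 𝕜) * b ε a * c ε a'
        * ip (frame 𝕜 ε d) X), Finset.mul_sum]
  refine Finset.sum_congr rfl fun a _ => ?_
  rw [integral_finsetSum _ fun δ _ => integrable_finsetSum _ fun a' _ => hi ε a δ a']
  rw [Finset.sum_eq_single ε ?_ fun h => absurd (Finset.mem_univ ε) h]
  · rw [integral_finsetSum _ fun a' _ => hi ε a ε a', Finset.mul_sum]
    refine Finset.sum_congr rfl fun a' _ => ?_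
    rw [integral_const_mul, integral_volForm_frame hX hT hd, if_pos rfl]
    simp only [Finset.mul_sum]
    refine Finset.sum_congr rfl fun d _ => ?_
    ring
  · intro δ _ hδ
    rw [integral_finsetSum _ fun a' _ => hi ε a δ a']
    refine Finset.sum_eq_zero fun a' _ => ?_
    rw [integral_const_mul, integral_volForm_frame hX hT hd, if_neg hδ, mul_zero]

end VolForm

lemma so4Mat_eq (c : ℤˣ → Fin 3 → ℝ) : so4Mat c =
    !![0, c 1 0 - c (-1) 0, c 1 1 - c (-1) 1, c 1 2 - c (-1) 2;
      c (-1) 0 - c 1 0, 0, -c (-1) 2 - c 1 2, c (-1) 1 + c 1 1;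
      c (-1) 1 - c 1 1, c (-1) 2 + c 1 2, 0, -c (-1) 0 - c 1 0;
      c (-1) 2 - c 1 2, -c (-1) 1 - c 1 1, c (-1) 0 + c 1 0, 0] := by
  ext i k
  rw [so4Mat, sum_units]
  fin_cases i <;> fin_cases k <;> simp [leftMat, rightMat, Fin.sum_univ_three] <;> ring

/-- In components: the two su(2) factors commute with each other and have structure constants -2
ε_{abc}. -/
lemma so4Mat_comm (c d : ℤˣ → Fin 3 → ℝ) : so4Mat d * so4Mat c - so4Mat c * so4Mat d
    = so4Mat fun ε e => -2 * ∑ a, ∑ b, levi a b e * c ε a * d ε b := by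
  simp only [so4Mat_eq, levi_eq, Fin.sum_univ_three]
  generalize c 1 = x, c (-1) = y, d 1 = z, d (-1) = w
  rw [← Matrix.ext_iff]
  simp only [Fin.forall_fin_succ, Matrix.sub_apply, Matrix.mul_apply, Fin.sum_univ_four]
  simp
  refine ⟨⟨?_, ?_, ?_, ?_⟩, ⟨?_, ?_, ?_, ?_⟩, ⟨?_, ?_, ?_, ?_⟩, ?_, ?_, ?_, ?_⟩ <;> ring

lemma bracket_so4Field (c d : ℤˣ → Fin 3 → ℝ) : bracket (so4Field c) (so4Field d)
    = so4Field fun ε e => -2 * ∑ a, ∑ b, levi a b e * c ε a * d ε b := by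
  rw [so4Field_eq_linField, so4Field_eq_linField, so4Field_eq_linField, ← lin_real, ← lin_real,
    ← lin_real, bracket_lin _ (isTangent_lin (so4Mat_transpose d)),
    lieD_lin (so4Mat_transpose c), so4Mat_comm]

/-! ### The Lagrangian on `so(4)`-valued fields -/

lemma topForm_eq {R : Type} [AddCommGroup R] (T : Fin 3 → Fin 3 → Fin 3 → R) :
    topForm T = T 0 1 2 + T 1 2 0 + T 2 0 1 - T 1 0 2 - T 0 2 1 - T 2 1 0 := by
  have h : (Finset.univ : Finset (Equiv.Perm (Fin 3))) = {1, Equiv.swap 0 1, Equiv.swap 0 2,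
      Equiv.swap 1 2, Equiv.swap 0 1 * Equiv.swap 1 2, Equiv.swap 1 2 * Equiv.swap 0 1} := by
    decide
  rw [topForm, h, Finset.sum_insert (by decide), Finset.sum_insert (by decide),
    Finset.sum_insert (by decide), Finset.sum_insert (by decide), Finset.sum_insert (by decide),
    Finset.sum_singleton]
  have e1 : Equiv.Perm.sign (Equiv.swap (0 : Fin 3) 1) = -1 := by decide
  have e2 : Equiv.Perm.sign (Equiv.swap (0 : Fin 3) 2) = -1 := by decide
  have e3 : Equiv.Perm.sign (Equiv.swap (1 : Fin 3) 2) = -1 := by decide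
  simp only [map_mul, e1, e2, e3, map_one]
  have f1 : ∀ i : Fin 3, Equiv.swap (0 : Fin 3) 1 i = ![1, 0, 2] i := by decide
  have f2 : ∀ i : Fin 3, Equiv.swap (0 : Fin 3) 2 i = ![2, 1, 0] i := by decide
  have f3 : ∀ i : Fin 3, Equiv.swap (1 : Fin 3) 2 i = ![0, 2, 1] i := by decide
  simp only [Equiv.Perm.coe_mul, Function.comp, f1, f2, f3]
  simp
  abel

lemma topForm_cycle {R : Type} [AddCommGroup R] (T : Fin 3 → Fin 3 → Fin 3 → R) :
    topForm (fun μ ν ρ => T ν ρ μ) = topForm T := by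
  rw [topForm_eq, topForm_eq]
  abel

lemma integral_topForm {α : Type} [MeasurableSpace α] {m : Measure α}
    {T : α → Fin 3 → Fin 3 → Fin 3 → ℝ} (hT : ∀ μ ν ρ, Integrable (fun p => T p μ ν ρ) m) :
    ∫ p, topForm (T p) ∂m = topForm fun μ ν ρ => ∫ p, T p μ ν ρ ∂m := by
  simp only [topForm, zsmul_eq_mul]
  rw [integral_finsetSum _ fun σ _ => (hT _ _ _).const_mul _]
  refine Finset.sum_congr rfl fun σ _ => ?_
  rw [integral_const_mul]

lemma pd_so4Field {c : X3 → ℤˣ → Fin 3 → ℝ} {x : X3}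
    (hc : ∀ ε a, DifferentiableAt ℝ (fun y => c y ε a) x) (μ : Fin 3) (p : S3) (i : Fin 4) :
    pd μ (fun y => so4Field (c y) p i) x
      = so4Field (fun ε a => pd μ (fun y => c y ε a) x) p i := by
  simp only [so4Field_apply, pd]
  rw [fderiv_fun_sum fun ε _ => DifferentiableAt.fun_sum fun a _ => (hc ε a).mul_const _]
  rw [_root_.sum_apply]
  refine Finset.sum_congr rfl fun ε _ => ?_
  rw [fderiv_fun_sum fun a _ => (hc ε a).mul_const _, _root_.sum_apply]
  refine Finset.sum_congr rfl fun a _ => ?_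
  rw [fderiv_mul_const (hc ε a)]
  simp [mul_comm]

/-- The Chern-Simons form of an `su(2)` connection with components `a` and derivatives `D`. -/
noncomputable def csForm (D : Fin 3 → Fin 3 → Fin 3 → ℝ) (a : Fin 3 → Fin 3 → ℝ) : ℝ :=
  topForm fun μ ν ρ => ∑ e, D μ ν e * a ρ e
    - 2 / 3 * ∑ b, ∑ c, ∑ e, levi b c e * a μ b * a ν c * a ρ e

/-- Pairing the curl with a basis field multiplies the pairing of P itself by -2ε, so the components
of P along so(4) are fixed by its curl. Hence the kinetic term does not depend on the choice of
potential. -/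
lemma ip_comb_of_curl {P : VF ℝ} (hP : RadSmooth P) {A c : ℤˣ → Fin 3 → ℝ}
    (h : curl P = so4Field A) :
    ip (comb c) P = ∑ ε : ℤˣ, -Real.pi ^ 2 * (ε : ℤ) * ∑ a, c ε a * A ε a := by
  have h1 : ∀ ε a, ip (frame ℝ ε a) P = -Real.pi ^ 2 * (ε : ℤ) * A ε a := by
    intro ε a
    have h2 := ip_frame_curl ε a hP
    rw [h, so4Field_eq_comb, ip_frame_comb] at h2
    simp only [RCLike.ofReal_real_eq_id, id] at h2
    rcases Int.units_eq_one_or ε with rfl | rfl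
    · simp at h2 ⊢; linarith
    · simp at h2 ⊢; linarith
  rw [comb, ip_sum_left (fun δ _ => RadSmooth.sum_vf fun b _ =>
    (radSmooth_frame δ b).smul_vf _) hP]
  refine Finset.sum_congr rfl fun ε _ => ?_
  rw [ip_sum_left (fun b _ => (radSmooth_frame ε b).smul_vf _) hP, Finset.mul_sum]
  refine Finset.sum_congr rfl fun a _ => ?_
  rw [ip_smul_left, h1]
  ring

lemma integral_volForm_so4Field (A B C : ℤˣ → Fin 3 → ℝ) :
    ∫ p, volForm p (so4Field A p) (so4Field B p) (so4Field C p) ∂S3vol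
      = ∑ ε : ℤˣ, -2 * Real.pi ^ 2 * (ε : ℤ) * ∑ a, ∑ b, ∑ c, levi a b c * A ε a * B ε b * C ε c := by
  have hA := so4_subset_sdiffS3 (mem_so4_iff.2 ⟨A, rfl⟩)
  rw [so4Field_eq_comb] at hA
  rw [so4Field_eq_comb, so4Field_eq_comb, so4Field_eq_comb,
    integral_volForm_comb (radSmooth_comb A) hA.2.1 hA.2.2]
  refine Finset.sum_congr rfl fun ε _ => ?_
  simp only [ip_frame_comb, levi_eq, Fin.sum_univ_three]
  simp
  ring

/-- The kinetic term is evaluated by `ip_comb_of_curl`. The cubic term carries -1/3 times -2π²ε,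
which is the coefficient -2/3 of the Chern-Simons form after extracting -π²ε. -/
lemma ncsLagrangian_so4 {A : SO4Connection} {P : GaugeField} {x : X3}
    (hA : ∀ ε μ a, DifferentiableAt ℝ (fun y => A y ε μ a) x)
    (hP : ∀ μ, IsSmooth (P x μ) ∧ curl (P x μ) = so4GaugeField A x μ) :
    ncsLagrangian (so4GaugeField A) P x = ∑ ε : ℤˣ, -Real.pi ^ 2 * (ε : ℤ)
      * csForm (fun μ ν a => pd μ (fun y => A y ε ν a) x) (A x ε) := by
  have h1 : ∀ μ ν p i, pd μ (fun y => so4GaugeField A y ν p i) x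
      = so4Field (fun ε a => pd μ (fun y => A y ε ν a) x) p i := fun μ ν p i =>
    pd_so4Field (fun ε a => hA ε ν a) μ p i
  have hs : ∀ c, RadSmooth (so4Field c) := fun c => by
    rw [so4Field_eq_comb]; exact radSmooth_comb c
  have hPs : ∀ μ, RadSmooth (P x μ) := fun μ => isSmooth_iff.1 (hP μ).1
  have hi1 : ∀ μ ν ρ, Integrable (fun p => ∑ i, so4Field (fun ε a => pd μ (fun y => A y ε ν a) x) p i
      * P x ρ p i) S3vol := fun μ ν ρ => (radSmooth_dot (hs _) (hPs ρ)).integrable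
  have hi2 : ∀ μ ν ρ, Integrable (fun p => 1 / 3 * volForm p (so4GaugeField A x μ p)
      (so4GaugeField A x ν p) (so4GaugeField A x ρ p)) S3vol := fun μ ν ρ =>
    (RadSmooth.volForm (hs _) (hs _) (hs _)).integrable.const_mul _
  rw [ncsLagrangian]
  simp only [h1]
  rw [integral_topForm (T := fun p μ ν ρ => ∑ i, so4Field (fun ε a => pd μ (fun y => A y ε ν a) x) p i
      * P x ρ p i - 1 / 3 * volForm p (so4GaugeField A x μ p)
      (so4GaugeField A x ν p) (so4GaugeField A x ρ p)) fun μ ν ρ => (hi1 μ ν ρ).sub (hi2 μ ν ρ)]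
  have h2 : ∀ μ ν ρ, ∫ p, (∑ i, so4Field (fun ε a => pd μ (fun y => A y ε ν a) x) p i * P x ρ p i
      - 1 / 3 * volForm p (so4GaugeField A x μ p) (so4GaugeField A x ν p) (so4GaugeField A x ρ p))
        ∂S3vol = ∑ ε : ℤˣ, -Real.pi ^ 2 * (ε : ℤ) * (∑ e, pd μ (fun y => A y ε ν e) x * A x ε ρ e
          - 2 / 3 * ∑ b, ∑ c, ∑ e, levi b c e * A x ε μ b * A x ε ν c * A x ε ρ e) := by
    intro μ ν ρ
    rw [integral_sub (hi1 μ ν ρ) (hi2 μ ν ρ), integral_const_mul]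
    have h3 := ip_comb_of_curl (hPs ρ) (c := fun ε a => pd μ (fun y => A y ε ν a) x) (hP ρ).2
    rw [← so4Field_eq_comb, ip] at h3
    rw [h3]
    simp only [so4GaugeField]
    rw [integral_volForm_so4Field, Finset.mul_sum, ← Finset.sum_sub_distrib]
    refine Finset.sum_congr rfl fun ε _ => ?_
    ring
  simp only [h2, csForm, topForm, Finset.smul_sum, Finset.mul_sum (s := (Finset.univ :
    Finset (Equiv.Perm (Fin 3))))]
  rw [Finset.sum_comm]
  refine Finset.sum_congr rfl fun ε _ => Finset.sum_congr rfl fun σ _ => ?_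
  rw [mul_smul_comm]

/-! ### Comparison with Chern-Simons theory, and potentials -/

lemma SO4Connection.differentiableAt {U : Set X3} (hU : IsOpen U) {A : SO4Connection}
    (hA : ContDiffOn ℝ ∞ A U) {x : X3} (hx : x ∈ U) (ε : ℤˣ) (μ a : Fin 3) :
    DifferentiableAt ℝ (fun y => A y ε μ a) x := by
  have h := (hA.contDiffAt (hU.mem_nhds hx)).differentiableAt (by simp)
  exact differentiableAt_pi.1 (differentiableAt_pi.1 (differentiableAt_pi.1 h ε) μ) a

lemma SO4Connection.contDiffOn {U : Set X3} {A : SO4Connection}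
    (hA : ContDiffOn ℝ ∞ A U) (ε : ℤˣ) (μ a : Fin 3) :
    ContDiffOn ℝ ∞ (fun y => A y ε μ a) U :=
  contDiffOn_pi.1 (contDiffOn_pi.1 (contDiffOn_pi.1 hA ε) μ) a

/-- The traces of products of Pauli matrices are tr σ_a σ_b = 2 δ_{ab} and, antisymmetrised, tr σ_a
σ_b σ_c = 2i ε_{abc}. -/
lemma csLagrangian_eq (A : SO4Connection) (ε : ℤˣ) (x : X3) : csLagrangian A ε x
    = ((2 * csForm (fun μ ν a => pd μ (fun y => A y ε ν a) x) (A x ε) : ℝ) : ℂ) := by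
  have h : ∀ μ ν ρ, Matrix.trace (pauli (A x ε μ) * pauli (fun a => pd ν (fun y => A y ε ρ a) x)
      + (2 / 3 * Complex.I) • (pauli (A x ε μ) * pauli (A x ε ν) * pauli (A x ε ρ)))
      = ((2 * (∑ e, pd ν (fun y => A y ε ρ e) x * A x ε μ e
        - 2 / 3 * ∑ b, ∑ c, ∑ e, levi b c e * A x ε ν b * A x ε ρ c * A x ε μ e) : ℝ) : ℂ) := by
    intro μ ν ρ
    generalize A x ε μ = u, A x ε ν = v, A x ε ρ = w
    simp only [Matrix.trace_fin_two, pauli, levi_eq, Fin.sum_univ_three, Matrix.add_apply,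
      Matrix.smul_apply, Matrix.mul_apply, Fin.sum_univ_two, smul_eq_mul]
    simp
    ring_nf
    simp only [Complex.I_sq]
    ring
  rw [csLagrangian]
  simp only [h]
  -- The matrix form is A ∧ dA while `csForm` is written as dA ∧ A; a cyclic relabelling of the
  -- three indices costs no sign.
  rw [topForm_cycle (fun μ ν ρ => ((2 * (∑ e, pd μ (fun y => A y ε ν e) x * A x ε ρ e
        - 2 / 3 * ∑ b, ∑ c, ∑ e, levi b c e * A x ε μ b * A x ε ν c * A x ε ρ e) : ℝ) : ℂ)), csForm,
    topForm_eq, topForm_eq]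
  push_cast
  ring

lemma ncsLagrangian_eq_so4CSLagrangian {U : Set X3} (hU : IsOpen U) {A : SO4Connection}
    {P : GaugeField} (hA : ContDiffOn ℝ ∞ A U) (hP : IsPotential U (so4GaugeField A) P) {x : X3}
    (hx : x ∈ U) : ((2 / Real.pi ^ 2 * ncsLagrangian (so4GaugeField A) P x : ℝ) : ℂ)
      = so4CSLagrangian A x := by
  rw [ncsLagrangian_so4 (SO4Connection.differentiableAt hU hA hx)
    fun μ => ⟨(hP x hx μ).1, (hP x hx μ).2.2⟩, so4CSLagrangian, csLagrangian_eq, csLagrangian_eq,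
    ← Complex.ofReal_sub, sum_units]
  congr 1
  have := Real.pi_ne_zero
  simp
  field_simp
  ring

lemma ncsAction_eq_so4CSAction {U : Set X3} (hU : IsOpen U) {A : SO4Connection}
    {P : GaugeField} (hA : ContDiffOn ℝ ∞ A U) (hP : IsPotential U (so4GaugeField A) P) :
    ((2 / Real.pi ^ 2 * ncsAction U (so4GaugeField A) P : ℝ) : ℂ) = so4CSAction U A := by
  rw [ncsAction, so4CSAction, ← integral_const_mul, ← integral_complex_ofReal]
  exact setIntegral_congr_fun hU.measurableSet fun x hx =>
    ncsLagrangian_eq_so4CSLagrangian hU hA hP hx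

lemma exists_isPotential (U : Set X3) (A : SO4Connection) :
    ∃ P : GaugeField, IsPotential U (so4GaugeField A) P := by
  -- The basis fields have curl eigenvalue -2ε, and -ε/2 is its inverse because ε² = 1.
  refine ⟨so4GaugeField fun x ε μ a => -((ε : ℤ) : ℝ) / 2 * A x ε μ a, fun x _ μ => ?_⟩
  have h := so4_subset_sdiffS3 (mem_so4_iff.2
    ⟨fun ε a => -((ε : ℤ) : ℝ) / 2 * A x ε μ a, rfl⟩)
  refine ⟨h.1, h.2.1, ?_⟩
  simp only [so4GaugeField, so4Field_eq_comb]
  have hc : ∀ c : ℤˣ → Fin 3 → ℝ, curl (comb c) = ∑ ε, ∑ a, c ε a • curl (frame ℝ ε a) := by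
    intro c
    have ht : ∀ k p, tderiv k (comb c) p = fun i => ∑ q : ℤˣ × Fin 3,
        c q.1 q.2 * tderiv k (frame ℝ q.1 q.2) p i := by
      intro k p
      funext i
      have e : comb c = lin ℝ (so4Mat c) := by
        rw [← so4Field_eq_comb, so4Field_eq_linField, lin_real]
      simp only [e, frame, tderiv_lin, Fintype.sum_prod_type, lin, linField_apply, so4Mat]
      simp only [Matrix.sum_apply, Matrix.smul_apply, smul_eq_mul, RCLike.ofReal_real_eq_id, id,
        mul_sub, Finset.sum_sub_distrib, Finset.sum_mul, Finset.mul_sum]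
      congr 1
      rw [Finset.sum_comm]
      refine Finset.sum_congr rfl fun ε _ => ?_
      rw [Finset.sum_comm]
      refine Finset.sum_congr rfl fun a _ => Finset.sum_congr rfl fun l _ => ?_
      ring
    funext p i
    simp only [curl, ht, volForm_sum_right, Finset.sum_apply, Pi.smul_apply, smul_eq_mul,
      Finset.mul_sum]
    rw [Finset.sum_comm, Fintype.sum_prod_type]
  rw [hc, comb]
  refine Finset.sum_congr rfl fun ε _ => Finset.sum_congr rfl fun a _ => ?_
  rw [curl_frame, smul_smul]
  congr 1
  rcases Int.units_eq_one_or ε with rfl | rfl <;> simp <;> ring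

/-! ### Gauge transformations -/

lemma gaugeVar_so4 {A : SO4Connection} {ξ : X3 → ℤˣ → Fin 3 → ℝ} {x : X3}
    (hξ : DifferentiableAt ℝ ξ x) :
    gaugeVar (fun y => so4Field (ξ y)) (so4GaugeField A) x
      = so4GaugeField (so4GaugeVar ξ A) x := by
  have hd : ∀ ε a, DifferentiableAt ℝ (fun y => ξ y ε a) x := fun ε a =>
    differentiableAt_pi.1 (differentiableAt_pi.1 hξ ε) a
  funext μ p i
  simp only [gaugeVar, so4GaugeField]
  rw [pd_so4Field hd, bracket_so4Field]
  simp only [so4Field_apply, so4GaugeVar, ← Finset.sum_sub_distrib]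
  refine Finset.sum_congr rfl fun ε _ => Finset.sum_congr rfl fun a _ => ?_
  ring

lemma hasDerivAt_csForm (D D' : Fin 3 → Fin 3 → Fin 3 → ℝ) (a a' : Fin 3 → Fin 3 → ℝ) :
    HasDerivAt (fun t : ℝ => csForm (fun μ ν e => D μ ν e + t * D' μ ν e)
        (fun μ e => a μ e + t * a' μ e))
      (topForm fun μ ν ρ => ∑ e, (D' μ ν e * a ρ e + D μ ν e * a' ρ e)
        - 2 / 3 * ∑ b, ∑ c, ∑ e, levi b c e * (a' μ b * a ν c * a ρ e + a μ b * a' ν c * a ρ e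
          + a μ b * a ν c * a' ρ e)) 0 := by
  have hl : ∀ x y : ℝ, HasDerivAt (fun t : ℝ => x + t * y) y 0 := fun x y => by
    simpa using ((hasDerivAt_id (0 : ℝ)).mul_const y).const_add x
  simp only [csForm, topForm, zsmul_eq_mul]
  refine HasDerivAt.fun_sum fun σ _ => HasDerivAt.const_mul _ (HasDerivAt.sub ?_ ?_)
  · refine HasDerivAt.fun_sum fun e _ => ?_
    exact ((hl (D (σ 0) (σ 1) e) (D' (σ 0) (σ 1) e)).mul (hl (a (σ 2) e) (a' (σ 2) e))).congr_deriv
      (by simp)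
  · refine HasDerivAt.const_mul _ (HasDerivAt.fun_sum fun b _ => HasDerivAt.fun_sum fun c _ =>
      HasDerivAt.fun_sum fun e _ => ?_)
    have := (((hl (a (σ 0) b) (a' (σ 0) b)).const_mul (levi b c e)).mul
      (hl (a (σ 1) c) (a' (σ 1) c))).mul (hl (a (σ 2) e) (a' (σ 2) e))
    refine this.congr_deriv ?_
    simp
    ring

/-- Second derivatives of ξ drop out by antisymmetrisation. The terms in ξ, D and a cancel by
invariance of the scalar product, those in dξ, a and a because three times 2/3 is 2, and those cubic
in a by invariance of the structure constants. Only dA ∧ dξ is left. -/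
lemma csForm_gaugeVar (D H : Fin 3 → Fin 3 → Fin 3 → ℝ) (a dξ : Fin 3 → Fin 3 → ℝ)
    (ξ : Fin 3 → ℝ) (hH : ∀ μ ν, H μ ν = H ν μ) :
    (topForm fun μ ν ρ => ∑ e, ((H μ ν e + 2 * ∑ b, ∑ c, levi b c e * (dξ μ b * a ν c
          + ξ b * D μ ν c)) * a ρ e + D μ ν e * (dξ ρ e + 2 * ∑ b, ∑ c, levi b c e * ξ b * a ρ c))
        - 2 / 3 * ∑ b, ∑ c, ∑ e, levi b c e *
          ((dξ μ b + 2 * ∑ k, ∑ l, levi k l b * ξ k * a μ l) * a ν c * a ρ e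
          + a μ b * (dξ ν c + 2 * ∑ k, ∑ l, levi k l c * ξ k * a ν l) * a ρ e
          + a μ b * a ν c * (dξ ρ e + 2 * ∑ k, ∑ l, levi k l e * ξ k * a ρ l)))
      = topForm fun μ ν ρ => ∑ e, D μ ν e * dξ ρ e := by
  simp only [topForm_eq, levi_eq, Fin.sum_univ_three, hH 1 0, hH 2 0, hH 2 1]
  simp
  ring

lemma pd_comm {f : X3 → ℝ} (hf : ContDiff ℝ ∞ f) (μ ν : Fin 3) (x : X3) :
    pd μ (fun y => pd ν f y) x = pd ν (fun y => pd μ f y) x := by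
  have h : ∀ μ ν, pd μ (fun y => pd ν f y) x
      = fderiv ℝ (fderiv ℝ f) x (Pi.single μ 1) (Pi.single ν 1) := by
    intro μ ν
    simp only [pd]
    have hd : DifferentiableAt ℝ (fderiv ℝ f) x :=
      ((hf.fderiv_right (m := ∞) (by simp)).differentiable (by simp)) x
    rw [fderiv_clm_apply hd (differentiableAt_const _)]
    simp
  rw [h, h]
  exact (hf.contDiffAt.isSymmSndFDerivAt (by simp; exact WithTop.coe_le_coe.2 le_top)) _ _

lemma contDiff_pd {f : X3 → ℝ} (hf : ContDiff ℝ ∞ f) (μ : Fin 3) :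
    ContDiff ℝ ∞ (fun y => pd μ f y) :=
  (hf.fderiv_right (m := ∞) (by simp)).clm_apply contDiff_const

lemma contDiffOn_pd {U : Set X3} (hU : IsOpen U) {f : X3 → ℝ} (hf : ContDiffOn ℝ ∞ f U)
    (μ : Fin 3) : ContDiffOn ℝ ∞ (fun y => pd μ f y) U :=
  (hf.fderiv_of_isOpen hU (m := ∞) (by simp)).clm_apply contDiffOn_const

/-! ### Integration by parts against compactly supported functions -/

section ByParts

variable {U : Set X3} {f ζ : X3 → ℝ}

/-- Outside U nothing is known about f, but there ζ vanishes; on the compact support of ζ the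
product is continuous. -/
lemma integrable_mul_of_tsupport (hf : ContinuousOn f U) (hζ : Continuous ζ)
    (hc : HasCompactSupport ζ) (hs : tsupport ζ ⊆ U) : Integrable (fun x => f x * ζ x) := by
  have h1 : IntegrableOn (fun x => f x * ζ x) (tsupport ζ) :=
    ((hf.mono hs).mul hζ.continuousOn).integrableOn_compact hc
  refine (integrableOn_iff_integrable_of_support_subset ?_).1 h1
  intro x hx
  refine subset_tsupport ζ ?_
  rw [Function.mem_support] at *
  exact right_ne_zero_of_mul hx

lemma tsupport_pd (μ : Fin 3) : tsupport (fun y => pd μ ζ y) ⊆ tsupport ζ :=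
  tsupport_fderiv_apply_subset ℝ _

/-- Both integrands are supported in the compact support of ζ, which lies in U, so the integral over
U is one over the whole space and there is no boundary term. -/
lemma integral_pd_mul (hU : IsOpen U) (hf : ContDiffOn ℝ ∞ f U) (hζ : ContDiff ℝ ∞ ζ)
    (hc : HasCompactSupport ζ) (hs : tsupport ζ ⊆ U) (μ : Fin 3) :
    ∫ x in U, pd μ f x * ζ x = - ∫ x, f x * pd μ ζ x := by
  have h0 : ∫ x in U, pd μ f x * ζ x = ∫ x, pd μ f x * ζ x := by
    refine setIntegral_eq_integral_of_forall_compl_eq_zero fun x hx => ?_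
    rw [image_eq_zero_of_notMem_tsupport fun h => hx (hs h), mul_zero]
  have hd := (contDiff_pd hζ μ).continuous
  have h1 := integrable_mul_of_tsupport (contDiffOn_pd hU hf μ).continuousOn hζ.continuous hc hs
  have h2 := integrable_mul_of_tsupport hf.continuousOn hd
    (hc.of_isClosed_subset (isClosed_tsupport _) (tsupport_pd μ)) ((tsupport_pd μ).trans hs)
  have h3 := integrable_mul_of_tsupport hf.continuousOn hζ.continuous hc hs
  have h4 := integral_mul_fderiv_eq_neg_fderiv_mul_of_integrable (μ := volume) (f := ζ) (g := f)
    (v := Pi.single μ 1) (by simpa only [mul_comm, pd] using h2)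
    (by simpa only [mul_comm, pd] using h1)
    (by simpa only [mul_comm] using h3) (fun x _ => (hζ.differentiable (by simp)) x)
    (fun x hx => (hf.contDiffAt (hU.mem_nhds (hs hx))).differentiableAt (by simp))
  rw [h0]
  simpa only [mul_comm, pd] using h4

end ByParts

lemma contDiff_so4GaugeVar {U : Set X3} {A : SO4Connection} {ξ : X3 → ℤˣ → Fin 3 → ℝ}
    (hA : ContDiffOn ℝ ∞ A U) (hξ : ContDiff ℝ ∞ ξ) :
    ContDiffOn ℝ ∞ (so4GaugeVar ξ A) U := by
  have hξ' : ∀ ε a, ContDiff ℝ ∞ (fun y => ξ y ε a) := fun ε a =>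
    contDiff_pi.1 (contDiff_pi.1 hξ ε) a
  refine contDiffOn_pi.2 fun ε => contDiffOn_pi.2 fun μ => contDiffOn_pi.2 fun c => ?_
  refine (contDiff_pd (hξ' ε c) μ).contDiffOn.add (contDiffOn_const.mul ?_)
  exact ContDiffOn.sum fun a _ => ContDiffOn.sum fun b _ =>
    (contDiffOn_const.mul (hξ' ε a).contDiffOn).mul (SO4Connection.contDiffOn hA ε μ b)

lemma pd_so4GaugeVar {A : SO4Connection} {ξ : X3 → ℤˣ → Fin 3 → ℝ} {x : X3} {ε : ℤˣ} {ν : Fin 3}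
    (hA : ∀ a, DifferentiableAt ℝ (fun y => A y ε ν a) x) (hξ : ContDiff ℝ ∞ ξ) (μ c : Fin 3) :
    pd μ (fun y => so4GaugeVar ξ A y ε ν c) x
      = pd μ (fun y => pd ν (fun z => ξ z ε c) y) x + 2 * ∑ a, ∑ b, levi a b c *
        (pd μ (fun y => ξ y ε a) x * A x ε ν b + ξ x ε a * pd μ (fun y => A y ε ν b) x) := by
  have hξ' : ∀ ε a, ContDiff ℝ ∞ (fun y => ξ y ε a) := fun ε a =>
    contDiff_pi.1 (contDiff_pi.1 hξ ε) a
  have hξd : ∀ a, HasFDerivAt (fun y => ξ y ε a) (fderiv ℝ (fun y => ξ y ε a) x) x := fun a =>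
    ((hξ' ε a).differentiable (by simp) x).hasFDerivAt
  have h1 := ((contDiff_pd (hξ' ε c) ν).differentiable (by simp) x).hasFDerivAt
  have h2 : HasFDerivAt (fun y => 2 * ∑ a, ∑ b, levi a b c * ξ y ε a * A y ε ν b) _ x :=
    (HasFDerivAt.fun_sum fun a _ => HasFDerivAt.fun_sum fun b _ =>
      ((hξd a).const_mul (levi a b c)).mul (hA b).hasFDerivAt).const_mul 2
  have h3 := (h1.add h2).fderiv
  change fderiv ℝ (fun y => so4GaugeVar ξ A y ε ν c) x = _ at h3
  simp only [pd] at h3 ⊢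
  rw [h3]
  simp only [_root_.add_apply, _root_.smul_apply, _root_.sum_apply, smul_eq_mul]
  congr 2
  refine Finset.sum_congr rfl fun a _ => Finset.sum_congr rfl fun b _ => ?_
  ring

/-- The variation of the truncated Lagrangian is a total derivative. -/
lemma deriv_ncsLagrangian {U : Set X3} (hU : IsOpen U) {A : SO4Connection}
    {ξ : X3 → ℤˣ → Fin 3 → ℝ} {P : ℝ → GaugeField} (hA : ContDiffOn ℝ ∞ A U)
    (hξ : ContDiff ℝ ∞ ξ)
    (hP : ∀ t : ℝ, IsPotential U (so4GaugeField A +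
        t • gaugeVar (fun y => so4Field (ξ y)) (so4GaugeField A)) (P t)) {x : X3} (hx : x ∈ U) :
    deriv (fun t : ℝ => ncsLagrangian (so4GaugeField A +
        t • gaugeVar (fun y => so4Field (ξ y)) (so4GaugeField A)) (P t) x) 0
      = ∑ ε : ℤˣ, -Real.pi ^ 2 * (ε : ℤ) * topForm fun μ ν ρ => ∑ e,
        pd μ (fun y => A y ε ν e) x * pd ρ (fun y => ξ y ε e) x := by
  -- The whole line of varied fields stays so(4)-valued, so the truncated Lagrangian applies at
  -- every t, whatever potentials are chosen.
  have hs : ∀ t : ℝ, so4GaugeField A + t • gaugeVar (fun y => so4Field (ξ y)) (so4GaugeField A)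
      = so4GaugeField (A + t • so4GaugeVar ξ A) := by
    intro t
    funext y μ p i
    simp only [Pi.add_apply, Pi.smul_apply, gaugeVar_so4 (hξ.differentiable (by simp) y)]
    simp only [so4GaugeField, so4Field_apply, Pi.add_apply, Pi.smul_apply, smul_eq_mul, add_mul,
      Finset.sum_add_distrib, Finset.mul_sum, mul_assoc]
  have hη := contDiff_so4GaugeVar hA hξ
  have hAd := SO4Connection.differentiableAt hU hA hx
  have hηd := SO4Connection.differentiableAt hU hη hx
  have hL : ∀ t : ℝ, ncsLagrangian (so4GaugeField A +
        t • gaugeVar (fun y => so4Field (ξ y)) (so4GaugeField A)) (P t) x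
      = ∑ ε : ℤˣ, -Real.pi ^ 2 * (ε : ℤ) * csForm
        (fun μ ν e => pd μ (fun y => A y ε ν e) x + t * pd μ (fun y => so4GaugeVar ξ A y ε ν e) x)
        (fun μ e => A x ε μ e + t * so4GaugeVar ξ A x ε μ e) := by
    intro t
    have h1 := hP t
    rw [hs] at h1 ⊢
    have h2 : ContDiffOn ℝ ∞ (A + t • so4GaugeVar ξ A) U := ContDiffOn.add hA (hη.const_smul t)
    rw [ncsLagrangian_so4 (SO4Connection.differentiableAt hU h2 hx)
      fun μ => ⟨(h1 x hx μ).1, (h1 x hx μ).2.2⟩]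
    refine Finset.sum_congr rfl fun ε _ => ?_
    congr 2
    funext μ ν e
    simp only [pd, Pi.add_apply, Pi.smul_apply, smul_eq_mul]
    rw [fderiv_fun_add (hAd ε ν e) ((hηd ε ν e).const_mul t), fderiv_const_mul (hηd ε ν e)]
    simp
  simp only [hL]
  refine (HasDerivAt.fun_sum fun ε _ => (hasDerivAt_csForm _ _ _ _).const_mul _).deriv.trans ?_
  refine Finset.sum_congr rfl fun ε _ => ?_
  congr 1
  rw [← csForm_gaugeVar (fun μ ν e => pd μ (fun y => A y ε ν e) x)
    (fun μ ν e => pd μ (fun y => pd ν (fun z => ξ z ε e) y) x) (A x ε)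
    (fun μ e => pd μ (fun y => ξ y ε e) x) (ξ x ε)
    fun μ ν => funext fun e => pd_comm (contDiff_pi.1 (contDiff_pi.1 hξ ε) e) μ ν x]
  simp only [pd_so4GaugeVar (hAd ε _) hξ]
  rfl

/-- The variation is dA ∧ dξ. Moving the derivative from A onto dξ leaves second derivatives of ξ,
which are symmetric and cancel in the antisymmetrised sum. -/
lemma integral_deriv_ncsLagrangian {U : Set X3} (hU : IsOpen U) {A : SO4Connection}
    {ξ : X3 → ℤˣ → Fin 3 → ℝ} {P : ℝ → GaugeField} (hA : ContDiffOn ℝ ∞ A U)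
    (hξ : ContDiff ℝ ∞ ξ) (hc : HasCompactSupport ξ) (hξU : tsupport ξ ⊆ U)
    (hP : ∀ t : ℝ, IsPotential U (so4GaugeField A +
        t • gaugeVar (fun y => so4Field (ξ y)) (so4GaugeField A)) (P t)) :
    ∫ x in U, deriv (fun t : ℝ => ncsLagrangian (so4GaugeField A +
        t • gaugeVar (fun y => so4Field (ξ y)) (so4GaugeField A)) (P t) x) 0 = 0 := by
  rw [setIntegral_congr_fun hU.measurableSet fun x hx => deriv_ncsLagrangian hU hA hξ hP hx]
  have hξ' : ∀ ε a, ContDiff ℝ ∞ (fun y => ξ y ε a) := fun ε a =>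
    contDiff_pi.1 (contDiff_pi.1 hξ ε) a
  have hsub : ∀ ε a, tsupport (fun y => ξ y ε a) ⊆ tsupport ξ := fun ε a =>
    closure_mono fun y hy => by
      rw [Function.mem_support] at *
      intro h
      simp [h] at hy
  have hsub' : ∀ ρ ε a, tsupport (fun x => pd ρ (fun y => ξ y ε a) x) ⊆ tsupport ξ :=
    fun ρ ε a => (tsupport_pd ρ).trans (hsub ε a)
  have hcs : ∀ ρ ε a, HasCompactSupport (fun x => pd ρ (fun y => ξ y ε a) x) := fun ρ ε a =>
    hc.of_isClosed_subset (isClosed_tsupport _) (hsub' ρ ε a)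
  have hI : ∀ ε μ ν ρ, Integrable (fun x => ∑ e,
      pd μ (fun y => A y ε ν e) x * pd ρ (fun y => ξ y ε e) x) (volume.restrict U) :=
    fun ε μ ν ρ => integrable_finsetSum _ fun e _ => (integrable_mul_of_tsupport
      (contDiffOn_pd hU (SO4Connection.contDiffOn hA ε ν e) μ).continuousOn
      (contDiff_pd (hξ' ε e) ρ).continuous (hcs ρ ε e) ((hsub' ρ ε e).trans hξU)).integrableOn
  have hJ : ∀ ε μ ν ρ, ∫ x in U, ∑ e, pd μ (fun y => A y ε ν e) x * pd ρ (fun y => ξ y ε e) x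
      = - ∑ e, ∫ x, A x ε ν e * pd μ (fun z => pd ρ (fun y => ξ y ε e) z) x := by
    intro ε μ ν ρ
    rw [integral_finsetSum _ fun e _ => (integrable_mul_of_tsupport
      (contDiffOn_pd hU (SO4Connection.contDiffOn hA ε ν e) μ).continuousOn
      (contDiff_pd (hξ' ε e) ρ).continuous (hcs ρ ε e) ((hsub' ρ ε e).trans hξU)).integrableOn,
      ← Finset.sum_neg_distrib]
    exact Finset.sum_congr rfl fun e _ => integral_pd_mul hU (SO4Connection.contDiffOn hA ε ν e)
      (contDiff_pd (hξ' ε e) ρ) (hcs ρ ε e) ((hsub' ρ ε e).trans hξU) μ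
  have hT : ∀ ε, Integrable (fun x => topForm fun μ ν ρ => ∑ e,
      pd μ (fun y => A y ε ν e) x * pd ρ (fun y => ξ y ε e) x) (volume.restrict U) := by
    intro ε
    simp only [topForm, zsmul_eq_mul]
    exact integrable_finsetSum _ fun σ _ => (hI ε _ _ _).const_mul _
  rw [integral_finsetSum _ fun ε _ => (hT ε).const_mul _]
  refine Finset.sum_eq_zero fun ε _ => ?_
  rw [integral_const_mul, integral_topForm (hI ε)]
  have hsym : ∀ μ ν ρ, ∑ e, ∫ x, A x ε ν e * pd μ (fun z => pd ρ (fun y => ξ y ε e) z) x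
      = ∑ e, ∫ x, A x ε ν e * pd ρ (fun z => pd μ (fun y => ξ y ε e) z) x := by
    intro μ ν ρ
    simp only [pd_comm (hξ' ε _) μ ρ]
  rw [topForm_eq]
  simp only [hJ]
  -- Each even permutation is matched with the odd one that exchanges its first and last index.
  rw [hsym 0 1 2, hsym 1 2 0, hsym 2 0 1]
  ring

/-! ### The field equations on `so(4)`-valued fields -/

/-- The components of the curvature of an `so(4)` connection. -/
noncomputable def curvature (A : SO4Connection) (x : X3) (ε : ℤˣ) (μ ν c : Fin 3) : ℝ :=
  pd μ (fun y => A y ε ν c) x - pd ν (fun y => A y ε μ c) x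
    - 2 * ∑ a, ∑ b, levi a b c * A x ε μ a * A x ε ν b

lemma so4Field_eq_zero_iff {c : ℤˣ → Fin 3 → ℝ} :
    (∀ p i, so4Field c p i = 0) ↔ ∀ ε a, c ε a = 0 := by
  constructor
  · intro h ε a
    have h1 : comb c = comb (0 : ℤˣ → Fin 3 → ℝ) := by
      funext p i
      rw [← so4Field_eq_comb, h, comb_apply]
      simp
    rw [comb_injective h1]
    rfl
  · intro h p i
    rw [so4Field_apply]
    simp [h]

/-- F is again so(4)-valued, with the two su(2) curvatures as components, and the components of an
so(4) field are unique. -/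
lemma ncsFieldEquation_iff {U : Set X3} (hU : IsOpen U) {A : SO4Connection}
    (hA : ContDiffOn ℝ ∞ A U) : NCSFieldEquation U (so4GaugeField A) ↔
      ∀ x ∈ U, ∀ μ ν ε c, curvature A x ε μ ν c = 0 := by
  refine forall₂_congr fun x hx => forall₂_congr fun μ ν => ?_
  have hAd := SO4Connection.differentiableAt hU hA hx
  rw [← so4Field_eq_zero_iff (c := fun ε c => curvature A x ε μ ν c)]
  refine forall₂_congr fun p i => ?_
  have h : pd μ (fun y => so4GaugeField A y ν p i) x - pd ν (fun y => so4GaugeField A y μ p i) x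
      + bracket (so4GaugeField A x μ) (so4GaugeField A x ν) p i
      = so4Field (fun ε c => curvature A x ε μ ν c) p i := by
    simp only [so4GaugeField]
    rw [pd_so4Field fun ε a => hAd ε ν a, pd_so4Field fun ε a => hAd ε μ a, bracket_so4Field]
    simp only [so4Field_apply, curvature, ← Finset.sum_sub_distrib, ← Finset.sum_add_distrib]
    refine Finset.sum_congr rfl fun ε _ => Finset.sum_congr rfl fun a _ => ?_
    ring
  rw [h]

lemma pd_dreibein {A : SO4Connection} {x : X3}
    (hA : ∀ ε μ a, DifferentiableAt ℝ (fun y => A y ε μ a) x) (μ ν a : Fin 3) :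
    pd μ (fun y => dreibein A y ν a) x
      = pd μ (fun y => A y 1 ν a) x - pd μ (fun y => A y (-1) ν a) x := by
  simp only [pd, dreibein]
  rw [fderiv_fun_sub (hA 1 ν a) (hA (-1) ν a)]
  rfl

lemma pd_spinConn {A : SO4Connection} {x : X3}
    (hA : ∀ ε μ a, DifferentiableAt ℝ (fun y => A y ε μ a) x) (μ ν a b : Fin 3) :
    pd μ (fun y => spinConn A y ν a b) x
      = ∑ c, levi a b c * (pd μ (fun y => A y 1 ν c) x + pd μ (fun y => A y (-1) ν c) x) := by
  have h : HasFDerivAt (fun y => spinConn A y ν a b) _ x :=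
    HasFDerivAt.fun_sum fun c _ => ((hA 1 ν c).hasFDerivAt.add (hA (-1) ν c).hasFDerivAt).const_mul
      (levi a b c)
  simp only [pd]
  rw [h.fderiv]
  simp [mul_add]

/-- The torsion is the difference of the two su(2) curvatures; the curvature equation is their sum
contracted with ε_{abc}. Both vanish exactly when each su(2) curvature does. -/
lemma deSitterGravity_iff {U : Set X3} (hU : IsOpen U) {A : SO4Connection}
    (hA : ContDiffOn ℝ ∞ A U) : DeSitterGravity U A ↔
      ∀ x ∈ U, ∀ μ ν ε c, curvature A x ε μ ν c = 0 := by
  refine forall₂_congr fun x hx => forall₂_congr fun μ ν => ?_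
  have hAd := SO4Connection.differentiableAt hU hA hx
  have h1 : ∀ a, pd μ (fun y => dreibein A y ν a) x - pd ν (fun y => dreibein A y μ a) x
      + ∑ b, (spinConn A x μ a b * dreibein A x ν b - spinConn A x ν a b * dreibein A x μ b)
      = curvature A x 1 μ ν a - curvature A x (-1) μ ν a := by
    intro a
    rw [pd_dreibein hAd, pd_dreibein hAd]
    simp only [curvature, spinConn, dreibein, Fin.sum_univ_three, levi_eq]
    fin_cases a <;> simp <;> ring
  have h2 : ∀ a b, pd μ (fun y => spinConn A y ν a b) x - pd ν (fun y => spinConn A y μ a b) x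
      + ∑ c, (spinConn A x μ a c * spinConn A x ν c b - spinConn A x ν a c * spinConn A x μ c b)
      - (dreibein A x μ a * dreibein A x ν b - dreibein A x ν a * dreibein A x μ b)
      = ∑ c, levi a b c * (curvature A x 1 μ ν c + curvature A x (-1) μ ν c) := by
    intro a b
    rw [pd_spinConn hAd, pd_spinConn hAd]
    simp only [curvature, spinConn, dreibein, Fin.sum_univ_three, levi_eq]
    fin_cases a <;> fin_cases b <;> simp <;> ring
  simp only [h1]
  have h3 : (∀ a b, pd μ (fun y => spinConn A y ν a b) x - pd ν (fun y => spinConn A y μ a b) x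
      + ∑ c, (spinConn A x μ a c * spinConn A x ν c b - spinConn A x ν a c * spinConn A x μ c b)
      = dreibein A x μ a * dreibein A x ν b - dreibein A x ν a * dreibein A x μ b)
      ↔ ∀ a b, ∑ c, levi a b c * (curvature A x 1 μ ν c + curvature A x (-1) μ ν c) = 0 :=
    forall₂_congr fun a b => by rw [← h2, sub_eq_zero]
  rw [h3]
  constructor
  · rintro ⟨h4, h5⟩ ε c
    have h6 : curvature A x 1 μ ν c + curvature A x (-1) μ ν c = 0 := by
      -- With indices modulo 3, ε_{c+1, c+2, d} is 1 for d = c and 0 otherwise, so this component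
      -- isolates c.
      have := h5 (c + 1) (c + 2)
      simp only [levi_eq, Fin.sum_univ_three] at this
      fin_cases c <;> simpa using this
    have h7 := h4 c
    rcases Int.units_eq_one_or ε with rfl | rfl <;> linarith
  · intro h
    simp [h]

/-! ### The mode expansion -/

lemma V_mem_sdiffS3 (α : HIndex) : V α ∈ sdiffS3 ℂ := by
  rw [V_eq]
  refine mem_sdiffS3_iff.2 ⟨Subtype.prop (normFactor α • harmVF α.j α.ε α.k α.l), ?_⟩
  exact sdiffSub.smul_mem _
    (harmVF_mem lieEnd_basisMat_mem_sdiffSub (topVF_mem_sdiffSub _ _) _ _)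

lemma V_so4Idx_eq_comb (ε : ℤˣ) (n : Fin 3) :
    V (so4Idx ε n) = comb fun δ a => if δ = ε then spinOne n a else 0 := by
  rw [V_so4Idx, comb, Finset.sum_eq_single ε (fun δ _ hδ => by simp [hδ])
    fun h => absurd (Finset.mem_univ ε) h]
  simp

/-- With the first slot arbitrary, the coefficient sees V_α only through its pairings with so(4). -/
lemma E_so4Idx (α : HIndex) (ε δ : ℤˣ) (n m : Fin 3) : E α (so4Idx ε n) (so4Idx δ m)
    = if ε = δ then -((ε : ℤ) : ℂ) * ∑ a, ∑ b, ∑ c, (levi a b c : ℂ) * spinOne n a * spinOne m b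
      * ip (frame ℂ ε c) (V α) else 0 := by
  obtain ⟨h1, h2, h3⟩ := V_mem_sdiffS3 α
  rw [E, V_so4Idx_eq_comb, V_so4Idx_eq_comb, integral_volForm_comb (isSmooth_iff.1 h1) h2 h3,
    Finset.sum_eq_single ε (fun ε' _ hε => by simp [hε]) fun h => absurd (Finset.mem_univ ε) h]
  by_cases h : ε = δ
  · simp [h]
  · simp [h]

/-- Harmonics with j > 1 are orthogonal to so(4), so two modes with j = 1 never source a higher one.
This is what makes the truncation consistent. -/
lemma E_eq_zero {α : HIndex} (hα : 1 < α.j) (β γ : SO4Index) : E α β γ = 0 := by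
  obtain ⟨ε, n, rfl⟩ := so4Idx_eq β
  obtain ⟨δ, m, rfl⟩ := so4Idx_eq γ
  obtain ⟨h1, h2, h3⟩ := mem_MC_iff.1 (V_mem_MC hα)
  have h4 : ∀ ε a, ip (frame ℂ ε a) (V α) = 0 := fun ε a => by
    have := h3 ε a
    rwa [ipForm_apply] at this
  rw [E_so4Idx]
  simp [h4]

lemma ip_frame_V (ε δ : ℤˣ) (n c : Fin 3) : ip (frame ℂ δ c) (V (so4Idx ε n))
    = if δ = ε then 2 * (Real.pi : ℂ) ^ 2 * spinOne n c else 0 := by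
  rw [V_so4Idx_eq_comb, ip_frame_comb]
  simp

lemma fullModeEquations_extendByZero {U : Set X3} {s : Modes SO4Index}
    (h : TruncatedModeEquations U s) : FullModeEquations U (extendByZero s) := by
  intro x hx α μ ν
  have hs : ∀ β : SO4Index, extendByZero s β.1 = s β := by
    intro β
    funext μ x
    simp [extendByZero, β.2]
  -- The double series is supported on pairs of indices with j = 1, so it is a finite sum.
  have hsum : HasSum (fun q : HIndex × HIndex =>
      wedge (extendByZero s) q.1 q.2 μ ν x * E α q.1 q.2)
      (∑ β : SO4Index, ∑ γ : SO4Index, wedge s β γ μ ν x * E α β γ) := by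
    have hinj : Function.Injective
        (fun q : SO4Index × SO4Index => ((q.1.1, q.2.1) : HIndex × HIndex)) := by
      rintro ⟨a, b⟩ ⟨c, d⟩ h
      simp only [Prod.mk.injEq] at h
      exact Prod.ext (Subtype.ext h.1) (Subtype.ext h.2)
    rw [← hinj.hasSum_iff]
    · rw [← Fintype.sum_prod_type']
      convert hasSum_fintype _ using 2 with q
      simp [wedge, hs]
    · rintro ⟨β, γ⟩ hq
      have h0 : ∀ β : HIndex, β.j ≠ 1 → ∀ μ x, extendByZero s β μ x = 0 := fun β hβ μ x => by
        simp [extendByZero, hβ]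
      by_cases hβ : β.j = 1
      · by_cases hγ : γ.j = 1
        · exact absurd ⟨(⟨β, hβ⟩, ⟨γ, hγ⟩), rfl⟩ hq
        · simp [wedge, h0 γ hγ]
      · simp [wedge, h0 β hβ]
  refine ⟨_, hsum, ?_⟩
  by_cases hα : α.j = 1
  · have h1 := h x hx ⟨α, hα⟩ μ ν
    rw [← h1]
    congr 2
    simp only [dStar, hs ⟨α, hα⟩]
  · have h1 : ∑ β : SO4Index, ∑ γ : SO4Index, wedge s β γ μ ν x * E α β γ = 0 :=
      Finset.sum_eq_zero fun β _ => Finset.sum_eq_zero fun γ _ => by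
        rw [E_eq_zero (lt_of_le_of_ne α.one_le_j (Ne.symm hα)), mul_zero]
    rw [h1]
    simp [dStar, extendByZero, hα, pd]

/-- The components of `∑ s_α V_α` in the basis of `so(4)`. -/
noncomputable def modeComponents (s : Modes SO4Index) (x : X3) (ε : ℤˣ) (μ a : Fin 3) : ℂ :=
  ∑ n, s (so4Idx ε n) μ x * spinOne n a

lemma sum_smul_V (s : Modes SO4Index) (x : X3) (μ : Fin 3) :
    ∑ α : SO4Index, s α μ x • V α = comb fun ε a => modeComponents s x ε μ a := by
  rw [sum_so4Index, comb]
  refine Finset.sum_congr rfl fun ε _ => ?_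
  simp only [V_so4Idx, Finset.smul_sum, smul_smul, modeComponents, Finset.sum_smul]
  exact Finset.sum_comm

/-- The `so(4)` connection with the given modes. -/
noncomputable def modeConnection (s : Modes SO4Index) : SO4Connection := fun x ε μ a =>
  (modeComponents s x ε μ a).re

lemma contDiffOn_modeConnection {U : Set X3} {s : Modes SO4Index} (hs : SmoothModes U s) :
    ContDiffOn ℝ ∞ (modeConnection s) U := by
  refine contDiffOn_pi.2 fun ε => contDiffOn_pi.2 fun μ => contDiffOn_pi.2 fun a => ?_
  have h : ContDiffOn ℝ ∞ (fun x => modeComponents s x ε μ a) U :=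
    ContDiffOn.sum fun n _ => (hs _ μ).mul contDiffOn_const
  exact Complex.reCLM.contDiff.comp_contDiffOn h

lemma conj_mode {U : Set X3} {s : Modes SO4Index} (hr : RealModes U (extendByZero s)) {x : X3}
    (hx : x ∈ U) (ε : ℤˣ) (n μ : Fin 3) : (starRingEnd ℂ) (s (so4Idx ε n) μ x)
      = (-1) ^ (n : ℕ) * s (so4Idx ε (2 - n)) μ x := by
  have h := hr (so4Idx ε n) μ x hx
  have hs : ∀ β : SO4Index, extendByZero s β.1 = s β := by
    intro β
    funext μ x
    simp [extendByZero, β.2]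
  have hn : (so4Idx ε n).1.neg = (so4Idx ε (2 - n)).1 := by
    rcases Int.units_eq_one_or ε with rfl | rfl
    · ext <;> simp [HIndex.neg, so4Idx, HIndex.twoQ, HIndex.twoQt]
      fin_cases n <;> rfl
    · ext <;> simp [HIndex.neg, so4Idx, HIndex.twoQ, HIndex.twoQt]
      fin_cases n <;> rfl
  have hc : (so4Idx ε n).1.conjSign = (-1) ^ (n : ℕ) := by
    rcases Int.units_eq_one_or ε with rfl | rfl <;> simp [HIndex.conjSign, so4Idx] <;> ring
  rw [hs, hn, hs, hc] at h
  exact h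

/-- Conjugation maps n to 2 - n with sign (-1)ⁿ both in the modes and in `spinOne`, so it permutes
the three summands. -/
lemma ofReal_modeConnection {U : Set X3} {s : Modes SO4Index} (hr : RealModes U (extendByZero s))
    {x : X3} (hx : x ∈ U) (ε : ℤˣ) (μ a : Fin 3) :
    (modeConnection s x ε μ a : ℂ) = modeComponents s x ε μ a := by
  refine Complex.conj_eq_iff_re.1 ?_
  simp only [modeComponents, Fin.sum_univ_three, map_add, map_mul, conj_mode hr hx, conj_spinOne]
  have e1 : (2 - 1 : Fin 3) = 1 := rfl
  have e2 : (2 - 2 : Fin 3) = 0 := rfl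
  have e0 : (2 - 0 : Fin 3) = 2 := rfl
  rw [e0, e1, e2]
  simp
  ring

/-- The inverse of the mode expansion, from the orthogonality of `spinOne`. The conjugate is used
because the mode equations contain d(s_α)*. -/
lemma conj_mode_eq {U : Set X3} {s : Modes SO4Index} (hr : RealModes U (extendByZero s))
    {x : X3} (hx : x ∈ U) (ε : ℤˣ) (n μ : Fin 3) : (starRingEnd ℂ) (s (so4Idx ε n) μ x)
      = 2 * (Real.pi : ℂ) ^ 2 * ∑ a, spinOne n a * (modeConnection s x ε μ a : ℂ) := by
  apply (starRingEnd ℂ).injective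
  rw [Complex.conj_conj]
  simp only [map_mul, map_sum, Complex.conj_ofReal, map_pow, Complex.conj_ofNat]
  simp only [ofReal_modeConnection hr hx, modeComponents, Finset.mul_sum]
  rw [Finset.sum_comm]
  have h : ∀ m, ∑ a, 2 * (Real.pi : ℂ) ^ 2 * ((starRingEnd ℂ) (spinOne n a)
      * (s (so4Idx ε m) μ x * spinOne m a)) = if n = m then s (so4Idx ε m) μ x else 0 := by
    intro m
    have h1 := spinOne_orthogonal n m
    have h2 : ∑ a, 2 * (Real.pi : ℂ) ^ 2 * ((starRingEnd ℂ) (spinOne n a)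
      * (s (so4Idx ε m) μ x * spinOne m a)) = 2 * (Real.pi : ℂ) ^ 2 * s (so4Idx ε m) μ x
        * ∑ a, (starRingEnd ℂ) (spinOne n a) * spinOne m a := by
      rw [Finset.mul_sum]
      exact Finset.sum_congr rfl fun a _ => by ring
    rw [h2, h1]
    have := pi_ne_zero'
    split_ifs
    · field_simp
    · simp
  simp [h]

lemma dStar_eq {U : Set X3} (hU : IsOpen U) {s : Modes SO4Index} (hs : SmoothModes U s)
    (hr : RealModes U (extendByZero s)) {x : X3} (hx : x ∈ U) (ε : ℤˣ) (n μ ν : Fin 3) :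
    dStar s (so4Idx ε n) μ ν x = 2 * (Real.pi : ℂ) ^ 2 * ∑ a, spinOne n a *
      ((pd μ (fun y => modeConnection s y ε ν a) x - pd ν (fun y => modeConnection s y ε μ a) x : ℝ)
        : ℂ) := by
  have hA := SO4Connection.differentiableAt hU (contDiffOn_modeConnection hs) hx
  have h : ∀ μ ν, pd μ (fun y => (starRingEnd ℂ) (s (so4Idx ε n) ν y)) x = 2 * (Real.pi : ℂ) ^ 2
      * ∑ a, spinOne n a * ((pd μ (fun y => modeConnection s y ε ν a) x : ℝ) : ℂ) := by
    intro μ ν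
    -- The reality condition holds on U only, so the two functions are compared near x, which
    -- suffices for derivatives as U is open.
    have h1 : (fun y => (starRingEnd ℂ) (s (so4Idx ε n) ν y)) =ᶠ[nhds x] fun y =>
        2 * (Real.pi : ℂ) ^ 2 * ∑ a, spinOne n a * (modeConnection s y ε ν a : ℂ) :=
      Filter.eventually_of_mem (hU.mem_nhds hx) fun y hy => conj_mode_eq hr hy ε n ν
    have h2 : HasFDerivAt (fun y => 2 * (Real.pi : ℂ) ^ 2 * ∑ a, spinOne n a *
        (modeConnection s y ε ν a : ℂ)) _ x :=
      (HasFDerivAt.fun_sum fun a _ => (Complex.ofRealCLM.hasFDerivAt.comp x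
        (hA ε ν a).hasFDerivAt).const_mul (spinOne n a)).const_mul (2 * (Real.pi : ℂ) ^ 2)
    simp only [pd]
    rw [h1.fderiv_eq, h2.fderiv]
    simp
  rw [dStar, h, h, ← mul_sub, ← Finset.sum_sub_distrib]
  congr 1
  refine Finset.sum_congr rfl fun a _ => ?_
  push_cast
  ring

/-- The factor 4π² is the norm 2π² of the basis fields times 2 from the antisymmetry of the wedge
product. -/
lemma sum_wedge_E (s : Modes SO4Index) (x : X3) (ε : ℤˣ) (n μ ν : Fin 3) :
    ∑ β : SO4Index, ∑ γ : SO4Index, wedge s β γ μ ν x * E (so4Idx ε n) β γ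
      = -4 * (Real.pi : ℂ) ^ 2 * ((ε : ℤ) : ℂ) * ∑ c, spinOne n c * ∑ a, ∑ b, (levi a b c : ℂ)
        * modeComponents s x ε μ a * modeComponents s x ε ν b := by
  simp only [sum_so4Index, E_so4Idx, ip_frame_V]
  rw [Finset.sum_eq_single ε (fun δ _ hδ => by simp [hδ]) fun h => absurd (Finset.mem_univ ε) h]
  have h1 : ∀ m, ∑ δ, ∑ m', wedge s (so4Idx ε m) (so4Idx δ m') μ ν x *
      (if ε = δ then -((ε : ℤ) : ℂ) * ∑ a, ∑ b, ∑ c, (levi a b c : ℂ) * spinOne m a * spinOne m' b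
        * (if ε = ε then 2 * (Real.pi : ℂ) ^ 2 * spinOne n c else 0) else 0)
      = ∑ m', wedge s (so4Idx ε m) (so4Idx ε m') μ ν x *
      (-((ε : ℤ) : ℂ) * ∑ a, ∑ b, ∑ c, (levi a b c : ℂ) * spinOne m a * spinOne m' b
        * (2 * (Real.pi : ℂ) ^ 2 * spinOne n c)) := by
    intro m
    rw [Finset.sum_eq_single ε (fun δ _ hδ => by simp [Ne.symm hδ])
      fun h => absurd (Finset.mem_univ ε) h]
    simp
  rw [Finset.sum_congr rfl fun m _ => h1 m]
  simp only [wedge, modeComponents, levi_eq, Fin.sum_univ_three]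
  simp
  ring

/-- The equation for (ε, n) is 4π²ε times the curvature components contracted with row n of
`spinOne`. The prefactor is nonzero and the matrix invertible, so all these equations together say
that the curvature vanishes. -/
lemma truncatedModeEquations_iff {U : Set X3} (hU : IsOpen U) {s : Modes SO4Index}
    (hs : SmoothModes U s) (hr : RealModes U (extendByZero s)) : TruncatedModeEquations U s ↔
      ∀ x ∈ U, ∀ μ ν ε c, curvature (modeConnection s) x ε μ ν c = 0 := by
  have h : ∀ x ∈ U, ∀ μ ν ε n, 2 * (((so4Idx ε n).1.ε : ℤ) : ℂ) * dStar s (so4Idx ε n) μ ν x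
      + (((so4Idx ε n).1.j : ℂ) + 1)
        * ∑ β : SO4Index, ∑ γ : SO4Index, wedge s β γ μ ν x * E (so4Idx ε n) β γ
      = 4 * (Real.pi : ℂ) ^ 2 * ((ε : ℤ) : ℂ)
        * ∑ c, spinOne n c * (curvature (modeConnection s) x ε μ ν c : ℂ) := by
    intro x hx μ ν ε n
    rw [dStar_eq hU hs hr hx, sum_wedge_E]
    simp only [← ofReal_modeConnection hr hx, curvature]
    push_cast
    simp only [so4Idx, mul_sub, Finset.sum_sub_distrib]
    push_cast
    simp only [mul_left_comm (spinOne n _) 2, ← Finset.mul_sum]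
    ring
  have h2 : TruncatedModeEquations U s ↔ ∀ x ∈ U, ∀ μ ν ε n,
      ∑ c, spinOne n c * (curvature (modeConnection s) x ε μ ν c : ℂ) = 0 := by
    refine forall₂_congr fun x hx => ?_
    rw [forall_so4Index (P := fun α => ∀ μ ν : Fin 3, 2 * ((α.1.ε : ℤ) : ℂ) * dStar s α μ ν x
      + ((α.1.j : ℂ) + 1) * ∑ β : SO4Index, ∑ γ : SO4Index, wedge s β γ μ ν x * E α β γ = 0)]
    have hne : ∀ ε : ℤˣ, 4 * (Real.pi : ℂ) ^ 2 * ((ε : ℤ) : ℂ) ≠ 0 := by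
      intro ε
      have := pi_ne_zero'
      rcases Int.units_eq_one_or ε with rfl | rfl <;> simp [this]
    constructor
    · intro h3 μ ν ε n
      have h4 := h3 ε n μ ν
      rw [h x hx] at h4
      exact (mul_eq_zero.1 h4).resolve_left (hne ε)
    · intro h3 ε n μ ν
      rw [h x hx, h3, mul_zero]
  rw [h2]
  refine forall₂_congr fun x hx => forall_congr' fun μ => forall₂_congr fun ν ε => ?_
  constructor
  · intro h3 a
    -- Contracting with the conjugate matrix recovers the individual component by completeness.
    have h4 : ∑ n, (starRingEnd ℂ) (spinOne n a)
        * ∑ c, spinOne n c * (curvature (modeConnection s) x ε μ ν c : ℂ) = 0 :=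
      Finset.sum_eq_zero fun n _ => by rw [h3, mul_zero]
    simp only [Finset.mul_sum, ← mul_assoc] at h4
    rw [Finset.sum_comm] at h4
    simp only [← Finset.sum_mul, spinOne_complete] at h4
    have h5 := pi_ne_zero'
    simp [h5] at h4
    exact h4
  · intro h3 n
    simp [h3]

end NCS
-- The main theorem
theorem mainTheorem5 (U : Set X3) (hU : IsOpen U) :
    -- `K = so(4)` is a subalgebra of `sdiff(S³)`, given by the harmonics with `j = 1`
    (so4 ⊆ sdiffS3 ℝ ∧ (∀ X ∈ so4, ∀ Y ∈ so4, bracket X Y ∈ so4) ∧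
      (∀ X : VF ℝ, X ∈ so4 ↔ X ∈ sdiffS3 ℝ ∧ toC X ∈ KC) ∧
      (∀ X : VF ℝ, X ∈ so4 ↔ ∃! c : ℤˣ → Fin 3 → ℝ, X = so4Field c)) ∧
    -- `sdiff(S³) = K ⊕ M`
    (∀ X : VF ℝ, X ∈ sdiffS3 ℝ ↔ ∃! YZ : VF ℝ × VF ℝ, YZ.1 ∈ so4 ∧ YZ.2 ∈ M ∧ X = YZ.1 + YZ.2) ∧
    -- `[M, K] ⊆ M`, for real fields, for complex fields, and for finite sums of harmonics
    (∀ X ∈ M, ∀ Y ∈ so4, bracket X Y ∈ M) ∧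
    (∀ X ∈ MC, ∀ Y ∈ KC, bracket X Y ∈ MC) ∧
    ((harmonicSpan : Set (VF ℂ)) ⊆ MC ∧
      ∀ X ∈ harmonicSpan, ∀ Y ∈ KC, bracket X Y ∈ harmonicSpan) ∧
    -- the Lagrangian and the action of an `so(4)`-valued gauge field are those of `SO(4)`
    -- Chern-Simons theory
    (∀ (A : SO4Connection) (P : GaugeField), ContDiffOn ℝ ∞ A U →
      IsPotential U (so4GaugeField A) P →
      (∀ x ∈ U, ((2 / Real.pi ^ 2 * ncsLagrangian (so4GaugeField A) P x : ℝ) : ℂ)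
        = so4CSLagrangian A x) ∧
      ((2 / Real.pi ^ 2 * ncsAction U (so4GaugeField A) P : ℝ) : ℂ) = so4CSAction U A) ∧
    -- every `so(4)`-valued gauge field has a potential
    (∀ A : SO4Connection, ∃ P : GaugeField, IsPotential U (so4GaugeField A) P) ∧
    -- gauge transformations with `so(4)`-valued parameter preserve the truncation ...
    (∀ (A : SO4Connection) (ξ : X3 → ℤˣ → Fin 3 → ℝ), ContDiffOn ℝ ∞ ξ U → ∀ x ∈ U,
      gaugeVar (fun y => so4Field (ξ y)) (so4GaugeField A) x
        = so4GaugeField (so4GaugeVar ξ A) x) ∧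
    -- ... and the truncated action is invariant under them
    (∀ (A : SO4Connection) (ξ : X3 → ℤˣ → Fin 3 → ℝ) (P : ℝ → GaugeField),
      ContDiffOn ℝ ∞ A U → ContDiff ℝ ∞ ξ → HasCompactSupport ξ → tsupport ξ ⊆ U →
      (∀ t : ℝ, IsPotential U (so4GaugeField A +
        t • gaugeVar (fun y => so4Field (ξ y)) (so4GaugeField A)) (P t)) →
      ∫ x in U, deriv (fun t : ℝ => ncsLagrangian (so4GaugeField A +
        t • gaugeVar (fun y => so4Field (ξ y)) (so4GaugeField A)) (P t) x) 0 = 0) ∧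
    -- solutions of the truncated equations, extended by zero, solve the full equations
    (∀ s : Modes SO4Index, SmoothModes U s → TruncatedModeEquations U s →
      FullModeEquations U (extendByZero s)) ∧
    -- the truncated equations are those of Euclidean de Sitter gravity, and imply `F = 0`
    (∀ s : Modes SO4Index, SmoothModes U s → RealModes U (extendByZero s) →
      ∃ A : SO4Connection, ContDiffOn ℝ ∞ A U ∧
        (∀ x ∈ U, ∀ μ, toC (so4GaugeField A x μ) = ∑ α : SO4Index, s α μ x • V α) ∧
        (TruncatedModeEquations U s ↔ DeSitterGravity U A)) ∧
    (∀ A : SO4Connection, ContDiffOn ℝ ∞ A U →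
      (DeSitterGravity U A ↔ NCSFieldEquation U (so4GaugeField A))) := by
  refine ⟨⟨so4_subset_sdiffS3, fun X hX Y hY => bracket_so4 hX hY, mem_so4_iff_mem_KC,
    mem_so4_iff_existsUnique⟩, mem_sdiffS3_iff_existsUnique, fun X hX Y hY => bracket_M hX hY,
    fun X hX Y hY => bracket_MC hX hY, ⟨harmonicSpan_subset_MC,
    fun X hX Y hY => bracket_harmonicSpan hX hY⟩, ?_, exists_isPotential U, ?_, ?_, ?_, ?_, ?_⟩
  · exact fun A P hA hP => ⟨fun x hx => ncsLagrangian_eq_so4CSLagrangian hU hA hP hx,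
      ncsAction_eq_so4CSAction hU hA hP⟩
  · exact fun A ξ hξ x hx =>
      gaugeVar_so4 ((hξ.contDiffAt (hU.mem_nhds hx)).differentiableAt (by simp))
  · exact fun A ξ P hA hξ hc hξU hP => integral_deriv_ncsLagrangian hU hA hξ hc hξU hP
  · exact fun s _ h => fullModeEquations_extendByZero h
  · intro s hs hr
    refine ⟨modeConnection s, contDiffOn_modeConnection hs, fun x hx μ => ?_, ?_⟩
    · rw [sum_smul_V, so4GaugeField, toC_so4Field]
      congr 1
      funext ε a
      exact ofReal_modeConnection hr hx ε μ a
    -- Both systems are equivalent to the vanishing of the two su(2) curvatures.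
    · rw [truncatedModeEquations_iff hU hs hr, deSitterGravity_iff hU (contDiffOn_modeConnection hs)]
  · exact fun A hA => (deSitterGravity_iff hU hA).trans (ncsFieldEquation_iff hU hA).symm
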